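/- Let $0<q<1$. For a polynomial $f\in\mathbb{C}[z]$ put $\breve f(w)=f\big((w+w^{-1})/2\big)$ for $w\in\mathbb{C}\setminus\{0\}$ (so $\breve f(e^{i\theta})=f(\cos\theta)$), and $e(z)=z$. The Askey-Wilson operator $\mathcal{D}_q$ and the averaging operator $\mathcal{S}_q$ on $\mathbb{C}[z]$ are defined, with $z=(w+w^{-1})/2$, by $$\mathcal{D}_qf(z)=\frac{\breve f(q^{1/2}w)-\breve f(q^{-1/2}w)}{\breve e(q^{1/2}w)-\breve e(q^{-1/2}w)},\qquad \mathcal{S}_qf(z)=\frac{\breve f(q^{1/2}w)+\breve f(q^{-1/2}w)}{2}.$$ An orthogonal polynomial sequence (OPS) is a sequence $(P_n)_{n\ge0}$ in $\mathbb{C}[z]$ with $\deg P_n=n$ for which there is a linear functional $\mathbf{u}$ on $\mathbb{C}[z]$ with $\langle\mathbf{u},P_nP_m\rangle=\kappa_n\delta_{n,m}$, $\kappa_n\neq0$, for all $n,m\ge0$. For $a_1,a_2,a_3,a_4\in\mathbb{C}$ with $a_1\ne0$, $\sigma_4=a_1a_2a_3a_4$, and $$(1-\sigma_4q^n)\prod_{1\le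 i<j\le4}(1-a_ia_jq^n)\neq0\qquad(n=0,1,\dots),$$ the monic Askey-Wilson polynomials $Q_n(\cdot;a_1,a_2,a_3,a_4|q)$ are given by $Q_{-1}=0$, $Q_0=1$, $Q_{n+1}(z)=(z-B_n)Q_n(z)-C_nQ_{n-1}(z)$, where $$2B_n=a_1+\frac1{a_1}-\frac{(1-a_1a_2q^n)(1-a_1a_3q^n)(1-a_1a_4q^n)(1-\sigma_4q^{n-1})}{a_1(1-\sigma_4q^{2n-1})(1-\sigma_4q^{2n})}-\frac{a_1(1-q^n)(1-a_2a_3q^{n-1})(1-a_2a_4q^{n-1})(1-a_3a_4q^{n-1})}{(1-\sigma_4q^{2n-1})(1-\sigma_4q^{2n-2})},$$ $$C_{n+1}=\frac{(1-q^{n+1})(1-\sigma_4q^{n-1})\prod_{1\le i<j\le4}(1-a_ia_jq^n)}{4(1-\sigma_4q^{2n-1})(1-\sigma_4q^{2n})^2(1-\sigma_4q^{2n+1})}$$ (for $n=0$ the common factor $1-\sigma_4q^{-1}$ is cancelled and the last term of $2B_0$ is $0$). A sequence $(Q_n)_{n\ge0}$ of polynomials is called *the Askey-Wilson polynomial sequence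 or a special or limiting case of it* if there are admissible parameters $a^{(k)}=(a_1^{(k)},\dots,a_4^{(k)})$, $k=0,1,\dots$ (possibly constant in $k$), such that for every $n$ the coefficients of $Q_n(\cdot;a_1^{(k)},\dots,a_4^{(k)}|q)$ converge to those of $Q_n$ as $k\to\infty$. **Theorem.** Let $(P_n)_{n\ge0}$ be an OPS such that, with $P_{-1}=0$, $$(az^2+bz+c)\,\mathcal{D}_q\mathcal{S}_qP_n(z)=a_nP_{n+1}(z)+b_nP_n(z)+c_nP_{n-1}(z)\qquad(n=0,1,\dots),$$ where $a,b,c\in\mathbb{C}$ and $(a_n)_{n\ge0},(b_n)_{n\ge0},(c_n)_{n\ge0}$ are sequences of complex numbers with $c_n\neq0$ for every $n\ge1$. Then, up to an affine transformation of the variable, $(P_n)$ is the Askey-Wilson polynomial sequence or a special or limiting case of it: there are such a sequence $(Q_n)_{n\ge0}$, numbers $r,s\in\mathbb{C}$ with $r\neq0$, and nonzero constants $k_n\in\mathbb{C}$ such that $P_n(z)=k_n\,Q_n(rz+s)$ for all $n\ge0$. -/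

import Mathlib

open Polynomial Filter Topology

namespace AskeyWilson

/-- The Joukowski map `w ↦ (w + w⁻¹) / 2`; for `w = e^{iθ}` it is `cos θ`. -/
noncomputable def joukowski (w : ℂ) : ℂ := (w + w⁻¹) / 2

/-- `q^{1/2}`, as a complex number. -/
noncomputable def qHalf (q : ℝ) : ℂ := ((Real.sqrt q : ℝ) : ℂ)

/-- `g = 𝒟_q f`: with `f̆(w) = f((w + w⁻¹)/2)` and `e(x) = x`,
`f̆(q^{1/2} w) - f̆(q^{-1/2} w) = (ĕ(q^{1/2} w) - ĕ(q^{-1/2} w)) · ğ(w)` for all `w ≠ 0`. -/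
def IsDq (q : ℝ) (f g : ℂ[X]) : Prop :=
  ∀ w : ℂ, w ≠ 0 →
    f.eval (joukowski (qHalf q * w)) - f.eval (joukowski ((qHalf q)⁻¹ * w)) =
      (joukowski (qHalf q * w) - joukowski ((qHalf q)⁻¹ * w)) * g.eval (joukowski w)

/-- `g = 𝒮_q f`: `ğ(w) = (f̆(q^{1/2} w) + f̆(q^{-1/2} w)) / 2` for all `w ≠ 0`. -/
def IsSq (q : ℝ) (f g : ℂ[X]) : Prop :=
  ∀ w : ℂ, w ≠ 0 →
    g.eval (joukowski w) =
      (f.eval (joukowski (qHalf q * w)) + f.eval (joukowski ((qHalf q)⁻¹ * w))) / 2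

/-- The Askey–Wilson operator `𝒟_q` on polynomials: the polynomial `g` with `IsDq q f g`
(it exists and is unique for `0 < q < 1`, see `isDq_Dq` and `IsDq.unique`). -/
noncomputable def Dq (q : ℝ) (f : ℂ[X]) : ℂ[X] := Classical.epsilon (IsDq q f)

/-- The averaging operator `𝒮_q` on polynomials: the polynomial `g` with `IsSq q f g`
(it exists and is unique for `0 < q < 1`, see `isSq_Sq` and `IsSq.unique`). -/
noncomputable def Sq (q : ℝ) (f : ℂ[X]) : ℂ[X] := Classical.epsilon (IsSq q f)

theorem qHalf_ne_zero {q : ℝ} (hq : 0 < q) : qHalf q ≠ 0 := by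
  simpa [qHalf] using (Real.sqrt_pos.2 hq).ne'

theorem exists_isDq_isSq {q : ℝ} (hq : 0 < q) (f : ℂ[X]) :
    (∃ g, IsDq q f g) ∧ ∃ g, IsSq q f g := by
  have hp := qHalf_ne_zero hq
  suffices h : ∃ g₁ g₂, IsDq q f g₁ ∧ IsSq q f g₂ by
    obtain ⟨g₁, g₂, h₁, h₂⟩ := h
    exact ⟨⟨g₁, h₁⟩, ⟨g₂, h₂⟩⟩
  generalize hpp : qHalf q = p at hp
  induction f using Polynomial.induction_on' with
  | add f₁ f₂ ih₁ ih₂ =>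
    obtain ⟨g₁, g₂, h₁, h₂⟩ := ih₁
    obtain ⟨k₁, k₂, l₁, l₂⟩ := ih₂
    refine ⟨g₁ + k₁, g₂ + k₂, fun w hw => ?_, fun w hw => ?_⟩
    · simp only [eval_add]
      linear_combination h₁ w hw + l₁ w hw
    · simp only [eval_add]
      linear_combination h₂ w hw + l₂ w hw
  | monomial n a =>
    induction n with
    | zero => exact ⟨0, C a, fun w _ => by simp, fun w _ => by simp⟩
    | succ n ih =>
      obtain ⟨g₁, g₂, h₁, h₂⟩ := ih
      have hm : (monomial (n + 1) a : ℂ[X]) = X * monomial n a := by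
        rw [X_mul_monomial]
      refine ⟨g₂ + C ((p + p⁻¹) / 2) * X * g₁,
        C ((p - p⁻¹) ^ 2 / 4) * (X ^ 2 - 1) * g₁ + C ((p + p⁻¹) / 2) * X * g₂,
        fun w hw => ?_, fun w hw => ?_⟩
      · have e₁ := h₁ w hw
        have e₂ := h₂ w hw
        have hx : joukowski (p * w) + joukowski (p⁻¹ * w) = (p + p⁻¹) * joukowski w := by
          simp only [joukowski]
          field_simp
          ring
        rw [hpp] at *
        simp only [hm, eval_mul, eval_X, eval_add, eval_C]
        linear_combination (-(joukowski (p * w) - joukowski (p⁻¹ * w))) * e₂ +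
          (joukowski (p * w) + joukowski (p⁻¹ * w)) / 2 * e₁ +
          (joukowski (p * w) - joukowski (p⁻¹ * w)) * g₁.eval (joukowski w) / 2 * hx
      · have e₁ := h₁ w hw
        have e₂ := h₂ w hw
        have hx : joukowski (p * w) + joukowski (p⁻¹ * w) = (p + p⁻¹) * joukowski w := by
          simp only [joukowski]
          field_simp
          ring
        have hy : (joukowski (p * w) - joukowski (p⁻¹ * w)) ^ 2 =
            (p - p⁻¹) ^ 2 * (joukowski w ^ 2 - 1) := by
          simp only [joukowski]
          field_simp
          ring
        rw [hpp] at *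
        simp only [hm, eval_mul, eval_X, eval_add, eval_C, eval_sub, eval_pow, eval_one]
        linear_combination ((p + p⁻¹) / 2 * joukowski w) * e₂ -
          (joukowski (p * w) - joukowski (p⁻¹ * w)) / 4 * e₁ -
          g₁.eval (joukowski w) / 4 * hy -
          ((monomial n a).eval (joukowski (p * w)) +
            (monomial n a).eval (joukowski (p⁻¹ * w))) / 4 * hx

theorem isDq_Dq {q : ℝ} (hq : 0 < q) (f : ℂ[X]) : IsDq q f (Dq q f) :=
  Classical.epsilon_spec (exists_isDq_isSq hq f).1

theorem isSq_Sq {q : ℝ} (hq : 0 < q) (f : ℂ[X]) : IsSq q f (Sq q f) :=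
  Classical.epsilon_spec (exists_isDq_isSq hq f).2

theorem eq_of_eval_joukowski {g h : ℂ[X]}
    (H : ∀ w : ℂ, w ≠ 0 → w ^ 2 ≠ 1 → g.eval (joukowski w) = h.eval (joukowski w)) : g = h := by
  refine Polynomial.eq_of_infinite_eval_eq g h ?_
  have hinj : Function.Injective (fun n : ℕ => joukowski ((n : ℂ) + 2)) := by
    intro m n hmn
    have hm : ((m : ℂ) + 2) ≠ 0 := by exact_mod_cast (by omega : m + 2 ≠ 0)
    have hn : ((n : ℂ) + 2) ≠ 0 := by exact_mod_cast (by omega : n + 2 ≠ 0)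
    simp only [joukowski] at hmn
    field_simp at hmn
    have h0 : ((m : ℂ) - n) * ((m + 2) * (n + 2) - 1) = 0 := by linear_combination hmn
    rcases mul_eq_zero.1 h0 with h1 | h1
    · exact_mod_cast sub_eq_zero.1 h1
    · have h2 : (m + 2) * (n + 2) = 1 := by exact_mod_cast sub_eq_zero.1 h1
      nlinarith
  refine (Set.infinite_range_of_injective hinj).mono ?_
  rintro _ ⟨n, rfl⟩
  refine H _ (by exact_mod_cast (by omega : n + 2 ≠ 0)) ?_
  have h4 : 2 ^ 2 ≤ (n + 2) ^ 2 := Nat.pow_le_pow_left (by omega) 2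
  have : (n + 2) ^ 2 ≠ 1 := by omega
  exact_mod_cast this

theorem IsSq.unique {q : ℝ} {f g h : ℂ[X]} (hg : IsSq q f g) (hh : IsSq q f h) : g = h :=
  eq_of_eval_joukowski fun w hw _ => (hg w hw).trans (hh w hw).symm

theorem IsDq.unique {q : ℝ} (hq : 0 < q) (hq1 : q < 1) {f g h : ℂ[X]}
    (hg : IsDq q f g) (hh : IsDq q f h) : g = h := by
  refine eq_of_eval_joukowski fun w hw hw2 => ?_
  have e := (hg w hw).symm.trans (hh w hw)
  refine mul_left_cancel₀ ?_ e
  have hp := qHalf_ne_zero hq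
  have hp2 : qHalf q ^ 2 ≠ 1 := by
    have : qHalf q ^ 2 = (q : ℂ) := by
      rw [qHalf, ← Complex.ofReal_pow, Real.sq_sqrt hq.le]
    rw [this]
    exact_mod_cast hq1.ne
  have : joukowski (qHalf q * w) - joukowski ((qHalf q)⁻¹ * w) =
      (qHalf q ^ 2 - 1) * (w ^ 2 - 1) / (2 * qHalf q * w) := by
    simp only [joukowski]
    field_simp
    ring
  rw [this]
  exact div_ne_zero (mul_ne_zero (sub_ne_zero.2 hp2) (sub_ne_zero.2 hw2))
    (mul_ne_zero (mul_ne_zero two_ne_zero hp) hw)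

/-- `(P_n)` is an orthogonal polynomial sequence (OPS): `deg P_n = n`, and
`⟨u, P_n P_m⟩ = κ_n δ_{nm}` with `κ_n ≠ 0`, for some linear functional `u` on `ℂ[X]`. -/
def IsOPS (P : ℕ → ℂ[X]) : Prop :=
  (∀ n : ℕ, (P n).degree = (n : WithBot ℕ)) ∧
    ∃ u : ℂ[X] →ₗ[ℂ] ℂ,
      (∀ n m : ℕ, n ≠ m → u (P n * P m) = 0) ∧ ∀ n : ℕ, u (P n * P n) ≠ 0

/-- `A_n = (1-a₁a₂qⁿ)(1-a₁a₃qⁿ)(1-a₁a₄qⁿ)(1-σ₄qⁿ⁻¹) / (a₁ (1-σ₄q²ⁿ⁻¹) (1-σ₄q²ⁿ))`, where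
`σ₄ = a₁a₂a₃a₄`; for `n = 0` the common factor `1 - σ₄q⁻¹` is cancelled. -/
noncomputable def coeffA (q a₁ a₂ a₃ a₄ : ℂ) : ℕ → ℂ
  | 0 => (1 - a₁ * a₂) * (1 - a₁ * a₃) * (1 - a₁ * a₄) / (a₁ * (1 - a₁ * a₂ * a₃ * a₄))
  | n + 1 =>
    (1 - a₁ * a₂ * q ^ (n + 1)) * (1 - a₁ * a₃ * q ^ (n + 1)) * (1 - a₁ * a₄ * q ^ (n + 1)) *
        (1 - a₁ * a₂ * a₃ * a₄ * q ^ n) /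
      (a₁ * (1 - a₁ * a₂ * a₃ * a₄ * q ^ (2 * n + 1)) * (1 - a₁ * a₂ * a₃ * a₄ * q ^ (2 * n + 2)))

/-- `a₁(1-qⁿ)(1-a₂a₃qⁿ⁻¹)(1-a₂a₄qⁿ⁻¹)(1-a₃a₄qⁿ⁻¹) / ((1-σ₄q²ⁿ⁻¹)(1-σ₄q²ⁿ⁻²))`,
which is `0` for `n = 0`. -/
noncomputable def coeffC (q a₁ a₂ a₃ a₄ : ℂ) : ℕ → ℂ
  | 0 => 0
  | n + 1 =>
    a₁ * (1 - q ^ (n + 1)) * (1 - a₂ * a₃ * q ^ n) * (1 - a₂ * a₄ * q ^ n) *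
        (1 - a₃ * a₄ * q ^ n) /
      ((1 - a₁ * a₂ * a₃ * a₄ * q ^ (2 * n + 1)) * (1 - a₁ * a₂ * a₃ * a₄ * q ^ (2 * n)))

/-- The recurrence coefficient `B_n` of the monic Askey–Wilson polynomials. -/
noncomputable def awB (q a₁ a₂ a₃ a₄ : ℂ) (n : ℕ) : ℂ :=
  (a₁ + 1 / a₁ - coeffA q a₁ a₂ a₃ a₄ n - coeffC q a₁ a₂ a₃ a₄ n) / 2

/-- The recurrence coefficient `C_{n+1}` of the monic Askey–Wilson polynomials, as a function of
`n`; for `n = 0` the common factor `1 - σ₄q⁻¹` of numerator and denominator is cancelled. -/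
noncomputable def awCsucc (q a₁ a₂ a₃ a₄ : ℂ) : ℕ → ℂ
  | 0 =>
    (1 - q) * ((1 - a₁ * a₂) * (1 - a₁ * a₃) * (1 - a₁ * a₄) *
        (1 - a₂ * a₃) * (1 - a₂ * a₄) * (1 - a₃ * a₄)) /
      (4 * (1 - a₁ * a₂ * a₃ * a₄) ^ 2 * (1 - a₁ * a₂ * a₃ * a₄ * q))
  | n + 1 =>
    (1 - q ^ (n + 2)) * (1 - a₁ * a₂ * a₃ * a₄ * q ^ n) *
        ((1 - a₁ * a₂ * q ^ (n + 1)) * (1 - a₁ * a₃ * q ^ (n + 1)) *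
          (1 - a₁ * a₄ * q ^ (n + 1)) * (1 - a₂ * a₃ * q ^ (n + 1)) *
          (1 - a₂ * a₄ * q ^ (n + 1)) * (1 - a₃ * a₄ * q ^ (n + 1))) /
      (4 * (1 - a₁ * a₂ * a₃ * a₄ * q ^ (2 * n + 1)) *
        (1 - a₁ * a₂ * a₃ * a₄ * q ^ (2 * n + 2)) ^ 2 *
        (1 - a₁ * a₂ * a₃ * a₄ * q ^ (2 * n + 3)))

/-- The monic polynomials with `Q_0 = 1`, `Q_1 = z - B_0` and
`Q_{n+2} = (z - B_{n+1}) Q_{n+1} - C_{n+1} Q_n`; here `c n` stands for `C_{n+1}`. -/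
noncomputable def monicOfTTRR (b c : ℕ → ℂ) : ℕ → ℂ[X]
  | 0 => 1
  | 1 => X - C (b 0)
  | n + 2 => (X - C (b (n + 1))) * monicOfTTRR b c (n + 1) - C (c n) * monicOfTTRR b c n

/-- The monic Askey–Wilson polynomial `Q_n(·; a₁, a₂, a₃, a₄ | q)`. -/
noncomputable def awPoly (q a₁ a₂ a₃ a₄ : ℂ) : ℕ → ℂ[X] :=
  monicOfTTRR (awB q a₁ a₂ a₃ a₄) (awCsucc q a₁ a₂ a₃ a₄)

/-- The restrictions on the Askey–Wilson parameters (with `a₁ ≠ 0`, as the formula for `B_n`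
divides by `a₁`). -/
def Admissible (q a₁ a₂ a₃ a₄ : ℂ) : Prop :=
  a₁ ≠ 0 ∧ ∀ n : ℕ,
    (1 - a₁ * a₂ * a₃ * a₄ * q ^ n) * (1 - a₁ * a₂ * q ^ n) * (1 - a₁ * a₃ * q ^ n) *
      (1 - a₁ * a₄ * q ^ n) * (1 - a₂ * a₃ * q ^ n) * (1 - a₂ * a₄ * q ^ n) *
      (1 - a₃ * a₄ * q ^ n) ≠ 0

/-- `(Q_n)` is the sequence of monic Askey–Wilson polynomials in base `q`, or a special or limiting
case of it: for some admissible parameters `a k = (a₁, a₂, a₃, a₄)`, `k = 0, 1, …`, and for every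
`n`, the monic Askey–Wilson polynomials of degree `n` with parameters `a k` converge
coefficientwise to `Q_n` as `k → ∞`. (A constant sequence of parameters gives the Askey–Wilson
polynomials and their special cases; parameters tending to `0` or `∞` give the limiting cases.) -/
def IsAskeyWilsonOrLimit (q : ℝ) (Q : ℕ → ℂ[X]) : Prop :=
  ∃ a : ℕ → Fin 4 → ℂ,
    (∀ k, Admissible q (a k 0) (a k 1) (a k 2) (a k 3)) ∧
      ∀ n j : ℕ, Tendsto (fun k => (awPoly q (a k 0) (a k 1) (a k 2) (a k 3) n).coeff j)
        atTop (𝓝 ((Q n).coeff j))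

end AskeyWilson

open Polynomial Filter Topology

namespace AskeyWilson

/-! The composite `𝒟_q 𝒮_q` is a nonzero multiple of `D = 𝒟_{q²}`: the middle terms cancel. The
hypothesis is thus a structure relation for `π D`, where `π = az² + bz + c`. With `S = 𝒮_{q²}` and
`α = (q + q⁻¹)/2`, the proof shows that the `P_n` are eigenfunctions of a first-order operator `T =
x S + (l₁ X + l₀) D`, and that such orthogonal polynomials are explicit.

The structure relation makes the adjoint of `π D` with respect to `u` again first-order, `V S + U D`
with `deg V = 1` and `deg U ≤ 2` (`exists_adjoint`). Hence `N = V S + (U - π) D` is antisymmetric.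
If `N` is a commutator `[T, X]` with `T` as above, then `T` is symmetric
(`symmetric_of_commutator`); as it preserves degrees, it is diagonal in the orthogonal basis
(`exists_eigenoperator`).

The main difficulty is that `N` has this commutator form, which amounts to two scalar relations
between `π`, `U` and `V` (`coefficient_relations`). Since `D` and `S` act diagonally on Chebyshev
polynomials, up to passing from `T_n` to `U_{n-1}`, the adjoint identity becomes two recurrences for
the moments `ν_n = u(U_{n-1})`, namely `(A(s) + q⁻ⁿ Π(s)) ν = 0` and `(A(1/s) + qⁿ Π(s)) ν = 0`,
where `s` is the shift in `n`. Eliminating `qⁿ` leaves a recurrence with constant coefficients.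
Regularity of `u` allows only the trivial one, so `A(s/q) A(1/s) = Π(s/q) Π(s)` (`factorization`).
The first scalar relation comes from this together with the second highest coefficients of the
orthogonal polynomials (`linear_relation`), the second one from this, the lowest moments and a
nonzero Hankel determinant (`quadratic_relation`).

Finally, the eigenvalue equation determines the two coefficients below the leading one, hence the
three-term recurrence, in terms of `ρ₀, ρ₁, ς` (`exists_pencil`). For generic `ρ₀` this is the
Askey-Wilson recurrence with parameters `√q, -√q, A, B`, where `A + B = ς/ρ₀` and `AB = ρ₁/ρ₀`.
Every other case is reached by perturbing `ρ₀` (`isAskeyWilsonOrLimit_pencil`). -/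

/-! ### Shift pairs: product rules and realization in base `q²`. -/

/-- `D` and `S` are the divided-difference and the averaging operator attached to a shift with
parameter `α`: they satisfy the product rules of `𝒟_q` and `𝒮_q` with one factor equal to `X`. -/
structure IsShiftPair (α : ℂ) (D S : ℂ[X] →ₗ[ℂ] ℂ[X]) : Prop where
  D_one : D 1 = 0
  S_one : S 1 = 1
  D_X_mul : ∀ f, D (X * f) = S f + C α * X * D f
  S_X_mul : ∀ f, S (X * f) = C (α ^ 2 - 1) * (X ^ 2 - 1) * D f + C α * X * S f

/-- The monomials span `ℂ[X]`: an additive and homogeneous predicate that holds on `1` and is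
stable under multiplication by `X` holds everywhere. -/
theorem induction_X_mul {p : ℂ[X] → Prop} (h1 : p 1) (hadd : ∀ f g, p f → p g → p (f + g))
    (hsmul : ∀ (a : ℂ) f, p f → p (C a * f)) (hX : ∀ f, p f → p (X * f)) (f : ℂ[X]) : p f := by
  induction f using Polynomial.induction_on' with
  | add f g hf hg => exact hadd f g hf hg
  | monomial n a =>
    rw [← C_mul_X_pow_eq_monomial]
    refine hsmul a _ ?_
    induction n with
    | zero => simpa using h1
    | succ n ih => rw [pow_succ']; exact hX _ ih

theorem map_C_mul (L : ℂ[X] →ₗ[ℂ] ℂ[X]) (a : ℂ) (f : ℂ[X]) : L (C a * f) = C a * L f := by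
  rw [← smul_eq_C_mul, ← smul_eq_C_mul, map_smul]

theorem functional_C_mul (u : ℂ[X] →ₗ[ℂ] ℂ) (a : ℂ) (f : ℂ[X]) : u (C a * f) = a * u f := by
  rw [← smul_eq_C_mul, map_smul, smul_eq_mul]

namespace IsShiftPair

variable {α : ℂ} {D S : ℂ[X] →ₗ[ℂ] ℂ[X]}

/-- Both rules must be proved together: multiplying `f` by `X` mixes `D f` and `S f`. -/
theorem D_S_mul (h : IsShiftPair α D S) (f g : ℂ[X]) :
    D (f * g) = D f * S g + S f * D g ∧
      S (f * g) = S f * S g + C (α ^ 2 - 1) * (X ^ 2 - 1) * (D f * D g) := by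
  induction f using induction_X_mul with
  | h1 => simp [h.D_one, h.S_one]
  | hadd f₁ f₂ h₁ h₂ =>
    simp only [add_mul, map_add]
    rw [h₁.1, h₂.1, h₁.2, h₂.2]
    constructor <;> ring
  | hsmul a f hf =>
    rw [mul_assoc, map_C_mul, map_C_mul, map_C_mul, map_C_mul, hf.1, hf.2]
    constructor <;> ring
  | hX f hf =>
    rw [mul_assoc, h.D_X_mul, h.S_X_mul, h.D_X_mul, h.S_X_mul, hf.1, hf.2]
    constructor <;> ring

theorem D_X (h : IsShiftPair α D S) : D X = 1 := by
  have := h.D_X_mul 1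
  simpa [h.D_one, h.S_one] using this

theorem S_X (h : IsShiftPair α D S) : S X = C α * X := by
  have := h.S_X_mul 1
  simpa [h.D_one, h.S_one] using this

/-- First-order operators `V S + U D` satisfy a two-step commutation relation with `X`. -/
theorem comm_comm (h : IsShiftPair α D S) (U V f : ℂ[X]) :
    (V * S (X * (X * f)) + U * D (X * (X * f))) =
      2 * C α * X * (V * S (X * f) + U * D (X * f)) - X ^ 2 * (V * S f + U * D f) -
        C (α ^ 2 - 1) * (V * S f + U * D f) := by
  simp only [h.D_X_mul, h.S_X_mul, C_sub, C_pow, C_1]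
  ring

end IsShiftPair

theorem qHalf_sq {q : ℝ} (hq : 0 < q) : qHalf q ^ 2 = (q : ℂ) := by
  rw [qHalf, ← Complex.ofReal_pow, Real.sq_sqrt hq.le]

theorem qHalf_of_sq {q : ℝ} (hq : 0 < q) : qHalf (q ^ 2) = (q : ℂ) := by
  rw [qHalf, Real.sqrt_sq hq.le]

/-- The operators `𝒟` and `𝒮` in base `q²` form a shift pair, and `𝒟_q 𝒮_q` is a nonzero multiple
of `𝒟_{q²}`. -/
theorem exists_isShiftPair {q : ℝ} (hq : 0 < q) (hq1 : q < 1) :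
    ∃ D S : ℂ[X] →ₗ[ℂ] ℂ[X], IsShiftPair (((q : ℂ) + (q : ℂ)⁻¹) / 2) D S ∧
      ∃ β : ℂ, β ≠ 0 ∧ ∀ f, Dq q (Sq q f) = C β * D f := by
  have hQ : 0 < q ^ 2 := by positivity
  have hQ1 : q ^ 2 < 1 := by nlinarith
  have hqc : (q : ℂ) ≠ 0 := by exact_mod_cast hq.ne'
  have hp := qHalf_ne_zero hq
  let D : ℂ[X] →ₗ[ℂ] ℂ[X] :=
    { toFun := Dq (q ^ 2)
      map_add' := fun f g => (isDq_Dq hQ _).unique hQ hQ1 fun w hw => by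
        have h1 := isDq_Dq hQ f w hw
        have h2 := isDq_Dq hQ g w hw
        simp only [eval_add]
        linear_combination h1 + h2
      map_smul' := fun a f => (isDq_Dq hQ _).unique hQ hQ1 fun w hw => by
        have h1 := isDq_Dq hQ f w hw
        simp only [eval_smul, smul_eq_mul, RingHom.id_apply]
        linear_combination a * h1 }
  let S : ℂ[X] →ₗ[ℂ] ℂ[X] :=
    { toFun := Sq (q ^ 2)
      map_add' := fun f g => (isSq_Sq hQ _).unique fun w hw => by
        have h1 := isSq_Sq hQ f w hw
        have h2 := isSq_Sq hQ g w hw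
        simp only [eval_add]
        linear_combination h1 + h2
      map_smul' := fun a f => (isSq_Sq hQ _).unique fun w hw => by
        have h1 := isSq_Sq hQ f w hw
        simp only [eval_smul, smul_eq_mul, RingHom.id_apply]
        linear_combination a * h1 }
  have hD : ∀ f, IsDq (q ^ 2) f (D f) := fun f => isDq_Dq hQ f
  have hS : ∀ f, IsSq (q ^ 2) f (S f) := fun f => isSq_Sq hQ f
  have hsum : ∀ w : ℂ, w ≠ 0 → joukowski (q * w) + joukowski ((q : ℂ)⁻¹ * w) =
      ((q : ℂ) + (q : ℂ)⁻¹) * joukowski w := by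
    intro w hw
    simp only [joukowski]
    field_simp
    ring
  have hdiff : ∀ w : ℂ, w ≠ 0 → (joukowski (q * w) - joukowski ((q : ℂ)⁻¹ * w)) ^ 2 =
      ((q : ℂ) - (q : ℂ)⁻¹) ^ 2 * (joukowski w ^ 2 - 1) := by
    intro w hw
    simp only [joukowski]
    field_simp
    ring
  have hα : ((q : ℂ) - (q : ℂ)⁻¹) ^ 2 = 4 * ((((q : ℂ) + (q : ℂ)⁻¹) / 2) ^ 2 - 1) := by
    field_simp
    ring
  refine ⟨D, S, ⟨?_, ?_, fun f => ?_, fun f => ?_⟩, (qHalf q + (qHalf q)⁻¹) / 2, ?_, fun f => ?_⟩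
  · exact (hD 1).unique hQ hQ1 fun w hw => by simp
  · exact (hS 1).unique fun w hw => by simp
  · refine (hD _).unique hQ hQ1 fun w hw => ?_
    have h1 := hD f w hw
    have h2 := hS f w hw
    rw [qHalf_of_sq hq] at *
    simp only [eval_mul, eval_X, eval_add, eval_C]
    linear_combination (-(joukowski (q * w) - joukowski ((q : ℂ)⁻¹ * w))) * h2 +
          (joukowski (q * w) + joukowski ((q : ℂ)⁻¹ * w)) / 2 * h1 +
          (joukowski (q * w) - joukowski ((q : ℂ)⁻¹ * w)) * (D f).eval (joukowski w) / 2 *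
            hsum w hw
  · refine (hS _).unique fun w hw => ?_
    have h1 := hD f w hw
    have h2 := hS f w hw
    rw [qHalf_of_sq hq] at *
    simp only [eval_mul, eval_X, eval_add, eval_C, eval_sub, eval_pow, eval_one]
    linear_combination (((q : ℂ) + (q : ℂ)⁻¹) / 2 * joukowski w) * h2 -
          (joukowski (q * w) - joukowski ((q : ℂ)⁻¹ * w)) / 4 * h1 -
          (D f).eval (joukowski w) / 4 * hdiff w hw -
          (D f).eval (joukowski w) / 4 * (joukowski w ^ 2 - 1) * hα -
          (f.eval (joukowski (q * w)) +
            f.eval (joukowski ((q : ℂ)⁻¹ * w))) / 4 * hsum w hw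
  · refine div_ne_zero (fun h0 => ?_) two_ne_zero
    have h1 : qHalf q ^ 2 + 1 = 0 := by
      have := congrArg (fun t => qHalf q * t) h0
      simp only [mul_add, mul_zero, mul_inv_cancel₀ hp] at this
      rw [pow_two]; exact this
    rw [qHalf_sq hq] at h1
    have h2 : q + 1 = 0 := by exact_mod_cast h1
    linarith
  -- Averaging at `q^{1/2} w` and at `q^{-1/2} w` produces the value at `w` twice, and it cancels in
  -- the difference. What remains is half the difference between `q w` and `q⁻¹ w`; the ratio of the
  -- two denominators is `q^{1/2} + q^{-1/2}`.
  · refine (isDq_Dq hq _).unique hq hq1 fun w hw => ?_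
    have h1 := hD f w hw
    have h2 := isSq_Sq hq f (qHalf q * w) (mul_ne_zero hp hw)
    have h3 := isSq_Sq hq f ((qHalf q)⁻¹ * w) (mul_ne_zero (inv_ne_zero hp) hw)
    rw [qHalf_of_sq hq] at h1
    have e1 : qHalf q * (qHalf q * w) = q * w := by rw [← qHalf_sq hq]; ring
    have e2 : (qHalf q)⁻¹ * (qHalf q * w) = w := by field_simp
    have e3 : qHalf q * ((qHalf q)⁻¹ * w) = w := by field_simp
    have e4 : (qHalf q)⁻¹ * ((qHalf q)⁻¹ * w) = (q : ℂ)⁻¹ * w := by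
      rw [← qHalf_sq hq]; field_simp
    rw [e1, e2] at h2
    rw [e3, e4] at h3
    have e5 : (joukowski (qHalf q * w) - joukowski ((qHalf q)⁻¹ * w)) *
        (qHalf q + (qHalf q)⁻¹) = joukowski (q * w) - joukowski ((q : ℂ)⁻¹ * w) := by
      rw [← qHalf_sq hq]
      simp only [joukowski]
      field_simp
      ring
    simp only [eval_mul, eval_C]
    linear_combination h2 - h3 + h1 / 2 - (D f).eval (joukowski w) / 2 * e5

/-! ### Shift pairs on Chebyshev polynomials. -/

/-- `(qⁿ + q⁻ⁿ) / 2`. -/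
noncomputable def qAvg (q : ℂ) (n : ℤ) : ℂ := (q ^ n + (q ^ n)⁻¹) / 2

/-- `(qⁿ - q⁻ⁿ) / (q - q⁻¹)`. -/
noncomputable def qBracket (q : ℂ) (n : ℤ) : ℂ := (q ^ n - (q ^ n)⁻¹) / (q - q⁻¹)

theorem qBracket_zero (q : ℂ) : qBracket q 0 = 0 := by simp [qBracket]

theorem qAvg_zero (q : ℂ) : qAvg q 0 = 1 := by simp [qAvg]

theorem qBracket_neg (q : ℂ) (n : ℤ) : qBracket q (-n) = -qBracket q n := by
  simp only [qBracket, zpow_neg, inv_inv]; ring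

theorem qAvg_neg (q : ℂ) (n : ℤ) : qAvg q (-n) = qAvg q n := by
  simp only [qAvg, zpow_neg, inv_inv]; ring

theorem sub_inv_ne_zero {q : ℂ} (hq : q ≠ 0) (hq2 : q ^ 2 ≠ 1) : q - q⁻¹ ≠ 0 := by
  intro h
  apply hq2
  field_simp at h
  linear_combination h

theorem qBracket_one {q : ℂ} (hq : q ≠ 0) (hq2 : q ^ 2 ≠ 1) : qBracket q 1 = 1 := by
  simp [qBracket, div_self (sub_inv_ne_zero hq hq2)]

/-- This addition formula and the next one have the same shape as the rules `D_X_mul` and `S_X_mul`,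
so inductions over powers of `X` or Chebyshev polynomials close on them. -/
theorem qBracket_add_one {q : ℂ} (hq : q ≠ 0) (hq2 : q ^ 2 ≠ 1) (n : ℤ) :
    qBracket q (n + 1) = (q + q⁻¹) / 2 * qBracket q n + qAvg q n := by
  have := sub_inv_ne_zero hq hq2
  have hn := zpow_ne_zero n hq
  simp only [qBracket, qAvg, zpow_add_one₀ hq, mul_inv]
  generalize (q ^ n)⁻¹ = y
  field_simp
  ring

theorem qAvg_add_one {q : ℂ} (hq : q ≠ 0) (hq2 : q ^ 2 ≠ 1) (n : ℤ) :
    qAvg q (n + 1) = (((q + q⁻¹) / 2) ^ 2 - 1) * qBracket q n + (q + q⁻¹) / 2 * qAvg q n := by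
  have := sub_inv_ne_zero hq hq2
  have e : (((q + q⁻¹) / 2) ^ 2 - 1) = (q - q⁻¹) ^ 2 / 4 := by field_simp; ring
  rw [e]
  simp only [qBracket, qAvg, zpow_add_one₀ hq, mul_inv]
  generalize (q ^ n)⁻¹ = y
  field_simp
  ring

/-- The action of a shift pair on Chebyshev polynomials. -/
theorem IsShiftPair.chebyshev {q : ℂ} (hq : q ≠ 0) (hq2 : q ^ 2 ≠ 1) {D S : ℂ[X] →ₗ[ℂ] ℂ[X]}
    (h : IsShiftPair ((q + q⁻¹) / 2) D S) (n : ℤ) :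
    D (Chebyshev.T ℂ n) = C (qBracket q n) * Chebyshev.U ℂ (n - 1) ∧
      S (Chebyshev.T ℂ n) = C (qAvg q n) * Chebyshev.T ℂ n := by
  induction n using Polynomial.Chebyshev.induct' with
  | zero => simp [qBracket_zero, qAvg_zero, h.D_one, h.S_one]
  | one =>
    have e : qAvg q 1 = (q + q⁻¹) / 2 := by simp [qAvg]
    simp [qBracket_one hq hq2, e, h.D_X, h.S_X]
  | neg n ih =>
    rw [Chebyshev.T_neg, Chebyshev.U_neg_sub_one, ih.1, ih.2, qBracket_neg, qAvg_neg]
    simp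
  | add_two n ih1 ih2 =>
    obtain ⟨d1, s1⟩ := ih1
    obtain ⟨d2, s2⟩ := ih2
    have a1 := qBracket_add_one hq hq2 (n + 1)
    have a2 := qAvg_add_one hq hq2 (n + 1)
    have a3 := qBracket_add_one hq hq2 n
    have a4 := qAvg_add_one hq hq2 n
    rw [add_assoc] at a1 a2
    norm_num at a1 a2
    have e1 : ((n : ℤ) + 1 - 1) = n := by ring
    have e2 : ((n : ℤ) + 2 - 1) = n + 1 := by ring
    rw [e1] at d1
    rw [e2]
    have u1 := Chebyshev.U_add_one ℂ n
    have t1 := Chebyshev.T_eq_X_mul_T_sub_pol_U ℂ n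
    have t2 := Chebyshev.T_add_two ℂ n
    have t3 := Chebyshev.T_eq_U_sub_X_mul_U ℂ (n + 1)
    rw [e1] at t3
    have hmul : Chebyshev.T ℂ (n + 2) = C 2 * (X * Chebyshev.T ℂ (n + 1)) - Chebyshev.T ℂ n := by
      rw [t2, show (C 2 : ℂ[X]) = 2 from map_ofNat C 2]; ring
    have hC1 : C (qBracket q (n + 2)) = C 2 * C ((q + q⁻¹) / 2) * C (qBracket q (n + 1)) -
        C (qBracket q n) := by
      simp only [← C_mul, ← C_sub]
      congr 1
      linear_combination a1 + a4 - (q + q⁻¹) / 2 * a3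
    have hC2 : C (qAvg q (n + 2)) = C 2 * C ((q + q⁻¹) / 2) * C (qAvg q (n + 1)) -
        C (qAvg q n) := by
      simp only [← C_mul, ← C_sub]
      congr 1
      linear_combination a2 + (((q + q⁻¹) / 2) ^ 2 - 1) * a3 - (q + q⁻¹) / 2 * a4
    have hC3 : C (qAvg q (n + 1)) = C (qBracket q (n + 1)) * C ((q + q⁻¹) / 2) -
        C (qBracket q n) := by
      simp only [← C_mul, ← C_sub]
      congr 1
      linear_combination a4 - (q + q⁻¹) / 2 * a3
    have hC4 : C (((q + q⁻¹) / 2) ^ 2 - 1) * C (qBracket q (n + 1)) =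
        C ((q + q⁻¹) / 2) * C (qAvg q (n + 1)) - C (qAvg q n) := by
      simp only [← C_mul, ← C_sub]
      congr 1
      linear_combination (((q + q⁻¹) / 2) ^ 2 - 1) * a3 - (q + q⁻¹) / 2 * a4
    rw [hmul]
    rw [map_sub, map_sub, map_C_mul, map_C_mul, h.D_X_mul, h.S_X_mul, d1, d2, s1, s2]
    rw [hC1, hC2]
    have hC : (C 2 : ℂ[X]) = 2 := map_ofNat C 2
    have e3 : Chebyshev.U ℂ (n - 1) = 2 * X * Chebyshev.U ℂ n - Chebyshev.U ℂ (n + 1) := by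
      linear_combination u1
    rw [e3, hC]
    constructor
    · rw [hC3, t3]
      ring
    · have e5 : (X ^ 2 - 1) * Chebyshev.U ℂ n =
          Chebyshev.T ℂ (n + 2) - X * Chebyshev.T ℂ (n + 1) := by
        linear_combination -t1
      linear_combination 2 * C (((q + q⁻¹) / 2) ^ 2 - 1) * C (qBracket q (n + 1)) * e5 +
        2 * (Chebyshev.T ℂ (n + 2) - X * Chebyshev.T ℂ (n + 1)) * hC4 +
        (2 * C ((q + q⁻¹) / 2) * C (qAvg q (n + 1)) - 2 * C (qAvg q n)) * t2

/-! ### Highest coefficients of images of monomials. -/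

/-- The coefficient functional indexed by `ℤ`. -/
noncomputable def coeffZ (m : ℤ) : ℂ[X] →ₗ[ℂ] ℂ := if 0 ≤ m then lcoeff ℂ m.toNat else 0

theorem coeffZ_natCast (m : ℕ) (f : ℂ[X]) : coeffZ m f = f.coeff m := by simp [coeffZ]

theorem coeffZ_of_neg {m : ℤ} (hm : m < 0) (f : ℂ[X]) : coeffZ m f = 0 := by
  simp [coeffZ, not_le.2 hm]

theorem coeffZ_X_mul (m : ℤ) (f : ℂ[X]) : coeffZ m (X * f) = coeffZ (m - 1) f := by
  rcases lt_trichotomy m 0 with h | h | h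
  · rw [coeffZ_of_neg h, coeffZ_of_neg (by omega)]
  · subst h
    rw [coeffZ_of_neg (m := 0 - 1) (by norm_num)]
    have := coeffZ_natCast 0 (X * f)
    rwa [coeff_X_mul_zero] at this
  · obtain ⟨k, rfl⟩ : ∃ k : ℕ, m = ((k + 1 : ℕ) : ℤ) := ⟨(m - 1).toNat, by omega⟩
    rw [coeffZ_natCast, coeff_X_mul, ← coeffZ_natCast]
    congr 2
    push_cast
    ring

theorem coeffZ_C_mul (m : ℤ) (a : ℂ) (f : ℂ[X]) : coeffZ m (C a * f) = a * coeffZ m f :=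
  functional_C_mul _ _ _

theorem coeffZ_one (m : ℤ) : coeffZ m 1 = if m = 0 then 1 else 0 := by
  rcases lt_or_ge m 0 with h | h
  · rw [coeffZ_of_neg h, if_neg (by omega)]
  · obtain ⟨k, rfl⟩ : ∃ k : ℕ, m = (k : ℤ) := ⟨m.toNat, by omega⟩
    rw [coeffZ_natCast, coeff_one]
    simp

theorem coeffZ_X_pow (m : ℤ) (n : ℕ) : coeffZ m (X ^ n) = if m = n then 1 else 0 := by
  induction n generalizing m with
  | zero => rw [pow_zero, coeffZ_one]; simp
  | succ n ih =>
    rw [pow_succ', coeffZ_X_mul, ih]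
    congr 1
    push_cast
    simp only [eq_iff_iff]
    omega

theorem coeffZ_eq_zero {m : ℤ} {f : ℂ[X]} (h : (f.natDegree : ℤ) < m) : coeffZ m f = 0 := by
  obtain ⟨k, rfl⟩ : ∃ k : ℕ, m = (k : ℤ) := ⟨m.toNat, by omega⟩
  rw [coeffZ_natCast]
  exact coeff_eq_zero_of_natDegree_lt (by omega)

theorem functional_eq_zero_of_natDegree_le {L : ℂ[X] →ₗ[ℂ] ℂ} {n : ℕ}
    (h : ∀ i ≤ n, L (X ^ i) = 0) {f : ℂ[X]} (hf : f.natDegree ≤ n) : L f = 0 := by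
  rw [f.as_sum_range' (n + 1) (by omega), map_sum]
  refine Finset.sum_eq_zero fun i hi => ?_
  rw [← C_mul_X_pow_eq_monomial, functional_C_mul, h i (by simp at hi; omega), mul_zero]

/-- The third highest coefficient of `D Xⁿ`. -/
noncomputable def subcoeffD (q : ℂ) (n : ℤ) : ℂ :=
  (n * qBracket q (n - 2) - (n - 2) * qBracket q n) / 4

/-- The third highest coefficient of `S Xⁿ`. -/
noncomputable def subcoeffS (q : ℂ) (n : ℤ) : ℂ := n * (qAvg q (n - 2) - qAvg q n) / 4

/-- The operators respect parity up to a shift, so every second coefficient vanishes. The ranges `n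
≤ m + 3` and `n ≤ m + 2` stop after the second possibly nonzero coefficient, which is all that the
recurrence coefficients will need. -/
theorem IsShiftPair.coeffZ_X_pow {q : ℂ} (hq : q ≠ 0) (hq2 : q ^ 2 ≠ 1) {D S : ℂ[X] →ₗ[ℂ] ℂ[X]}
    (h : IsShiftPair ((q + q⁻¹) / 2) D S) (n : ℕ) :
    (∀ m : ℤ, n ≤ m + 3 → coeffZ m (D (X ^ n)) =
      (if m + 1 = n then qBracket q n else 0) + if m + 3 = n then subcoeffD q n else 0) ∧
    ∀ m : ℤ, n ≤ m + 2 → coeffZ m (S (X ^ n)) =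
      (if m = n then qAvg q n else 0) + if m + 2 = n then subcoeffS q n else 0 := by
  induction n with
  | zero =>
    rw [pow_zero, h.D_one, h.S_one]
    constructor
    · intro m _
      simp [qBracket_zero, subcoeffD, qBracket_neg]
    · intro m _
      simp [coeffZ_one, qAvg_zero, subcoeffS]
  | succ n ih =>
    obtain ⟨ihD, ihS⟩ := ih
    have g1 := qBracket_add_one hq hq2 n
    have g2 := qBracket_add_one hq hq2 (n - 2)
    have g3 := qBracket_add_one hq hq2 (n - 1)
    have a1 := qAvg_add_one hq hq2 n
    have a2 := qAvg_add_one hq hq2 (n - 2)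
    have a3 := qAvg_add_one hq hq2 (n - 1)
    have c1 : (n : ℤ) - 2 + 1 = n - 1 := by ring
    have c2 : (n : ℤ) - 1 + 1 = n := by ring
    have c3 : (n : ℤ) + 1 - 2 = n - 1 := by ring
    rw [c1] at g2 a2
    rw [c2] at g3 a3
    have hu : subcoeffD q (n + 1) = subcoeffS q n + (q + q⁻¹) / 2 * subcoeffD q n := by
      simp only [subcoeffD, subcoeffS, c3]
      push_cast
      rw [g1, g2]
      have g4 : qBracket q n = (q + q⁻¹) * qBracket q (n - 1) - qBracket q (n - 2) := by
        linear_combination g3 + a2 - (q + q⁻¹) / 2 * g2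
      have g5 : qAvg q n = qBracket q n * ((q + q⁻¹) / 2) - qBracket q (n - 1) := by
        linear_combination a3 - (q + q⁻¹) / 2 * g3
      have g6 : qAvg q (n - 2) = qBracket q (n - 1) - (q + q⁻¹) / 2 * qBracket q (n - 2) := by
        linear_combination -g2
      rw [g5, g6, g4]
      ring
    have hs : subcoeffS q (n + 1) = (((q + q⁻¹) / 2) ^ 2 - 1) * (subcoeffD q n - qBracket q n) +
        (q + q⁻¹) / 2 * subcoeffS q n := by
      simp only [subcoeffD, subcoeffS, c3]
      push_cast
      rw [a1, a2]
      have g7 : (((q + q⁻¹) / 2) ^ 2 - 1) * qBracket q n =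
          (q + q⁻¹) / 2 * qAvg q n - qAvg q (n - 1) := by
        linear_combination (((q + q⁻¹) / 2) ^ 2 - 1) * g3 - (q + q⁻¹) / 2 * a3
      linear_combination -a2 / 4 + g7 / 4
    constructor
    · intro m hm
      rw [pow_succ', h.D_X_mul, map_add, mul_assoc, coeffZ_C_mul, coeffZ_X_mul,
        ihS m (by push_cast at hm; omega), ihD (m - 1) (by push_cast at hm; omega)]
      push_cast
      rw [hu, g1]
      have e1 : (m - 1 + 1 = (n : ℤ)) ↔ m = n := by omega
      have e2 : (m - 1 + 3 = (n : ℤ)) ↔ m + 2 = n := by omega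
      have e3 : (m + 1 = (n : ℤ) + 1) ↔ m = n := by omega
      have e4 : (m + 3 = (n : ℤ) + 1) ↔ m + 2 = n := by omega
      simp only [e1, e2, e3, e4]
      split_ifs <;> ring
    · intro m hm
      have e : C (((q + q⁻¹) / 2) ^ 2 - 1) * (X ^ 2 - 1) * D (X ^ n) + C ((q + q⁻¹) / 2) * X *
          S (X ^ n) = C (((q + q⁻¹) / 2) ^ 2 - 1) * (X * (X * D (X ^ n)) - D (X ^ n)) +
            C ((q + q⁻¹) / 2) * (X * S (X ^ n)) := by ring
      rw [pow_succ', h.S_X_mul, e, map_add, coeffZ_C_mul, coeffZ_C_mul, map_sub, coeffZ_X_mul,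
        coeffZ_X_mul, coeffZ_X_mul, ihS (m - 1) (by push_cast at hm; omega),
        ihD m (by push_cast at hm; omega), ihD (m - 1 - 1) (by push_cast at hm; omega)]
      push_cast
      rw [hs, a1]
      have e1 : (m - 1 - 1 + 1 = (n : ℤ)) ↔ m = n + 1 := by omega
      have e2 : (m - 1 - 1 + 3 = (n : ℤ)) ↔ m + 1 = n := by omega
      have e3 : (m + 3 = (n : ℤ)) ↔ False := by
        push_cast at hm
        exact ⟨fun h => by omega, False.elim⟩
      have e4 : (m - 1 = (n : ℤ)) ↔ m = n + 1 := by omega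
      have e5 : (m - 1 + 2 = (n : ℤ)) ↔ m + 1 = n := by omega
      have e6 : (m + 2 = (n : ℤ) + 1) ↔ m + 1 = n := by omega
      simp only [e1, e2, e3, e4, e5, e6]
      split_ifs <;> first | contradiction | ring

/-! ### Monic orthogonal polynomial sequences. -/

/-- `(M_n)` is the monic orthogonal polynomial sequence of the linear functional `u`. -/
structure IsMonicOPS (u : ℂ[X] →ₗ[ℂ] ℂ) (M : ℕ → ℂ[X]) : Prop where
  monic : ∀ n, (M n).Monic
  natDegree : ∀ n, (M n).natDegree = n
  orth : ∀ n m, n ≠ m → u (M n * M m) = 0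
  norm_ne_zero : ∀ n, u (M n * M n) ≠ 0

namespace IsMonicOPS

variable {u : ℂ[X] →ₗ[ℂ] ℂ} {M : ℕ → ℂ[X]}

theorem coeff_self (hM : IsMonicOPS u M) (n : ℕ) : (M n).coeff n = 1 := by
  have := hM.monic n
  rwa [Monic, leadingCoeff, hM.natDegree] at this

theorem coeff_of_lt (hM : IsMonicOPS u M) {n m : ℕ} (h : n < m) : (M n).coeff m = 0 :=
  coeff_eq_zero_of_natDegree_lt (by rwa [hM.natDegree])

theorem zero_eq_one (hM : IsMonicOPS u M) : M 0 = 1 :=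
  (hM.monic 0).natDegree_eq_zero.1 (hM.natDegree 0)

theorem degree (hM : IsMonicOPS u M) (n : ℕ) : (M n).degree = n := by
  rw [degree_eq_natDegree (hM.monic n).ne_zero, hM.natDegree]

theorem degree_sub_lt (hM : IsMonicOPS u M) {n : ℕ} {f : ℂ[X]} (hf : f.degree < (n + 1 : ℕ)) :
    (f - C (f.coeff n) * M n).degree < n := by
  rw [degree_lt_iff_coeff_zero] at hf ⊢
  intro m hm
  rw [coeff_sub, coeff_C_mul]
  rcases hm.eq_or_lt with rfl | h
  · rw [hM.coeff_self]; ring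
  · rw [hf m h, hM.coeff_of_lt h]; ring

theorem functional_eq_zero (hM : IsMonicOPS u M) {L : ℂ[X] →ₗ[ℂ] ℂ} {n : ℕ}
    (hL : ∀ i < n, L (M i) = 0) {f : ℂ[X]} (hf : f.degree < n) : L f = 0 := by
  induction n generalizing f with
  | zero =>
    have : f = 0 := by
      rw [← degree_eq_bot]; exact Nat.WithBot.lt_zero_iff.1 (by exact_mod_cast hf)
    simp [this]
  | succ n ih =>
    have h1 := ih (fun i hi => hL i (by omega)) (hM.degree_sub_lt hf)
    rw [map_sub, functional_C_mul, hL n (by omega)] at h1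
    simpa using h1

theorem functional_ext (hM : IsMonicOPS u M) {L L' : ℂ[X] →ₗ[ℂ] ℂ}
    (hL : ∀ i, L (M i) = L' (M i)) : L = L' := by
  ext1 i
  have : (L - L') (monomial i 1) = 0 :=
    hM.functional_eq_zero (n := i + 1) (fun i _ => by simp [hL])
      ((degree_monomial_le _ _).trans_lt (by exact_mod_cast Nat.lt_succ_self i))
  ext
  simpa [sub_eq_zero] using this

theorem orth_of_degree_lt (hM : IsMonicOPS u M) {n : ℕ} {f : ℂ[X]} (hf : f.degree < n) :
    u (M n * f) = 0 :=
  hM.functional_eq_zero (L := u ∘ₗ LinearMap.mulLeft ℂ (M n))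
    (fun i hi => by simpa using hM.orth n i (by omega)) hf

/-- Pairing with the highest available `M_n` detects the top coefficient, because `u(M_n²) ≠ 0`;
remove it and descend. -/
theorem eq_zero_of_orth (hM : IsMonicOPS u M) {n : ℕ} {f : ℂ[X]} (hf : f.degree < n)
    (h : ∀ i < n, u (f * M i) = 0) : f = 0 := by
  induction n with
  | zero =>
    rw [← degree_eq_bot]; exact Nat.WithBot.lt_zero_iff.1 (by exact_mod_cast hf)
  | succ n ih =>
    have h1 := hM.degree_sub_lt hf
    have h2 := hM.orth_of_degree_lt h1
    have h3 : f.coeff n * u (M n * M n) = 0 := by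
      rw [mul_comm (M n), sub_mul, map_sub, h n (by omega), mul_assoc, functional_C_mul] at h2
      linear_combination -h2
    have h4 := (mul_eq_zero.1 h3).resolve_right (hM.norm_ne_zero n)
    rw [h4, C_0, zero_mul, sub_zero] at h1
    exact ih h1 fun i hi => h i (by omega)

theorem eq_zero_of_forall (hM : IsMonicOPS u M) {f : ℂ[X]} (h : ∀ g, u (f * g) = 0) : f = 0 :=
  hM.eq_zero_of_orth (n := f.natDegree + 1)
    (degree_le_natDegree.trans_lt (by exact_mod_cast Nat.lt_succ_self _)) fun _ _ => h _

/-- The pairing of `M_n` with a polynomial of degree at most `n + 1`. -/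
theorem pairing (hM : IsMonicOPS u M) {n : ℕ} {f : ℂ[X]} (hf : f.natDegree ≤ n + 1) :
    u (M n * f) = (f.coeff n - f.coeff (n + 1) * (M (n + 1)).coeff n) * u (M n * M n) := by
  have h1 : f.degree < (n + 1 + 1 : ℕ) :=
    degree_le_natDegree.trans_lt (by exact_mod_cast Nat.lt_succ_of_le hf)
  have h2 := hM.degree_sub_lt h1
  have h3 := hM.orth_of_degree_lt (hM.degree_sub_lt h2)
  rw [coeff_sub, coeff_C_mul] at h3
  rw [mul_sub, mul_sub, map_sub, map_sub, mul_left_comm, functional_C_mul, mul_left_comm,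
    functional_C_mul, hM.orth n (n + 1) (by omega)] at h3
  linear_combination h3

/-- The three-term recurrence relation. -/
theorem exists_recurrence (hM : IsMonicOPS u M) :
    ∃ b c : ℕ → ℂ, (∀ n, c n ≠ 0) ∧ M = monicOfTTRR b c := by
  let b : ℕ → ℂ := fun n => u (M n * (X * M n)) / u (M n * M n)
  let c : ℕ → ℂ := fun n => u (M (n + 1) * M (n + 1)) / u (M n * M n)
  have hlt : ∀ n m : ℕ, (∀ k, m ≤ k → (X * M n).coeff k = (M (n + 1)).coeff k) →
      (X * M n - M (n + 1)).degree < (m : WithBot ℕ) := by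
    intro n m h
    rw [degree_lt_iff_coeff_zero]
    intro k hk
    rw [coeff_sub, h k hk, sub_self]
  have hX : ∀ n k, n + 1 ≤ k → (X * M n).coeff k = (M (n + 1)).coeff k := by
    intro n k hk
    obtain ⟨k, rfl⟩ : ∃ j, k = j + 1 := ⟨k - 1, by omega⟩
    rw [coeff_X_mul]
    rcases (Nat.le_of_succ_le_succ hk).eq_or_lt with rfl | h
    · rw [hM.coeff_self, hM.coeff_self]
    · rw [hM.coeff_of_lt h, hM.coeff_of_lt (by omega)]
  have hXd : ∀ n i, i < n → u (M (n + 1) * (X * M i)) = 0 := by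
    intro n i hi
    refine hM.orth_of_degree_lt ?_
    rw [mul_comm, degree_mul_X, hM.degree]
    exact_mod_cast (by omega : i + 1 < n + 1)
  have hXd' : ∀ n, u (M (n + 1) * (X * M n)) = u (M (n + 1) * M (n + 1)) := by
    intro n
    have := hM.orth_of_degree_lt (hlt n (n + 1) (hX n))
    rw [mul_sub, map_sub] at this
    linear_combination this
  have h0 : X * M 0 = M 1 + C (b 0) * M 0 := by
    rw [← sub_eq_zero]
    refine hM.eq_zero_of_orth (n := 1) ?_ ?_
    · rw [← sub_sub]
      refine (degree_sub_le _ _).trans_lt (max_lt (hlt 0 1 (hX 0)) ?_)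
      rw [hM.zero_eq_one, mul_one]
      exact degree_C_le.trans_lt (by exact_mod_cast Nat.one_pos)
    · intro i hi
      obtain rfl : i = 0 := by omega
      have h1 : b 0 * u (M 0 * M 0) = u (M 0 * (X * M 0)) :=
        div_mul_cancel₀ _ (hM.norm_ne_zero 0)
      rw [sub_mul, add_mul, map_sub, map_add, hM.orth 1 0 one_ne_zero, mul_assoc (C _),
        functional_C_mul, mul_comm (X * M 0), ← h1]
      ring
  have hs : ∀ n, X * M (n + 1) = M (n + 2) + C (b (n + 1)) * M (n + 1) + C (c n) * M n := by
    intro n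
    rw [← sub_eq_zero]
    refine hM.eq_zero_of_orth (n := n + 2) ?_ ?_
    · rw [add_assoc, ← sub_sub]
      refine (degree_sub_le _ _).trans_lt (max_lt (hlt _ _ (hX _)) ?_)
      refine (degree_add_le _ _).trans_lt (max_lt ?_ ?_) <;>
        rw [← smul_eq_C_mul] <;> refine (degree_smul_le _ _).trans_lt ?_ <;> rw [hM.degree]
      · exact_mod_cast Nat.lt_succ_self _
      · exact_mod_cast (by omega : n < n + 2)
    · intro i hi
      have e : u ((X * M (n + 1) - (M (n + 2) + C (b (n + 1)) * M (n + 1) + C (c n) * M n)) * M i) =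
          u (M (n + 1) * (X * M i)) - u (M (n + 2) * M i) - b (n + 1) * u (M (n + 1) * M i) -
            c n * u (M n * M i) := by
        rw [sub_mul, add_mul, add_mul, map_sub, map_add, map_add, mul_assoc (C _),
          functional_C_mul, mul_assoc (C _), functional_C_mul]
        ring_nf
      rw [e, hM.orth (n + 2) i (by omega)]
      rcases (Nat.lt_succ_iff.1 hi).eq_or_lt with rfl | h
      · have h1 : b (n + 1) * u (M (n + 1) * M (n + 1)) = u (M (n + 1) * (X * M (n + 1))) :=
          div_mul_cancel₀ _ (hM.norm_ne_zero _)
        rw [hM.orth n (n + 1) (by omega), ← h1]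
        ring
      · rw [hM.orth (n + 1) i (by omega)]
        rcases (Nat.lt_succ_iff.1 h).eq_or_lt with rfl | h'
        · have h1 : c i * u (M i * M i) = u (M (i + 1) * M (i + 1)) :=
            div_mul_cancel₀ _ (hM.norm_ne_zero _)
          rw [hXd', ← h1]
          ring
        · rw [hM.orth n i (by omega), hXd n i h']
          ring
  refine ⟨b, c, fun n => div_ne_zero (hM.norm_ne_zero _) (hM.norm_ne_zero _), ?_⟩
  have key : ∀ n, M n = monicOfTTRR b c n ∧ M (n + 1) = monicOfTTRR b c (n + 1) := by
    intro n
    induction n with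
    | zero =>
      refine ⟨hM.zero_eq_one, ?_⟩
      rw [hM.zero_eq_one] at h0
      simp only [monicOfTTRR]
      linear_combination -h0
    | succ n ih =>
      refine ⟨ih.2, ?_⟩
      simp only [monicOfTTRR]
      rw [← ih.1, ← ih.2]
      linear_combination -(hs n)
  exact _root_.funext fun n => (key n).1

end IsMonicOPS

/-! ### The adjoint of `π D`. -/

/-- The adjoint with respect to `u` of the operator `π D` with tridiagonal lower part is a
first-order operator `V S + U D` with `deg V = 1` and `deg U ≤ 2`. -/
theorem IsMonicOPS.exists_adjoint {u : ℂ[X] →ₗ[ℂ] ℂ} {M : ℕ → ℂ[X]} (hM : IsMonicOPS u M)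
    {α : ℂ} {D S : ℂ[X] →ₗ[ℂ] ℂ[X]} (h : IsShiftPair α D S) {π : ℂ[X]}
    (hE : ∀ n i, i + 1 < n → u (π * D (M n) * M i) = 0) (hπ : u π ≠ 0) :
    ∃ v₀ v₁ U₀ U₁ U₂ : ℂ, v₁ ≠ 0 ∧ u (C v₁ * X + C v₀) = 0 ∧
      ∀ f g, u (π * D f * g) =
        u (f * ((C v₁ * X + C v₀) * S g + (C U₂ * X ^ 2 + C U₁ * X + C U₀) * D g)) := by
  have hM1 : M 1 = X + C ((M 1).coeff 0) := by
    have := (hM.monic 1).eq_X_add_C (hM.natDegree 1)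
    exact this
  have hDM0 : D (M 0) = 0 := by rw [hM.zero_eq_one, h.D_one]
  have hDM1 : D (M 1) = 1 := by
    rw [hM1, map_add, h.D_X, ← mul_one (C _), map_C_mul, h.D_one, mul_zero, add_zero]
  have hXM : X = M 1 - C ((M 1).coeff 0) * M 0 := by
    rw [hM.zero_eq_one, mul_one]; nth_rewrite 1 [hM1]; ring
  set v : ℂ := u π / u (M 1 * M 1) with hv
  have hv0 : v ≠ 0 := div_ne_zero hπ (hM.norm_ne_zero 1)
  let E : ℂ[X] →ₗ[ℂ] ℂ[X] := LinearMap.mulLeft ℂ π ∘ₗ D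
  have hEf : ∀ f, E f = π * D f := fun f => rfl
  -- The case `g = 1` forces this choice: `u(π D M_n)` vanishes for `n ≠ 1`, and `D M_1 = 1` fixes
  -- the constant.
  set V : ℂ[X] := C v * M 1 with hV
  have hP1 : ∀ f, u (π * D f) = u (f * V) := by
    have : u ∘ₗ E = u ∘ₗ LinearMap.mulRight ℂ V := by
      refine hM.functional_ext fun i => ?_
      simp only [LinearMap.comp_apply, hEf, LinearMap.mulRight_apply, hV]
      rw [mul_left_comm, functional_C_mul]
      match i with
      | 0 => rw [hDM0, mul_zero, map_zero, hM.orth 0 1 (by omega), mul_zero]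
      | 1 => rw [hDM1, mul_one, hv, div_mul_cancel₀ _ (hM.norm_ne_zero 1)]
      | n + 2 =>
        have := hE (n + 2) 0 (by omega)
        rw [hM.zero_eq_one, mul_one] at this
        rw [this, hM.orth (n + 2) 1 (by omega), mul_zero]
    intro f
    exact LinearMap.congr_fun this f
  -- Expansion of the functional `f ↦ u(X π D f)` in the orthogonal basis; `hE` with `i = 0, 1`
  -- kills all terms beyond `M 2`.
  let z : ℕ → ℂ := fun i => u (X * (π * D (M i))) / u (M i * M i)
  set Z : ℂ[X] := C (z 0) * M 0 + C (z 1) * M 1 + C (z 2) * M 2 with hZ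
  have hZu : ∀ f, u (X * (π * D f)) = u (f * Z) := by
    have : u ∘ₗ LinearMap.mulLeft ℂ X ∘ₗ E = u ∘ₗ LinearMap.mulRight ℂ Z := by
      refine hM.functional_ext fun i => ?_
      simp only [LinearMap.comp_apply, hEf, LinearMap.mulRight_apply, LinearMap.mulLeft_apply, hZ]
      rw [mul_add, mul_add, map_add, map_add, mul_left_comm (M i), functional_C_mul,
        mul_left_comm (M i), functional_C_mul, mul_left_comm (M i), functional_C_mul]
      have hz : ∀ i, z i * u (M i * M i) = u (X * (π * D (M i))) :=
        fun i => div_mul_cancel₀ _ (hM.norm_ne_zero i)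
      match i with
      | 0 => rw [hz, hM.orth 0 1 (by omega), hM.orth 0 2 (by omega)]; ring
      | 1 => rw [hz, hM.orth 1 0 (by omega), hM.orth 1 2 (by omega)]; ring
      | 2 => rw [hz, hM.orth 2 0 (by omega), hM.orth 2 1 (by omega)]; ring
      | n + 3 =>
        have h1 := hE (n + 3) 1 (by omega)
        have h0 := hE (n + 3) 0 (by omega)
        rw [hM.orth (n + 3) 0 (by omega), hM.orth (n + 3) 1 (by omega),
          hM.orth (n + 3) 2 (by omega), hXM, sub_mul, map_sub, mul_comm (M 1), h1, mul_assoc,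
          functional_C_mul, mul_comm (M 0), h0]
        ring
    intro f
    exact LinearMap.congr_fun this f
  -- As `S X = α X` and `D X = 1`, this is the choice for which the adjoint identity holds at `g =
  -- X`.
  set U : ℂ[X] := Z - C α * X * V with hU
  have hUdeg : U.degree ≤ 2 := by
    have hdeg : ∀ (a : ℂ) (i : ℕ), i ≤ 2 → (C a * M i).degree ≤ 2 := fun a i hi => by
      rw [← smul_eq_C_mul]
      refine (degree_smul_le _ _).trans ?_
      rw [hM.degree]
      exact_mod_cast hi
    refine (degree_sub_le _ _).trans (max_le ?_ ?_)
    · exact (degree_add_le _ _).trans (max_le ((degree_add_le _ _).trans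
        (max_le (hdeg _ 0 (by omega)) (hdeg _ 1 (by omega)))) (hdeg _ 2 (by omega)))
    · rw [hV, mul_assoc, mul_left_comm X, ← smul_eq_C_mul, ← smul_eq_C_mul]
      refine (degree_smul_le _ _).trans ((degree_smul_le _ _).trans ?_)
      rw [mul_comm, degree_mul_X, hM.degree]
      norm_num
  -- The two-step relation `L X² - 2α X L X + X² L + (α² - 1) L = 0` of `comm_comm` is invariant
  -- under transposition. It holds for `L = π D` and for `L = V S + U D`, so the cases `g = 1` and
  -- `g = X` propagate to all powers.
  have key : ∀ n : ℕ, (∀ f, u (π * D f * X ^ n) = u (f * (V * S (X ^ n) + U * D (X ^ n)))) ∧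
      ∀ f, u (π * D f * X ^ (n + 1)) = u (f * (V * S (X ^ (n + 1)) + U * D (X ^ (n + 1)))) := by
    intro n
    induction n with
    | zero =>
      constructor
      · intro f
        simpa [h.S_one, h.D_one] using hP1 f
      · intro f
        have e : V * (C α * X) + U * 1 = Z := by rw [hU]; ring
        rw [zero_add, pow_one, h.S_X, h.D_X, e, mul_comm _ X, hZu]
    | succ n ih =>
      refine ⟨ih.2, fun f => ?_⟩
      have e1 := h.comm_comm π 0 f
      have e2 := h.comm_comm U V (X ^ n)
      simp only [zero_mul, zero_add] at e1
      have e3 : π * D f * X ^ (n + 1 + 1) =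
          C (2 * α) * (π * D (X * f) * X ^ (n + 1)) - π * D (X * (X * f)) * X ^ n -
            C (α ^ 2 - 1) * (π * D f * X ^ n) := by
        rw [e1, C_mul, map_ofNat]; ring
      rw [e3, map_sub, map_sub, functional_C_mul, functional_C_mul, ih.2, ih.1, ih.1,
        ← functional_C_mul, ← functional_C_mul, ← map_sub, ← map_sub]
      congr 1
      rw [pow_succ' X (n + 1), pow_succ' X n, e2, C_mul, map_ofNat]
      ring
  refine ⟨v * (M 1).coeff 0, v, U.coeff 0, U.coeff 1, U.coeff 2, hv0, ?_, fun f g => ?_⟩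
  · have e : C v * X + C (v * (M 1).coeff 0) = C v * (M 1 * M 0) := by
      rw [hM.zero_eq_one, mul_one, C_mul]; nth_rewrite 2 [hM1]; ring
    rw [e, functional_C_mul, hM.orth 1 0 one_ne_zero, mul_zero]
  · have e : C v * X + C (v * (M 1).coeff 0) = V := by
      rw [hV, C_mul]; nth_rewrite 2 [hM1]; ring
    rw [e, ← eq_quadratic_of_degree_le_two hUdeg]
    induction g using Polynomial.induction_on' with
    | add g₁ g₂ h₁ h₂ =>
      rw [map_add D, map_add S, mul_add (π * D f), map_add, h₁, h₂, ← map_add]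
      congr 1
      ring
    | monomial n a =>
      rw [← C_mul_X_pow_eq_monomial, map_C_mul, map_C_mul, mul_left_comm, functional_C_mul,
        (key n).1, ← functional_C_mul]
      congr 1
      ring

/-! ### Chebyshev moments and their recurrences. -/

theorem two_mul_T_mul_U (i m : ℤ) :
    2 * Chebyshev.T ℂ i * Chebyshev.U ℂ m = Chebyshev.U ℂ (m + i) + Chebyshev.U ℂ (m - i) := by
  induction i using Polynomial.Chebyshev.induct' with
  | zero => simp; ring
  | one =>
    have := Chebyshev.U_add_one ℂ m
    rw [Chebyshev.T_one]
    linear_combination -this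
  | neg n ih => rw [Chebyshev.T_neg, ih, sub_neg_eq_add, ← sub_eq_add_neg, add_comm]
  | add_two n ih1 ih2 =>
    have h1 := Chebyshev.T_add_two ℂ n
    have h2 := Chebyshev.U_add_two ℂ (m + n)
    have h3 := Chebyshev.U_sub_two ℂ (m - n)
    rw [show m + (n : ℤ) + 1 = m + (n + 1) by ring, show m + (n : ℤ) + 2 = m + (n + 2) by ring]
      at h2
    rw [show m - (n : ℤ) - 1 = m - (n + 1) by ring, show m - (n : ℤ) - 2 = m - (n + 2) by ring]
      at h3
    linear_combination 2 * Chebyshev.U ℂ m * h1 + 2 * X * ih1 - ih2 - h2 - h3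

/-- The moments of `u` with respect to the Chebyshev polynomials of the second kind. -/
noncomputable def moment (u : ℂ[X] →ₗ[ℂ] ℂ) (n : ℤ) : ℂ := u (Chebyshev.U ℂ (n - 1))

theorem moment_neg (u : ℂ[X] →ₗ[ℂ] ℂ) (n : ℤ) : moment u (-n) = -moment u n := by
  rw [moment, Chebyshev.U_neg_sub_one, map_neg, moment]

theorem moment_zero (u : ℂ[X] →ₗ[ℂ] ℂ) : moment u 0 = 0 := by simp [moment]

theorem functional_X_mul_U (u : ℂ[X] →ₗ[ℂ] ℂ) (n : ℤ) :
    u (X * Chebyshev.U ℂ (n - 1)) = (moment u (n + 1) + moment u (n - 1)) / 2 := by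
  have h := two_mul_T_mul_U 1 (n - 1)
  have e : (X * Chebyshev.U ℂ (n - 1) : ℂ[X]) = C (1 / 2) *
      (Chebyshev.U ℂ (n + 1 - 1) + Chebyshev.U ℂ (n - 1 - 1)) := by
    rw [show n + 1 - 1 = n - 1 + 1 by ring, ← h, Chebyshev.T_one, mul_assoc 2, ← map_ofNat C 2,
      ← mul_assoc (C _), ← C_mul]
    norm_num
  rw [e, functional_C_mul, map_add, moment, moment]
  ring

theorem functional_X_sq_mul_U (u : ℂ[X] →ₗ[ℂ] ℂ) (n : ℤ) :
    u (X ^ 2 * Chebyshev.U ℂ (n - 1)) =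
      (moment u (n + 2) + 2 * moment u n + moment u (n - 2)) / 4 := by
  have h1 := functional_X_mul_U (u ∘ₗ LinearMap.mulLeft ℂ X) n
  simp only [moment, LinearMap.comp_apply, LinearMap.mulLeft_apply, functional_X_mul_U] at h1
  rw [pow_two, mul_assoc, h1]
  simp only [moment]
  ring_nf

theorem two_mul_functional_T (u : ℂ[X] →ₗ[ℂ] ℂ) (n : ℤ) :
    2 * u (Chebyshev.T ℂ n) = moment u (n + 1) - moment u (n - 1) := by
  have h := two_mul_T_mul_U n 0
  rw [Chebyshev.U_zero, mul_one, zero_add, zero_sub, Chebyshev.U_neg, ← map_ofNat C 2] at h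
  rw [← functional_C_mul, h, map_add, map_neg, moment, moment]
  ring_nf

theorem functional_X_mul_T (u : ℂ[X] →ₗ[ℂ] ℂ) (n : ℤ) :
    4 * u (X * Chebyshev.T ℂ n) = moment u (n + 2) - moment u (n - 2) := by
  have h := two_mul_functional_T (u ∘ₗ LinearMap.mulLeft ℂ X) n
  simp only [moment, LinearMap.comp_apply, LinearMap.mulLeft_apply, functional_X_mul_U] at h
  have : (2 : ℂ) * (2 * u (X * Chebyshev.T ℂ n)) = moment u (n + 2) - moment u (n - 2) := by
    rw [h]
    simp only [moment]
    ring_nf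
  linear_combination this

/-- Two recurrences, exchanged by `q ↦ q⁻¹`, with Laurent polynomial coefficients
`A = ∑ Aᵢ sⁱ` and `Π = ∑ pᵢ (sⁱ + s⁻ⁱ)` in the shift `s`. -/
structure MomentRelations (q : ℂ) (ν : ℤ → ℂ) (A₂ A₁ A₀ A₁' A₂' p₂ p₁ p₀ : ℂ) : Prop where
  pos : ∀ n : ℤ, A₂ * ν (n + 2) + A₁ * ν (n + 1) + A₀ * ν n + A₁' * ν (n - 1) + A₂' * ν (n - 2) +
    (q ^ n)⁻¹ * (p₂ * (ν (n + 2) + ν (n - 2)) + p₁ * (ν (n + 1) + ν (n - 1)) + p₀ * ν n) = 0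
  neg : ∀ n : ℤ, A₂' * ν (n + 2) + A₁' * ν (n + 1) + A₀ * ν n + A₁ * ν (n - 1) + A₂ * ν (n - 2) +
    q ^ n * (p₂ * (ν (n + 2) + ν (n - 2)) + p₁ * (ν (n + 1) + ν (n - 1)) + p₀ * ν n) = 0

/-- This symmetry reduces the case `A₂' = 0` to `A₂ = 0`, where the other extreme coefficient is
available as a divisor. -/
theorem MomentRelations.symm {q : ℂ} {ν : ℤ → ℂ} {A₂ A₁ A₀ A₁' A₂' p₂ p₁ p₀ : ℂ}
    (h : MomentRelations q ν A₂ A₁ A₀ A₁' A₂' p₂ p₁ p₀) :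
    MomentRelations q⁻¹ ν A₂' A₁' A₀ A₁ A₂ p₂ p₁ p₀ :=
  ⟨fun n => by simpa using h.neg n, fun n => by simpa using h.pos n⟩

/-- These are the adjoint identity at `(T_n, 1)` and at `(1, T_n)`, rewritten by means of the
diagonal action on Chebyshev polynomials. -/
theorem momentRelations {q : ℂ} (hq : q ≠ 0) (hroot : ∀ n : ℤ, n ≠ 0 → q ^ n ≠ 1)
    {D S : ℂ[X] →ₗ[ℂ] ℂ[X]} (h : IsShiftPair ((q + q⁻¹) / 2) D S) {u : ℂ[X] →ₗ[ℂ] ℂ}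
    {a b c v₀ v₁ U₀ U₁ U₂ : ℂ}
    (hK : ∀ f g, u ((C a * X ^ 2 + C b * X + C c) * D f * g) =
        u (f * ((C v₁ * X + C v₀) * S g + (C U₂ * X ^ 2 + C U₁ * X + C U₀) * D g))) :
    MomentRelations q (moment u) (U₂ / 4 + (q - q⁻¹) * v₁ / 8) (U₁ / 2 + (q - q⁻¹) * v₀ / 4)
      (U₀ + U₂ / 2) (U₁ / 2 - (q - q⁻¹) * v₀ / 4) (U₂ / 4 - (q - q⁻¹) * v₁ / 8)
      (a / 4) (b / 2) (c + a / 2) := by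
  have hq2 : q ^ 2 ≠ 1 := by exact_mod_cast hroot 2 (by norm_num)
  have hh := sub_inv_ne_zero hq hq2
  have quad : ∀ (x y z : ℂ) (n : ℤ), u ((C x * X ^ 2 + C y * X + C z) * Chebyshev.U ℂ (n - 1)) =
      x / 4 * (moment u (n + 2) + moment u (n - 2)) + y / 2 * (moment u (n + 1) + moment u (n - 1))
        + (z + x / 2) * moment u n := by
    intro x y z n
    rw [add_mul, add_mul, mul_assoc, mul_assoc, map_add, map_add, functional_C_mul,
      functional_C_mul, functional_C_mul, functional_X_mul_U, functional_X_sq_mul_U]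
    simp only [moment]
    ring
  have lin : ∀ n : ℤ, u ((C v₁ * X + C v₀) * Chebyshev.T ℂ n) =
      v₁ / 4 * (moment u (n + 2) - moment u (n - 2)) +
        v₀ / 2 * (moment u (n + 1) - moment u (n - 1)) := by
    intro n
    rw [add_mul, mul_assoc, map_add, functional_C_mul, functional_C_mul]
    linear_combination v₁ / 4 * functional_X_mul_T u n + v₀ / 2 * two_mul_functional_T u n
  have r1 : ∀ n : ℤ, qBracket q n * u ((C a * X ^ 2 + C b * X + C c) * Chebyshev.U ℂ (n - 1)) =
      u ((C v₁ * X + C v₀) * Chebyshev.T ℂ n) := by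
    intro n
    have := hK (Chebyshev.T ℂ n) 1
    rw [h.S_one, h.D_one, (h.chebyshev hq hq2 n).1, mul_left_comm, mul_one, functional_C_mul] at this
    rw [this]
    congr 1
    ring
  have r2 : ∀ n : ℤ, qAvg q n * u ((C v₁ * X + C v₀) * Chebyshev.T ℂ n) +
      qBracket q n * u ((C U₂ * X ^ 2 + C U₁ * X + C U₀) * Chebyshev.U ℂ (n - 1)) = 0 := by
    intro n
    have := hK 1 (Chebyshev.T ℂ n)
    rw [h.D_one, (h.chebyshev hq hq2 n).1, (h.chebyshev hq hq2 n).2, one_mul, mul_left_comm,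
      mul_left_comm _ (C (qBracket q n)), map_add, functional_C_mul, functional_C_mul, mul_zero,
      zero_mul, map_zero] at this
    exact this.symm
  have r3 : ∀ n : ℤ, qAvg q n * u ((C a * X ^ 2 + C b * X + C c) * Chebyshev.U ℂ (n - 1)) +
      u ((C U₂ * X ^ 2 + C U₁ * X + C U₀) * Chebyshev.U ℂ (n - 1)) = 0 := by
    intro n
    -- The bracket cannot be cancelled at `n = 0`, but there `U_{-1} = 0` makes the claim trivial.
    rcases eq_or_ne n 0 with rfl | hn
    · simp
    · have hb : qBracket q n ≠ 0 := by
        refine div_ne_zero (fun h0 => ?_) hh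
        have hn' := zpow_ne_zero n hq
        apply hroot (2 * n) (by omega)
        rw [mul_comm, zpow_mul]
        field_simp at h0
        norm_cast
        linear_combination h0
      refine (mul_eq_zero.1 ?_).resolve_left hb
      linear_combination r2 n + qAvg q n * r1 n
  have e1 : ∀ n, (q - q⁻¹) * qBracket q n = q ^ n - (q ^ n)⁻¹ := fun n => by
    rw [qBracket, mul_div_cancel₀ _ hh]
  have e2 : ∀ n, 2 * qAvg q n = q ^ n + (q ^ n)⁻¹ := fun n => by
    rw [qAvg]; ring
  -- The combinations `qAvg ∓ (q - q⁻¹)/2 · qBracket` isolate `q^{∓n}`.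
  constructor
  · intro n
    have h1 := r1 n
    have h3 := r3 n
    rw [lin, quad] at h1
    rw [quad, quad] at h3
    set P := a / 4 * (moment u (n + 2) + moment u (n - 2)) +
      b / 2 * (moment u (n + 1) + moment u (n - 1)) + (c + a / 2) * moment u n
    linear_combination h3 - (q - q⁻¹) / 2 * h1 + P / 2 * e1 n - P / 2 * e2 n
  · intro n
    have h1 := r1 n
    have h3 := r3 n
    rw [lin, quad] at h1
    rw [quad, quad] at h3
    set P := a / 4 * (moment u (n + 2) + moment u (n - 2)) +
      b / 2 * (moment u (n + 1) + moment u (n - 1)) + (c + a / 2) * moment u n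
    linear_combination h3 + (q - q⁻¹) / 2 * h1 - P / 2 * e1 n - P / 2 * e2 n

/-- A functional with a Chebyshev moment recurrence with constant coefficients of order `8`,
symmetric under `s ↦ q / s`, is degenerate unless the recurrence is trivial. -/
theorem IsMonicOPS.const_recurrence {u : ℂ[X] →ₗ[ℂ] ℂ} {M : ℕ → ℂ[X]} (hM : IsMonicOPS u M)
    {q : ℂ} (hroot : ∀ n : ℤ, n ≠ 0 → q ^ n ≠ 1) {φ₄ φ₃ φ₂ φ₁ φ₀ : ℂ}
    (hφ : ∀ n : ℤ, φ₄ * (moment u (n + 4) + q ^ 4 * moment u (n - 4)) +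
      φ₃ * (moment u (n + 3) + q ^ 3 * moment u (n - 3)) +
      φ₂ * (moment u (n + 2) + q ^ 2 * moment u (n - 2)) +
      φ₁ * (moment u (n + 1) + q * moment u (n - 1)) + φ₀ * moment u n = 0) :
    φ₄ = 0 ∧ φ₃ = 0 ∧ φ₂ = 0 ∧ φ₁ = 0 ∧ φ₀ = 0 := by
  -- Since `ν` is odd, subtracting the recurrence at `-n` from the one at `n` turns the `j`-th term
  -- into `φ_j (1 + q^j) (ν_{n+j} + ν_{n-j})`, which is the pairing of a multiple of `T_j` with a
  -- `U_m`. So the recurrence says that `R` is orthogonal to every `U_m`.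
  set R : ℂ[X] := C (φ₄ * (1 + q ^ 4)) * Chebyshev.T ℂ 4 + C (φ₃ * (1 + q ^ 3)) * Chebyshev.T ℂ 3 +
    C (φ₂ * (1 + q ^ 2)) * Chebyshev.T ℂ 2 + C (φ₁ * (1 + q)) * Chebyshev.T ℂ 1 + C φ₀ with hR
  have hT : ∀ i m : ℤ, u (Chebyshev.T ℂ i * Chebyshev.U ℂ m) =
      (moment u (m + 1 + i) + moment u (m + 1 - i)) / 2 := by
    intro i m
    have h1 := congrArg u (two_mul_T_mul_U i m)
    rw [mul_assoc, ← map_ofNat C 2, functional_C_mul, map_add] at h1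
    simp only [moment]
    rw [show m + 1 + i - 1 = m + i by ring, show m + 1 - i - 1 = m - i by ring]
    linear_combination h1 / 2
  have hU : ∀ m : ℤ, u (R * Chebyshev.U ℂ m) = 0 := by
    intro m
    have h1 := hφ (m + 1)
    have h2 := hφ (-(m + 1))
    rw [show -(m + 1) + 4 = -(m + 1 - 4) by ring, show -(m + 1) + 3 = -(m + 1 - 3) by ring,
      show -(m + 1) + 2 = -(m + 1 - 2) by ring, show -(m + 1) + 1 = -(m + 1 - 1) by ring,
      show -(m + 1) - 4 = -(m + 1 + 4) by ring, show -(m + 1) - 3 = -(m + 1 + 3) by ring,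
      show -(m + 1) - 2 = -(m + 1 + 2) by ring, show -(m + 1) - 1 = -(m + 1 + 1) by ring] at h2
    simp only [moment_neg] at h2
    rw [hR]
    simp only [add_mul, map_add, mul_assoc, functional_C_mul, hT]
    have h3 : u (Chebyshev.U ℂ m) = moment u (m + 1) := by simp [moment]
    rw [h3]
    linear_combination h1 / 2 - h2 / 2
  have hXU : ∀ (k : ℕ) (m : ℤ), u (R * (X ^ k * Chebyshev.U ℂ m)) = 0 := by
    intro k
    induction k with
    | zero => intro m; simpa using hU m
    | succ k ih =>
      intro m
      have e : R * (X ^ (k + 1) * Chebyshev.U ℂ m) = C (1 / 2) *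
          (R * (X ^ k * Chebyshev.U ℂ (m + 1)) + R * (X ^ k * Chebyshev.U ℂ (m - 1))) := by
        have h1 := two_mul_T_mul_U 1 m
        rw [Chebyshev.T_one] at h1
        rw [← mul_add, ← mul_add, ← h1, pow_succ, mul_assoc 2, ← map_ofNat C 2,
          mul_left_comm _ (C 2), mul_left_comm _ (C 2), ← mul_assoc (C _), ← C_mul, mul_assoc]
        norm_num
      rw [e, functional_C_mul, map_add, ih, ih]
      ring
  have hR0 : R = 0 := by
    refine hM.eq_zero_of_forall fun g => ?_
    induction g using Polynomial.induction_on' with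
    | add g₁ g₂ h₁ h₂ => rw [mul_add, map_add, h₁, h₂, add_zero]
    | monomial n a =>
      have := hXU n 0
      rw [Chebyshev.U_zero, mul_one] at this
      rw [← C_mul_X_pow_eq_monomial, mul_left_comm, functional_C_mul, this, mul_zero]
  have t2 : Chebyshev.T ℂ 2 = 2 * X ^ 2 - 1 := Chebyshev.T_two ℂ
  have t3 : Chebyshev.T ℂ 3 = 4 * X ^ 3 - 3 * X := by
    have := Chebyshev.T_add_two ℂ 1
    norm_num [t2] at this
    rw [this]; ring
  have t4 : Chebyshev.T ℂ 4 = 8 * X ^ 4 - 8 * X ^ 2 + 1 := by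
    have := Chebyshev.T_add_two ℂ 2
    norm_num [t2, t3] at this
    rw [this]; ring
  have hRX : R = C (8 * (φ₄ * (1 + q ^ 4))) * X ^ 4 + C (4 * (φ₃ * (1 + q ^ 3))) * X ^ 3 +
      C (2 * (φ₂ * (1 + q ^ 2)) - 8 * (φ₄ * (1 + q ^ 4))) * X ^ 2 +
      C (φ₁ * (1 + q) - 3 * (φ₃ * (1 + q ^ 3))) * X +
      C (φ₀ - φ₂ * (1 + q ^ 2) + φ₄ * (1 + q ^ 4)) := by
    rw [hR, t2, t3, t4, Chebyshev.T_one]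
    simp only [C_mul, C_add, C_sub, map_ofNat]
    ring
  rw [hRX] at hR0
  have hne : ∀ i : ℕ, i ≠ 0 → 1 + q ^ i ≠ 0 := by
    intro i hi h0
    apply hroot (2 * i) (by omega)
    rw [mul_comm, zpow_mul, zpow_natCast]
    norm_cast
    linear_combination (q ^ i - 1) * h0
  have n1 := hne 1 one_ne_zero
  rw [pow_one] at n1
  have n2 := hne 2 two_ne_zero
  have n3 := hne 3 three_ne_zero
  have n4 := hne 4 four_ne_zero
  have c4 := congrArg (fun f => coeff f 4) hR0
  have c3 := congrArg (fun f => coeff f 3) hR0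
  have c2 := congrArg (fun f => coeff f 2) hR0
  have c1 := congrArg (fun f => coeff f 1) hR0
  have c0 := congrArg (fun f => coeff f 0) hR0
  simp only [coeff_add, coeff_C_mul, coeff_X_pow, coeff_X, coeff_C, coeff_zero] at c4 c3 c2 c1 c0
  norm_num at c4 c3 c2 c1 c0
  have z4 := c4.resolve_right n4
  have z3 := c3.resolve_right n3
  simp only [z4, zero_mul, mul_zero, sub_zero, mul_eq_zero, z3] at c2 c1
  have z2 := (c2.resolve_left two_ne_zero).resolve_right n2
  have z1 := c1.resolve_right n1
  simp only [z4, z2, zero_mul, sub_zero, add_zero] at c0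
  exact ⟨z4, z3, z2, z1, c0⟩

/-- The coefficients of `A(s/q) A(1/s) = Π(s/q) Π(s)`. -/
theorem IsMonicOPS.factorization {u : ℂ[X] →ₗ[ℂ] ℂ} {M : ℕ → ℂ[X]} (hM : IsMonicOPS u M)
    {q : ℂ} (hq : q ≠ 0) (hroot : ∀ n : ℤ, n ≠ 0 → q ^ n ≠ 1)
    {A₂ A₁ A₀ A₁' A₂' p₂ p₁ p₀ : ℂ}
    (h : MomentRelations q (moment u) A₂ A₁ A₀ A₁' A₂' p₂ p₁ p₀) :
    A₂ * A₂' = p₂ ^ 2 ∧ A₂ * A₁' + q * A₁ * A₂' = (1 + q) * p₁ * p₂ ∧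
      A₂ * A₀ + q * A₁ * A₁' + q ^ 2 * A₀ * A₂' = (1 + q ^ 2) * p₀ * p₂ + q * p₁ ^ 2 ∧
      A₂ ^ 2 + q * A₁ ^ 2 + q ^ 2 * A₀ ^ 2 + q ^ 3 * A₁' ^ 2 + q ^ 4 * A₂' ^ 2 =
        (1 + q ^ 4) * p₂ ^ 2 + (q + q ^ 3) * p₁ ^ 2 + q ^ 2 * p₀ ^ 2 := by
  -- Apply `q² A(s/q)` to the relation `neg`: as `q^{n+i} q^{-i} = qⁿ`, its second part becomes
  -- `q^{n+2} A(s) Π(s) ν`. By `pos`, the operator `Π(s/q)` yields the same term from `A(s) ν`. The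
  -- difference is the constant-coefficient recurrence `q² (A(s/q) A(1/s) - Π(s/q) Π(s)) ν = 0`,
  -- invariant under `s ↦ q/s`.
  obtain ⟨f4, f3, f2, -, f0⟩ := hM.const_recurrence hroot
    (φ₄ := A₂ * A₂' - p₂ ^ 2)
    (φ₃ := A₂ * A₁' + q * A₁ * A₂' - (1 + q) * p₁ * p₂)
    (φ₂ := A₂ * A₀ + q * A₁ * A₁' + q ^ 2 * A₀ * A₂' - (1 + q ^ 2) * p₀ * p₂ - q * p₁ ^ 2)
    (φ₁ := A₂ * A₁ + q * A₁ * A₀ + q ^ 2 * A₀ * A₁' + q ^ 3 * A₁' * A₂' -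
      (1 + q ^ 3) * p₂ * p₁ - (q + q ^ 2) * p₀ * p₁)
    (φ₀ := A₂ ^ 2 + q * A₁ ^ 2 + q ^ 2 * A₀ ^ 2 + q ^ 3 * A₁' ^ 2 + q ^ 4 * A₂' ^ 2 -
      ((1 + q ^ 4) * p₂ ^ 2 + (q + q ^ 3) * p₁ ^ 2 + q ^ 2 * p₀ ^ 2)) (fun n => by
      have hn := zpow_ne_zero n hq
      have m2 := h.neg (n + 2)
      have m1 := h.neg (n + 1)
      have m0 := h.neg n
      have m3 := h.neg (n - 1)
      have m4 := h.neg (n - 2)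
      have k2 := h.pos (n + 2)
      have k1 := h.pos (n + 1)
      have k0 := h.pos n
      have k3 := h.pos (n - 1)
      have k4 := h.pos (n - 2)
      rw [show n + 2 + 2 = n + 4 by ring, show n + 2 + 1 = n + 3 by ring,
        show n + 2 - 1 = n + 1 by ring, show n + 2 - 2 = n by ring] at m2 k2
      rw [show n + 1 + 2 = n + 3 by ring, show n + 1 + 1 = n + 2 by ring,
        show n + 1 - 1 = n by ring, show n + 1 - 2 = n - 1 by ring] at m1 k1
      rw [show n - 1 + 2 = n + 1 by ring, show n - 1 + 1 = n by ring,
        show n - 1 - 1 = n - 2 by ring, show n - 1 - 2 = n - 3 by ring] at m3 k3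
      rw [show n - 2 + 2 = n by ring, show n - 2 + 1 = n - 1 by ring,
        show n - 2 - 1 = n - 3 by ring, show n - 2 - 2 = n - 4 by ring] at m4 k4
      have z2 : q ^ (n + 2) = q ^ n * q ^ 2 := by rw [zpow_add₀ hq]; norm_cast
      have z1 : q ^ (n + 1) = q ^ n * q := zpow_add_one₀ hq n
      have z3 : q ^ (n - 1) = q ^ n * q⁻¹ := zpow_sub_one₀ hq n
      have z4 : q ^ (n - 2) = q ^ n * (q ^ 2)⁻¹ := by rw [zpow_sub₀ hq]; norm_cast
      rw [z2] at m2 k2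
      rw [z1] at m1 k1
      rw [z3] at m3 k3
      rw [z4] at m4 k4
      generalize q ^ n = y at *
      have inv_form : ∀ {x P z t : ℂ}, z ≠ 0 → t ≠ 0 → x + (z * t)⁻¹ * P = 0 →
          z * t * x + P = 0 := by
        intro x P z t hz ht h0
        field_simp at h0
        linear_combination h0
      have inv_form' : ∀ {x P z t : ℂ}, z ≠ 0 → t ≠ 0 → x + (z * t⁻¹)⁻¹ * P = 0 →
          z * x + t * P = 0 := by
        intro x P z t hz ht h0
        field_simp at h0
        linear_combination h0
      have mul_form : ∀ {x P z t : ℂ}, t ≠ 0 → x + z * t⁻¹ * P = 0 → t * x + z * P = 0 := by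
        intro x P z t ht h0
        field_simp at h0
        linear_combination h0
      rw [← mul_one y] at k0
      have k2' := inv_form hn (pow_ne_zero 2 hq) k2
      have k1' := inv_form hn hq k1
      have k0' := inv_form hn one_ne_zero k0
      have k3' := inv_form' hn hq k3
      have k4' := inv_form' hn (pow_ne_zero 2 hq) k4
      have m3' := mul_form hq m3
      have m4' := mul_form (pow_ne_zero 2 hq) m4
      clear m3 m4 k2 k1 k0 k3 k4 z1 z2 z3 z4
      linear_combination A₂ * m2 + A₁ * q * m1 + A₀ * q ^ 2 * m0 + A₁' * q ^ 2 * m3' +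
        A₂' * q ^ 2 * m4' - p₂ * k2' - p₁ * q * k1' - p₀ * q ^ 2 * k0' - p₁ * q ^ 2 * k3' -
        p₂ * q ^ 2 * k4')
  exact ⟨by linear_combination f4, by linear_combination f3, by linear_combination f2,
    by linear_combination f0⟩

/-! ### The linear and the quadratic relation between the coefficients. -/

theorem coeff_eq_zero_of_powers {q : ℂ} (hq : q ≠ 0) (hroot : ∀ n : ℤ, n ≠ 0 → q ^ n ≠ 1)
    {e₀ e₁ e₂ e₃ e₄ : ℂ} (h : ∀ n : ℕ, e₀ + e₁ * q ^ n + e₂ * (q ^ n) ^ 2 + e₃ * (q ^ n) ^ 3 +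
      e₄ * (q ^ n) ^ 4 = 0) : e₁ = 0 := by
  have hp : (C e₀ + C e₁ * X + C e₂ * X ^ 2 + C e₃ * X ^ 3 + C e₄ * X ^ 4 : ℂ[X]) = 0 := by
    refine eq_zero_of_infinite_isRoot _ ?_
    have hinj : Function.Injective (fun n : ℕ => q ^ n) := by
      intro m n hmn
      by_contra hne
      apply hroot ((m : ℤ) - n) (by omega)
      rw [zpow_sub₀ hq, zpow_natCast, zpow_natCast]
      simp only at hmn
      rw [hmn, div_self (pow_ne_zero _ hq)]
    refine (Set.infinite_range_of_injective hinj).mono ?_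
    rintro _ ⟨n, rfl⟩
    simp only [Set.mem_ofPred_eq, IsRoot, eval_add, eval_mul, eval_C, eval_X, eval_pow]
    exact h n
  have := congrArg (fun f => coeff f 1) hp
  simp only [coeff_add, coeff_C_mul, coeff_X_pow, coeff_X, coeff_C, coeff_zero] at this
  norm_num at this
  exact this

/-- First-order relations satisfied by the subleading coefficients `F n` of the orthogonal
polynomials force a linear relation between the coefficients. -/
theorem linear_relation_of_ne_zero {q : ℂ} (hq : q ≠ 0) (hroot : ∀ n : ℤ, n ≠ 0 → q ^ n ≠ 1)
    {A₂ A₁ A₁' A₂' p₂ p₁ : ℂ} (hA : A₂ * A₂' = p₂ ^ 2) (hne : A₂ ≠ A₂') (hA' : A₂' ≠ 0)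
    {F : ℕ → ℂ} (hF0 : F 0 = 0)
    (h1 : ∀ n : ℕ, (A₁ - p₁) * q ^ n - (A₁' - p₁) * (q ^ n)⁻¹ =
      2 * ((A₂ - p₂) * q ^ n - (A₂' - p₂) * (q ^ n)⁻¹) * F (n + 1) -
      2 * ((A₂ - p₂) * q ^ n * q⁻¹ - (A₂' - p₂) * q * (q ^ n)⁻¹) * F n)
    (h2 : ∀ n : ℕ, A₁ * (q ^ n) ^ 2 - A₁' * ((q ^ n)⁻¹) ^ 2 =
      2 * (A₂ * (q ^ n) ^ 2 - A₂' * ((q ^ n)⁻¹) ^ 2) * F (n + 1) -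
      2 * (A₂ * (q ^ n) ^ 2 * (q⁻¹) ^ 2 - A₂' * q ^ 2 * ((q ^ n)⁻¹) ^ 2) * F n) :
    A₁ + q * A₁' = (1 + q) * p₁ := by
  -- By `hA`, `A₂ / A₂'` is the square of `p₂ / A₂' = q ρ`, so the coefficients of `h1` and `h2`
  -- factor.
  obtain ⟨ρ, rfl⟩ : ∃ ρ, p₂ = q * ρ * A₂' := ⟨p₂ / (q * A₂'), by field_simp⟩
  obtain rfl : A₂ = q ^ 2 * ρ ^ 2 * A₂' := by
    apply mul_right_cancel₀ hA'; linear_combination hA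
  have hq1 : q - 1 ≠ 0 := sub_ne_zero.2 (by simpa using hroot 1 one_ne_zero)
  have hθ : q * ρ - 1 ≠ 0 := by
    intro h0
    apply hne
    linear_combination (q * ρ + 1) * A₂' * h0
  -- With this weight `h1` telescopes, so `y` is a sum of two geometric progressions (`hyc`).
  -- Differences of squares in `h2` contain the same weight (`hy2`).
  set y : ℕ → ℂ := fun n => 2 * A₂' * (q * ρ - 1) * (ρ * q ^ n + q * (q ^ n)⁻¹) * F n with hy
  have hy1 : ∀ n, y (n + 1) - y n = (A₁ - p₁) * q ^ n - (A₁' - p₁) * (q ^ n)⁻¹ := by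
    intro n
    rw [h1 n]
    simp only [hy, pow_succ, mul_inv]
    have hn := pow_ne_zero n hq
    field_simp
    ring
  have hyc : ∀ n, (q - 1) * y n =
      (A₁ - p₁) * (q ^ n - 1) + q * (A₁' - p₁) * ((q ^ n)⁻¹ - 1) := by
    intro n
    induction n with
    | zero => simp [hy, hF0]
    | succ n ih =>
      have := hy1 n
      rw [sub_eq_iff_eq_add] at this
      rw [this, mul_add, ih, pow_succ, mul_inv]
      have hn := pow_ne_zero n hq
      field_simp
      ring
  have hy2 : ∀ n, (q * ρ - 1) * (A₁ * (q ^ n) ^ 2 - A₁' * ((q ^ n)⁻¹) ^ 2) =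
      (q * ρ * q ^ n - (q ^ n)⁻¹) * y (n + 1) - (ρ * q ^ n - q * (q ^ n)⁻¹) * y n := by
    intro n
    rw [h2 n]
    simp only [hy, pow_succ, mul_inv]
    have hn := pow_ne_zero n hq
    field_simp
    ring
  -- Inserting the closed form of `y` into `hy2` gives a polynomial of degree at most four that
  -- vanishes at every `qⁿ`; its linear coefficient is the claim.
  have key := coeff_eq_zero_of_powers hq hroot
    (e₀ := q * (A₁' - p₁) + (q * ρ - 1) * A₁' + (A₁' - p₁))
    (e₁ := -(A₁ - p₁) - q * (A₁' - p₁))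
    (e₂ := 0)
    (e₃ := -ρ * (A₁ - p₁) - ρ * q * (A₁' - p₁))
    (e₄ := ρ * (A₁ - p₁) - (q * ρ - 1) * A₁ + q * ρ * (A₁ - p₁)) (fun n => by
      have e1 := hyc n
      have e2 := hy1 n
      have e3 := hy2 n
      rw [sub_eq_iff_eq_add] at e2
      rw [e2] at e3
      have hn := pow_ne_zero n hq
      generalize q ^ n = x at *
      generalize y n = z at *
      have e4 : x * ((q - 1) * z) = (A₁ - p₁) * (x ^ 2 - x) + q * (A₁' - p₁) * (1 - x) := by
        rw [e1]; field_simp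
      have e5 : (ρ * x ^ 2 + 1) * (x * ((q - 1) * z)) =
          (q * ρ - 1) * (A₁ * x ^ 4 - A₁') -
            (q * ρ * x ^ 2 - 1) * ((A₁ - p₁) * x ^ 2 - (A₁' - p₁)) := by
        field_simp at e3
        linear_combination -e3
      rw [e4] at e5
      linear_combination e5)
  linear_combination -key

/-- The normalization is `A₂' = 1`, `ν₁ = 1`, `A₂ = q²ρ²`, `p₂ = qρ`. The hypotheses are the moment
relations at `n = 0, 1`, the factorization, the linear relation, and a nonzero Hankel determinant.
The latter excludes the spurious branches of the algebraic system. -/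
theorem quadratic_relation_aux {q : ℂ} (hq : q ≠ 0) (hroot : ∀ n : ℤ, n ≠ 0 → q ^ n ≠ 1)
    {A₁ A₀ A₁' p₁ p₀ ρ ν₂ ν₃ : ℂ} (hρ : q ^ 2 * ρ ^ 2 ≠ 1)
    (hz : (q ^ 2 * ρ ^ 2 - 1) * ν₂ + A₁ - A₁' = 0)
    (hi : ν₃ + A₁' * ν₂ + A₀ - q ^ 2 * ρ ^ 2 + q * (q * ρ * (ν₃ - 1) + p₁ * ν₂ + p₀) = 0)
    (hj : q * (q ^ 2 * ρ ^ 2 * ν₃ + A₁ * ν₂ + A₀ - 1) + (q * ρ * (ν₃ - 1) + p₁ * ν₂ + p₀) = 0)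
    (h2 : q ^ 2 * ρ ^ 2 * A₁' + q * A₁ = (1 + q) * p₁ * (q * ρ))
    (h3 : q ^ 2 * ρ ^ 2 * A₀ + q * A₁ * A₁' + q ^ 2 * A₀ =
      (1 + q ^ 2) * p₀ * (q * ρ) + q * p₁ ^ 2)
    (h5 : (q ^ 2 * ρ ^ 2) ^ 2 + q * A₁ ^ 2 + q ^ 2 * A₀ ^ 2 + q ^ 3 * A₁' ^ 2 + q ^ 4 =
        (1 + q ^ 4) * (q * ρ) ^ 2 + (q + q ^ 3) * p₁ ^ 2 + q ^ 2 * p₀ ^ 2)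
    (hw : A₁ + q * A₁' = (1 + q) * p₁) (hn : ν₃ + 1 - ν₂ ^ 2 ≠ 0) :
    q * (A₀ - p₀) + q ^ 2 * ρ ^ 2 + q ^ 2 = (1 + q ^ 2) * (q * ρ) := by
  have hq1 : q - 1 ≠ 0 := sub_ne_zero.2 (by simpa using hroot 1 one_ne_zero)
  have hpow : ∀ i : ℕ, i ≠ 0 → 1 + q ^ i ≠ 0 := by
    intro i hi h0
    apply hroot (2 * i) (by omega)
    rw [mul_comm, zpow_mul, zpow_natCast]
    norm_cast
    linear_combination (q ^ i - 1) * h0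
  have hq2 : 1 + q ≠ 0 := by simpa using hpow 1 one_ne_zero
  have hq3 : 1 + q ^ 2 ≠ 0 := hpow 2 two_ne_zero
  have hm : q * ρ - 1 ≠ 0 := fun h0 => hρ (by linear_combination (q * ρ + 1) * h0)
  have hp : 1 + q * ρ ≠ 0 := fun h0 => hρ (by linear_combination (q * ρ - 1) * h0)
  have hA1 : A₁ = (1 + q) * p₁ - q * A₁' := by linear_combination hw
  by_cases hρ1 : ρ = 1
  · exfalso
    subst hρ1
    have e1 : p₁ = A₁' - (q - 1) * ν₂ := by
      apply mul_left_cancel₀ hq2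
      linear_combination hz - hw
    subst e1
    obtain rfl : A₁ = A₁' - (q ^ 2 - 1) * ν₂ := by linear_combination hz
    have e2 : p₀ = 2 * q - (A₁' - (q - 1) * ν₂) * ν₂ - q * ν₂ ^ 2 := by
      apply mul_left_cancel₀ (mul_ne_zero hq1 hq2)
      linear_combination q * hi - hj
    subst e2
    have e3 : A₀ = q ^ 2 + 1 - ν₂ * (A₁' + ν₂) := by
      apply mul_left_cancel₀ (mul_ne_zero two_ne_zero (pow_ne_zero 2 hq))
      linear_combination h3
    subst e3
    apply hn
    apply mul_left_cancel₀ hq3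
    linear_combination hi
  · have e1 : (1 + q) * p₁ = q * A₁' * (1 + ρ) := by
      apply mul_left_cancel₀ (sub_ne_zero.2 (Ne.symm hρ1))
      apply mul_left_cancel₀ hq
      rw [hA1] at h2
      linear_combination h2
    rw [e1] at hA1
    have e2 : A₁' = -(1 + q * ρ) * ν₂ := by
      rw [hA1] at hz
      apply mul_left_cancel₀ hm
      linear_combination hz
    obtain ⟨t, rfl⟩ : ∃ t, ν₂ = (1 + q) * t := ⟨ν₂ / (1 + q), by field_simp⟩
    have e3 : p₁ = -q * (1 + ρ) * (1 + q * ρ) * t := by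
      apply mul_left_cancel₀ hq2
      rw [e1, e2]
      ring
    -- `δ` and `ε` measure the deviation of `A₀` and `p₀` from values for which the conclusion
    -- holds. They satisfy the homogeneous linear system `d1`, `d2`, which is degenerate only for `ρ
    -- = -1`.
    obtain ⟨δ, rfl⟩ : ∃ δ, A₀ = ρ * (1 + q ^ 2) + q * (1 + q * ρ) ^ 2 * t ^ 2 + δ :=
      ⟨A₀ - (ρ * (1 + q ^ 2) + q * (1 + q * ρ) ^ 2 * t ^ 2), by ring⟩
    obtain ⟨ε, rfl⟩ : ∃ ε, p₀ = q * (1 + ρ ^ 2 + (1 + q * ρ) ^ 2 * t ^ 2) + ε :=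
      ⟨p₀ - q * (1 + ρ ^ 2 + (1 + q * ρ) ^ 2 * t ^ 2), by ring⟩
    rw [e2] at hA1
    subst hA1 e2 e3
    have d1 : (1 - ρ) * q * δ = (ρ * q ^ 2 - 1) * ε := by
      linear_combination -q * ρ * hi + hj
    have d2 : q * (1 + ρ ^ 2) * δ = (1 + q ^ 2) * ρ * ε := by
      apply mul_left_cancel₀ hq
      linear_combination h3
    have d3 : (1 + ρ) * ε = 0 := by
      apply mul_left_cancel₀ (sub_ne_zero.2 hρ)
      linear_combination (1 - ρ) * d2 - (1 + ρ ^ 2) * d1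
    rcases mul_eq_zero.1 d3 with hρm | hε
    · obtain rfl : ρ = -1 := by linear_combination hρm
      obtain ⟨s, rfl⟩ : ∃ s, ε = 2 * q * s := ⟨ε / (2 * q), by field_simp⟩
      obtain rfl : δ = -(1 + q ^ 2) * s := by
        apply mul_left_cancel₀ (mul_ne_zero two_ne_zero hq)
        linear_combination d1
      -- On the degenerate branch the sum-of-squares equation `h5` leaves two solutions; the nonzero
      -- one contradicts `hn`.
      have d5 : s * (s + 2 - 2 * q * t ^ 2) = 0 := by
        apply mul_left_cancel₀ (mul_ne_zero (pow_ne_zero 2 hq)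
          (pow_ne_zero 2 (mul_ne_zero hq1 hq2)))
        linear_combination h5
      rcases mul_eq_zero.1 d5 with rfl | hs
      · ring
      · exfalso
        obtain rfl : s = 2 * q * t ^ 2 - 2 := by linear_combination hs
        apply hn
        apply mul_left_cancel₀ (mul_ne_zero hq1 hq2)
        linear_combination -hi
    · subst hε
      have d4 : δ = 0 := by
        apply mul_left_cancel₀ (mul_ne_zero hq (sub_ne_zero.2 (Ne.symm hρ1)))
        linear_combination d1
      subst d4
      ring

theorem MomentRelations.quadratic_relation_of_ne_zero {q : ℂ} (hq : q ≠ 0)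
    (hroot : ∀ n : ℤ, n ≠ 0 → q ^ n ≠ 1) {u : ℂ[X] →ₗ[ℂ] ℂ} {M : ℕ → ℂ[X]}
    (hM : IsMonicOPS u M) {A₂ A₁ A₀ A₁' A₂' p₂ p₁ p₀ : ℂ}
    (h : MomentRelations q (moment u) A₂ A₁ A₀ A₁' A₂' p₂ p₁ p₀)
    (hne : A₂ ≠ A₂') (hA' : A₂' ≠ 0) (hw : A₁ + q * A₁' = (1 + q) * p₁) :
    q * (A₀ - p₀) + A₂ + q ^ 2 * A₂' = (1 + q ^ 2) * p₂ := by
  obtain ⟨f4, f3, f2, f0⟩ := hM.factorization hq hroot h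
  have m1 : moment u 1 ≠ 0 := by
    have := hM.norm_ne_zero 0
    simpa [moment, hM.zero_eq_one] using this
  have hu1 : moment u 1 = u 1 := by simp [moment]
  have hu2 : moment u 2 = 2 * u X := by
    have : Chebyshev.U ℂ (2 - 1) = C 2 * X := by
      rw [show (2 - 1 : ℤ) = 1 by norm_num, Chebyshev.U_one, map_ofNat]
    rw [moment, this, functional_C_mul]
  have hu3 : moment u 3 = 4 * u (X * X) - u 1 := by
    have : Chebyshev.U ℂ (3 - 1) = C 4 * (X * X) - 1 := by
      rw [show (3 - 1 : ℤ) = 2 by norm_num, Chebyshev.U_two, map_ofNat]; ring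
    rw [moment, this, map_sub, functional_C_mul]
  -- This is four times the Hankel determinant `u(1) u(X²) - u(X)²`, nonzero because `u(M_1²)` is.
  have hn : (moment u 3 + moment u 1) * moment u 1 - moment u 2 ^ 2 ≠ 0 := by
    have hM1 : M 1 = X + C ((M 1).coeff 0) := (hM.monic 1).eq_X_add_C (hM.natDegree 1)
    set b := (M 1).coeff 0
    have h01 := hM.orth 1 0 one_ne_zero
    have h11 := hM.norm_ne_zero 1
    have e0 : M 1 * M 0 = X + C b * 1 := by rw [hM.zero_eq_one, hM1]; ring
    have e1 : M 1 * M 1 = X * X + C b * X + C b * (M 1 * M 0) := by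
      rw [hM.zero_eq_one]; nth_rewrite 1 [hM1]; nth_rewrite 1 [hM1]; rw [hM1]; ring
    rw [e1, map_add, map_add, functional_C_mul, functional_C_mul, h01] at h11
    rw [e0, map_add, functional_C_mul] at h01
    rw [hu1] at m1
    rw [hu1, hu2, hu3]
    intro h0
    apply h11
    apply mul_left_cancel₀ m1
    linear_combination h0 / 4 + u X * h01
  have hz := h.pos 0
  have hi := h.neg 1
  have hj := h.pos 1
  norm_num [moment_zero] at hz hi hj
  have hm1 : moment u (-1) = -moment u 1 := moment_neg u 1
  have hm2 : moment u (-2) = -moment u 2 := moment_neg u 2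
  rw [hm1, hm2] at hz
  rw [hm1] at hi hj
  generalize moment u 1 = ν₁ at *
  generalize moment u 2 = ν₂ at *
  generalize moment u 3 = ν₃ at *
  obtain ⟨n₂, rfl⟩ : ∃ x, ν₂ = ν₁ * x := ⟨ν₂ / ν₁, by field_simp⟩
  obtain ⟨n₃, rfl⟩ : ∃ x, ν₃ = ν₁ * x := ⟨ν₃ / ν₁, by field_simp⟩
  obtain ⟨ρ, rfl⟩ : ∃ ρ, p₂ = A₂' * (q * ρ) := ⟨p₂ / (q * A₂'), by field_simp⟩
  obtain rfl : A₂ = A₂' * (q ^ 2 * ρ ^ 2) := by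
    apply mul_right_cancel₀ hA'; linear_combination f4
  obtain ⟨a₁, rfl⟩ : ∃ x, A₁ = A₂' * x := ⟨A₁ / A₂', by field_simp⟩
  obtain ⟨a₀, rfl⟩ : ∃ x, A₀ = A₂' * x := ⟨A₀ / A₂', by field_simp⟩
  obtain ⟨b₁, rfl⟩ : ∃ x, A₁' = A₂' * x := ⟨A₁' / A₂', by field_simp⟩
  obtain ⟨r₁, rfl⟩ : ∃ x, p₁ = A₂' * x := ⟨p₁ / A₂', by field_simp⟩
  obtain ⟨r₀, rfl⟩ : ∃ x, p₀ = A₂' * x := ⟨p₀ / A₂', by field_simp⟩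
  have hA2 := pow_ne_zero 2 hA'
  have hAν := mul_ne_zero hA' m1
  have := quadratic_relation_aux hq hroot (A₁ := a₁) (A₀ := a₀) (A₁' := b₁) (p₁ := r₁) (p₀ := r₀)
    (ρ := ρ) (ν₂ := n₂) (ν₃ := n₃) (fun h0 => hne (by rw [h0, mul_one]))
    (mul_left_cancel₀ hAν (by linear_combination hz))
    (mul_left_cancel₀ hAν (by linear_combination hi))
    (mul_left_cancel₀ hAν (by field_simp at hj; linear_combination hj))
    (mul_left_cancel₀ hA2 (by linear_combination f3))
    (mul_left_cancel₀ hA2 (by linear_combination f2))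
    (mul_left_cancel₀ hA2 (by linear_combination f0))
    (mul_left_cancel₀ hA' (by linear_combination hw))
    (fun h0 => hn (by linear_combination ν₁ ^ 2 * h0))
  linear_combination A₂' * this

theorem MomentRelations.quadratic_relation {q : ℂ} (hq : q ≠ 0)
    (hroot : ∀ n : ℤ, n ≠ 0 → q ^ n ≠ 1) {u : ℂ[X] →ₗ[ℂ] ℂ} {M : ℕ → ℂ[X]}
    (hM : IsMonicOPS u M) {A₂ A₁ A₀ A₁' A₂' p₂ p₁ p₀ : ℂ}
    (h : MomentRelations q (moment u) A₂ A₁ A₀ A₁' A₂' p₂ p₁ p₀)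
    (hne : A₂ ≠ A₂') (hw : A₁ + q * A₁' = (1 + q) * p₁) :
    q * (A₀ - p₀) + A₂ + q ^ 2 * A₂' = (1 + q ^ 2) * p₂ := by
  by_cases hA' : A₂' = 0
  · have hA : A₂ ≠ 0 := fun h0 => hne (by rw [h0, hA'])
    have := h.symm.quadratic_relation_of_ne_zero (inv_ne_zero hq)
      (fun n hn => by rw [inv_zpow, ne_eq, inv_eq_one]; exact hroot n hn) hM hne.symm hA
      (by field_simp; linear_combination hw)
    field_simp at this
    linear_combination this
  · exact h.quadratic_relation_of_ne_zero hq hroot hM hne hA' hw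

theorem linear_relation {q : ℂ} (hq : q ≠ 0) (hroot : ∀ n : ℤ, n ≠ 0 → q ^ n ≠ 1)
    {A₂ A₁ A₁' A₂' p₂ p₁ : ℂ} (hA : A₂ * A₂' = p₂ ^ 2) (hne : A₂ ≠ A₂')
    {F : ℕ → ℂ} (hF0 : F 0 = 0)
    (h1 : ∀ n : ℕ, (A₁ - p₁) * q ^ n - (A₁' - p₁) * (q ^ n)⁻¹ =
      2 * ((A₂ - p₂) * q ^ n - (A₂' - p₂) * (q ^ n)⁻¹) * F (n + 1) -
      2 * ((A₂ - p₂) * q ^ n * q⁻¹ - (A₂' - p₂) * q * (q ^ n)⁻¹) * F n)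
    (h2 : ∀ n : ℕ, A₁ * (q ^ n) ^ 2 - A₁' * ((q ^ n)⁻¹) ^ 2 =
      2 * (A₂ * (q ^ n) ^ 2 - A₂' * ((q ^ n)⁻¹) ^ 2) * F (n + 1) -
      2 * (A₂ * (q ^ n) ^ 2 * (q⁻¹) ^ 2 - A₂' * q ^ 2 * ((q ^ n)⁻¹) ^ 2) * F n) :
    A₁ + q * A₁' = (1 + q) * p₁ := by
  by_cases hA' : A₂' = 0
  · have hA0 : A₂ ≠ 0 := fun h0 => hne (by rw [h0, hA'])
    have := linear_relation_of_ne_zero (inv_ne_zero hq)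
      (fun n hn => by rw [inv_zpow, ne_eq, inv_eq_one]; exact hroot n hn) (A₂ := A₂') (A₂' := A₂)
      (A₁ := A₁') (A₁' := A₁) (p₂ := p₂) (p₁ := p₁) (by linear_combination hA) hne.symm hA0 hF0
      (fun n => by
        have := h1 n
        rw [inv_pow, inv_inv, inv_inv]
        linear_combination -this)
      (fun n => by
        have := h2 n
        rw [inv_pow, inv_inv, inv_inv]
        linear_combination -this)
    field_simp at this
    linear_combination this
  · exact linear_relation_of_ne_zero hq hroot hA hne hA' hF0 h1 h2

/-! ### Coefficients of first-order operators and the commutator form. -/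

section Coefficients

variable {q : ℂ} {D S : ℂ[X] →ₗ[ℂ] ℂ[X]}

theorem IsShiftPair.coeffZ_D (hq : q ≠ 0) (hq2 : q ^ 2 ≠ 1)
    (h : IsShiftPair ((q + q⁻¹) / 2) D S) {f : ℂ[X]} {m : ℤ} (hf : (f.natDegree : ℤ) ≤ m + 3) :
    coeffZ m (D f) = qBracket q (m + 1) * coeffZ (m + 1) f +
      subcoeffD q (m + 3) * coeffZ (m + 3) f := by
  have : (coeffZ m ∘ₗ D - qBracket q (m + 1) • coeffZ (m + 1) -
      subcoeffD q (m + 3) • coeffZ (m + 3)) f = 0 := by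
    refine functional_eq_zero_of_natDegree_le (n := f.natDegree) (fun i hi => ?_) le_rfl
    have := (h.coeffZ_X_pow hq hq2 i).1 m (by omega)
    simp only [LinearMap.sub_apply, LinearMap.comp_apply, LinearMap.smul_apply, smul_eq_mul,
      AskeyWilson.coeffZ_X_pow, this]
    split_ifs with h1 h2 h2
    · omega
    · rw [h1]; ring
    · rw [h2]; ring
    · ring
  simp only [LinearMap.sub_apply, LinearMap.comp_apply, LinearMap.smul_apply, smul_eq_mul] at this
  linear_combination this

theorem IsShiftPair.coeffZ_S (hq : q ≠ 0) (hq2 : q ^ 2 ≠ 1)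
    (h : IsShiftPair ((q + q⁻¹) / 2) D S) {f : ℂ[X]} {m : ℤ} (hf : (f.natDegree : ℤ) ≤ m + 2) :
    coeffZ m (S f) = qAvg q m * coeffZ m f + subcoeffS q (m + 2) * coeffZ (m + 2) f := by
  have : (coeffZ m ∘ₗ S - qAvg q m • coeffZ m - subcoeffS q (m + 2) • coeffZ (m + 2)) f = 0 := by
    refine functional_eq_zero_of_natDegree_le (n := f.natDegree) (fun i hi => ?_) le_rfl
    have := (h.coeffZ_X_pow hq hq2 i).2 m (by omega)
    simp only [LinearMap.sub_apply, LinearMap.comp_apply, LinearMap.smul_apply, smul_eq_mul,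
      AskeyWilson.coeffZ_X_pow, this]
    split_ifs with h1 h2 h2
    · omega
    · rw [h1]; ring
    · rw [h2]; ring
    · ring
  simp only [LinearMap.sub_apply, LinearMap.comp_apply, LinearMap.smul_apply, smul_eq_mul] at this
  linear_combination this

theorem natDegree_le_of_coeffZ {f : ℂ[X]} {n : ℕ} (h : ∀ m : ℤ, (n : ℤ) < m → coeffZ m f = 0) :
    f.natDegree ≤ n := by
  rw [natDegree_le_iff_coeff_eq_zero]
  intro m hm
  rw [← coeffZ_natCast]
  exact h m (by omega)

theorem IsShiftPair.natDegree_S_le (hq : q ≠ 0) (hq2 : q ^ 2 ≠ 1)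
    (h : IsShiftPair ((q + q⁻¹) / 2) D S) {f : ℂ[X]} {n : ℕ} (hf : f.natDegree ≤ n) :
    (S f).natDegree ≤ n := by
  refine natDegree_le_of_coeffZ fun m hm => ?_
  rw [h.coeffZ_S hq hq2 (by omega), coeffZ_eq_zero (by omega), coeffZ_eq_zero (by omega)]
  ring

/-- The leading coefficients of the image of a polynomial of degree at most `n` under a first-order
operator which raises the degree by one. -/
theorem IsShiftPair.coeffZ_firstOrder (hq : q ≠ 0) (hq2 : q ^ 2 ≠ 1)
    (h : IsShiftPair ((q + q⁻¹) / 2) D S) (v₀ v₁ U₀ U₁ U₂ : ℂ) {f : ℂ[X]} {n : ℕ}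
    (hf : f.natDegree ≤ n) :
    ((C v₁ * X + C v₀) * S f + (C U₂ * X ^ 2 + C U₁ * X + C U₀) * D f).natDegree ≤ n + 1 ∧
    coeffZ (n + 1) ((C v₁ * X + C v₀) * S f + (C U₂ * X ^ 2 + C U₁ * X + C U₀) * D f) =
      (v₁ * qAvg q n + U₂ * qBracket q n) * coeffZ n f ∧
    coeffZ n ((C v₁ * X + C v₀) * S f + (C U₂ * X ^ 2 + C U₁ * X + C U₀) * D f) =
      (v₀ * qAvg q n + U₁ * qBracket q n) * coeffZ n f +
        (v₁ * qAvg q (n - 1) + U₂ * qBracket q (n - 1)) * coeffZ (n - 1) f := by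
  have e : (C v₁ * X + C v₀) * S f + (C U₂ * X ^ 2 + C U₁ * X + C U₀) * D f =
      C v₁ * (X * S f) + C v₀ * S f + C U₂ * (X * (X * D f)) + C U₁ * (X * D f) + C U₀ * D f := by
    ring
  have z : ∀ m : ℤ, (n : ℤ) < m → coeffZ m f = 0 := fun m hm => coeffZ_eq_zero (by omega)
  rw [e]
  refine ⟨natDegree_le_of_coeffZ fun m hm => ?_, ?_, ?_⟩
  · push_cast at hm
    simp only [map_add, coeffZ_C_mul, coeffZ_X_mul]
    rw [h.coeffZ_S hq hq2 (by omega), h.coeffZ_S hq hq2 (by omega), h.coeffZ_D hq hq2 (by omega),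
      h.coeffZ_D hq hq2 (by omega), h.coeffZ_D hq hq2 (by omega), z m (by omega),
      z (m - 1) (by omega), z (m - 1 + 2) (by omega), z (m + 2) (by omega),
      z (m - 1 + 1) (by omega), z (m - 1 + 3) (by omega), z (m - 1 - 1 + 1) (by omega),
      z (m - 1 - 1 + 3) (by omega), z (m + 1) (by omega), z (m + 3) (by omega)]
    ring
  · simp only [map_add, coeffZ_C_mul, coeffZ_X_mul]
    rw [h.coeffZ_S hq hq2 (by omega), h.coeffZ_S hq hq2 (by omega), h.coeffZ_D hq hq2 (by omega),
      h.coeffZ_D hq hq2 (by omega), h.coeffZ_D hq hq2 (by omega)]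
    rw [z (n + 1) (by omega), z (n + 1 - 1 + 2) (by omega), z (n + 1 + 2) (by omega),
      z (n + 1 - 1 + 1) (by omega), z (n + 1 - 1 + 3) (by omega),
      z (n + 1 - 1 - 1 + 3) (by omega), z (n + 1 + 1) (by omega), z (n + 1 + 3) (by omega),
      show (n : ℤ) + 1 - 1 = n by ring, show (n : ℤ) - 1 + 1 = n by ring]
    ring
  · simp only [map_add, coeffZ_C_mul, coeffZ_X_mul]
    rw [h.coeffZ_S hq hq2 (by omega), h.coeffZ_S hq hq2 (by omega), h.coeffZ_D hq hq2 (by omega),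
      h.coeffZ_D hq hq2 (by omega), h.coeffZ_D hq hq2 (by omega)]
    rw [z (n - 1 + 2) (by omega), z (n + 2) (by omega), z (n - 1 + 3) (by omega),
      z (n - 1 - 1 + 3) (by omega), z (n + 1) (by omega), z (n + 3) (by omega),
      show (n : ℤ) - 1 - 1 + 1 = n - 1 by ring, show (n : ℤ) - 1 + 1 = n by ring]
    ring

end Coefficients

theorem qBracket_sub_one {q : ℂ} (hq : q ≠ 0) (n : ℤ) :
    qBracket q (n - 1) = (q ^ n * q⁻¹ - q * (q ^ n)⁻¹) / (q - q⁻¹) := by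
  rw [qBracket, zpow_sub_one₀ hq, mul_inv, inv_inv, mul_comm _ q]

theorem qAvg_sub_one {q : ℂ} (hq : q ≠ 0) (n : ℤ) :
    qAvg q (n - 1) = (q ^ n * q⁻¹ + q * (q ^ n)⁻¹) / 2 := by
  rw [qAvg, zpow_sub_one₀ hq, mul_inv, inv_inv, mul_comm _ q]

/-- If the adjoint of `π D` is `V S + U D`, then the coefficients of `π`, `U` and `V` are related
so that `V S + U D - π D` is the commutator of a first-order operator with `X`. -/
theorem IsMonicOPS.coefficient_relations {u : ℂ[X] →ₗ[ℂ] ℂ} {M : ℕ → ℂ[X]}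
    (hM : IsMonicOPS u M) {q : ℂ} (hq : q ≠ 0) (hroot : ∀ n : ℤ, n ≠ 0 → q ^ n ≠ 1)
    {D S : ℂ[X] →ₗ[ℂ] ℂ[X]} (h : IsShiftPair ((q + q⁻¹) / 2) D S)
    {a b c v₀ v₁ U₀ U₁ U₂ : ℂ} (hv : v₁ ≠ 0)
    (hK : ∀ f g, u ((C a * X ^ 2 + C b * X + C c) * D f * g) =
        u (f * ((C v₁ * X + C v₀) * S g + (C U₂ * X ^ 2 + C U₁ * X + C U₀) * D g))) :
    U₁ - b = ((q + q⁻¹) / 2 - 1) * v₀ ∧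
      2 * (U₀ - c) + ((q + q⁻¹) / 2 + 1) * (U₂ - a - ((q + q⁻¹) / 2 - 1) * v₁) = 0 := by
  have hq2 : q ^ 2 ≠ 1 := by exact_mod_cast hroot 2 (by norm_num)
  have hh := sub_inv_ne_zero hq hq2
  have hrel := momentRelations hq hroot h hK
  obtain ⟨f4, -⟩ := hM.factorization hq hroot hrel
  have hne : U₂ / 4 + (q - q⁻¹) * v₁ / 8 ≠ U₂ / 4 - (q - q⁻¹) * v₁ / 8 := by
    intro h0
    exact mul_ne_zero hh hv (by linear_combination 4 * h0)
  set F : ℕ → ℂ := fun n => coeffZ ((n : ℤ) - 1) (M n) with hF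
  have hF1 : ∀ n, (M (n + 1)).coeff n = F (n + 1) := by
    intro n
    rw [← coeffZ_natCast]
    simp only [hF]
    congr 2
    push_cast
    ring
  have hMn : ∀ n : ℕ, coeffZ n (M n) = 1 := fun n => by rw [coeffZ_natCast, hM.coeff_self]
  have hpair : ∀ (n : ℕ) (f : ℂ[X]), f.natDegree ≤ n + 1 →
      u (M n * f) = (coeffZ n f - coeffZ (n + 1) f * F (n + 1)) * u (M n * M n) := by
    intro n f hf
    rw [hM.pairing hf, hF1, coeffZ_natCast, show ((n : ℤ) + 1) = ((n + 1 : ℕ) : ℤ) by push_cast; rfl,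
      coeffZ_natCast]
  -- The adjoint identity at `(M_n, M_n)`.
  have N : ∀ n : ℕ, (v₀ * qAvg q n + U₁ * qBracket q n) +
      (v₁ * qAvg q (n - 1) + U₂ * qBracket q (n - 1)) * F n -
        (v₁ * qAvg q n + U₂ * qBracket q n) * F (n + 1) =
      b * qBracket q n + a * qBracket q (n - 1) * F n - a * qBracket q n * F (n + 1) := by
    intro n
    have h1 := hK (M n) (M n)
    obtain ⟨d1, k1, k2⟩ := h.coeffZ_firstOrder hq hq2 v₀ v₁ U₀ U₁ U₂ (hM.natDegree n).le
    obtain ⟨d2, k3, k4⟩ := h.coeffZ_firstOrder hq hq2 0 0 c b a (hM.natDegree n).le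
    simp only [C_0, zero_mul, zero_add] at d2 k3 k4
    rw [mul_comm _ (M n), hpair n _ d2, hpair n _ d1, k1, k2, k3, k4, hMn] at h1
    have h2 := mul_right_cancel₀ (hM.norm_ne_zero n) h1
    simp only [hF] at h2 ⊢
    linear_combination -h2
  -- By `D(f²) = 2 D f · S f`, the adjoint identities at `(M_n, S M_n)` and `(M_n², 1)` have
  -- left-hand sides that differ by a factor of two. Comparing them gives a second first-order
  -- relation for `F`, independent of `π`.
  have J : ∀ n : ℕ, 2 * ((v₀ * qAvg q n + U₁ * qBracket q n) * qAvg q n +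
      (v₁ * qAvg q (n - 1) + U₂ * qBracket q (n - 1)) * qAvg q (n - 1) * F n -
        (v₁ * qAvg q n + U₂ * qBracket q n) * qAvg q n * F (n + 1)) =
      v₀ + v₁ * F n - v₁ * F (n + 1) := by
    intro n
    have h1 := hK (M n) (S (M n))
    have h2 := hK (M n * M n) 1
    rw [(h.D_S_mul _ _).1, h.S_one, h.D_one] at h2
    have e1 : (C a * X ^ 2 + C b * X + C c) * (D (M n) * S (M n) + S (M n) * D (M n)) * 1 =
        C 2 * ((C a * X ^ 2 + C b * X + C c) * D (M n) * S (M n)) := by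
      rw [map_ofNat]; ring
    have e2 : M n * M n * ((C v₁ * X + C v₀) * 1 + (C U₂ * X ^ 2 + C U₁ * X + C U₀) * 0) =
        M n * (C v₁ * (X * M n) + C v₀ * M n) := by ring
    have d0 : (C v₁ * (X * M n) + C v₀ * M n).natDegree ≤ n + 1 := by
      refine natDegree_le_of_coeffZ fun m hm => ?_
      push_cast at hm
      rw [map_add, coeffZ_C_mul, coeffZ_C_mul, coeffZ_X_mul,
        coeffZ_eq_zero (by rw [hM.natDegree]; omega), coeffZ_eq_zero (by rw [hM.natDegree]; omega)]
      ring
    have s0 : coeffZ n (S (M n)) = qAvg q n := by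
      rw [h.coeffZ_S hq hq2 (by rw [hM.natDegree]; omega), hMn,
        coeffZ_eq_zero (by rw [hM.natDegree]; omega)]
      ring
    have s1 : coeffZ ((n : ℤ) - 1) (S (M n)) = qAvg q (n - 1) * F n := by
      rw [h.coeffZ_S hq hq2 (by rw [hM.natDegree]; omega),
        coeffZ_eq_zero (m := (n : ℤ) - 1 + 2) (by rw [hM.natDegree]; omega)]
      ring
    obtain ⟨d1, k1, k2⟩ := h.coeffZ_firstOrder hq hq2 v₀ v₁ U₀ U₁ U₂
      (h.natDegree_S_le hq hq2 (hM.natDegree n).le)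
    rw [e1, e2, functional_C_mul, h1, hpair n _ d1, hpair n _ d0, k1, k2, s0, s1, map_add, map_add,
      coeffZ_C_mul, coeffZ_C_mul, coeffZ_C_mul, coeffZ_C_mul, coeffZ_X_mul, coeffZ_X_mul,
      coeffZ_eq_zero (m := (n : ℤ) + 1) (by rw [hM.natDegree]; omega), add_sub_cancel_right,
      hMn] at h2
    have h3 : (2 * ((v₀ * qAvg q n + U₁ * qBracket q n) * qAvg q n +
      (v₁ * qAvg q (n - 1) + U₂ * qBracket q (n - 1)) * qAvg q (n - 1) * F n -
        (v₁ * qAvg q n + U₂ * qBracket q n) * qAvg q n * F (n + 1))) * u (M n * M n) =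
      (v₀ + v₁ * F n - v₁ * F (n + 1)) * u (M n * M n) := by
      linear_combination h2
    exact mul_right_cancel₀ (hM.norm_ne_zero n) h3
  have hF0 : F 0 = 0 := by
    simp only [hF]
    exact coeffZ_of_neg (by norm_num) _
  have hqr : q * q⁻¹ = 1 := mul_inv_cancel₀ hq
  have hkj : (q - q⁻¹) * (q - q⁻¹)⁻¹ = 1 := mul_inv_cancel₀ hh
  have hw := linear_relation hq hroot f4 hne hF0 (A₁ := U₁ / 2 + (q - q⁻¹) * v₀ / 4)
    (A₁' := U₁ / 2 - (q - q⁻¹) * v₀ / 4) (p₁ := b / 2) (fun n => by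
      have h1 := N n
      rw [qAvg_sub_one hq, qBracket_sub_one hq, qAvg, qBracket, zpow_natCast] at h1
      simp only [div_eq_mul_inv _ (q - q⁻¹)] at h1
      generalize (q ^ n)⁻¹ = w at *
      generalize q ^ n = x at *
      generalize (q - q⁻¹)⁻¹ = j at *
      generalize q⁻¹ = r at *
      linear_combination (q - r) / 2 * h1 - 1 / 2 * (U₁ * (x - w) + U₂ * (x * r - q * w) * F n -
        U₂ * (x - w) * F (n + 1) - b * (x - w) - a * (x * r - q * w) * F n +
        a * (x - w) * F (n + 1)) * hkj) (fun n => by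
      have h1 := J n
      rw [qAvg_sub_one hq, qBracket_sub_one hq, qAvg, qBracket, zpow_natCast] at h1
      have hxw : q ^ n * (q ^ n)⁻¹ = 1 := mul_inv_cancel₀ (pow_ne_zero n hq)
      simp only [div_eq_mul_inv _ (q - q⁻¹)] at h1
      generalize (q ^ n)⁻¹ = w at *
      generalize q ^ n = x at *
      generalize (q - q⁻¹)⁻¹ = j at *
      generalize q⁻¹ = r at *
      linear_combination (q - r) / 2 * h1 - (U₁ * (x - w) * (x + w) / 2 +
        U₂ * (x * r - q * w) * (x * r + q * w) / 2 * F n -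
        U₂ * (x - w) * (x + w) / 2 * F (n + 1)) * hkj -
        (q - r) / 2 * (v₀ * hxw + v₁ * F n * (q * r * hxw + hqr) - v₁ * F (n + 1) * hxw))
  have hw0 := hrel.quadratic_relation hq hroot hM hne hw
  have h1q : 1 + q ≠ 0 := fun h0 => hq2 (by linear_combination (q - 1) * h0)
  constructor
  · refine mul_left_cancel₀ h1q ?_
    linear_combination 2 * hw - v₀ * hqr
  · refine mul_left_cancel₀ hq ?_
    linear_combination 2 * hw0 + (U₂ / 2 - a / 2 - v₁ * (q⁻¹ + 3 * q) / 4) * hqr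

/-! ### Orthogonal polynomials as eigenfunctions. -/

/-- If the commutator of `T` with `X` is antisymmetric with respect to `u`, then `T` is
symmetric. -/
theorem symmetric_of_commutator {u : ℂ[X] →ₗ[ℂ] ℂ} {T N : ℂ[X] →ₗ[ℂ] ℂ[X]}
    (hT : ∀ f, T (X * f) = N f + X * T f) (hN : ∀ f g, u (N f * g) = -u (f * N g)) (f g : ℂ[X]) :
    u (T f * g) = u (f * T g) := by
  -- The defect of symmetry depends only on the product `f g`, so it is symmetric in `f` and `g`;
  -- being antisymmetric as well, it vanishes.
  have key : ∀ f g, u (T f * g) - u (f * T g) = u (T 1 * (f * g)) - u (T (f * g)) := by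
    intro f
    induction f using induction_X_mul with
    | h1 => intro g; simp
    | hadd f₁ f₂ h₁ h₂ =>
      intro g
      simp only [map_add, add_mul, mul_add]
      linear_combination h₁ g + h₂ g
    | hsmul a f hf =>
      intro g
      simp only [map_C_mul, mul_assoc, mul_left_comm _ (C a), functional_C_mul]
      linear_combination a * hf g
    | hX f hf =>
      intro g
      have h1 := hf (X * g)
      rw [hT g, mul_add, map_add, mul_left_comm f X g] at h1
      rw [hT f, add_mul, map_add, hN, mul_assoc X f g, mul_assoc X (T f) g,
        mul_left_comm X (T f) g, mul_assoc X f (T g), mul_left_comm X f (T g)]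
      linear_combination h1
  have h1 := key f g
  have h2 := key g f
  rw [mul_comm g f, mul_comm (T g) f, mul_comm g (T f)] at h2
  have h3 := key (f * g) 1
  rw [mul_one, mul_one] at h3
  linear_combination (h1 - h2) / 2

/-- The coefficients of the image of a polynomial under a first-order operator which preserves the
degree. -/
theorem IsShiftPair.coeffZ_eigenoperator {q : ℂ} (hq : q ≠ 0) (hq2 : q ^ 2 ≠ 1)
    {D S : ℂ[X] →ₗ[ℂ] ℂ[X]} (h : IsShiftPair ((q + q⁻¹) / 2) D S) (x l₁ l₀ : ℂ) {f : ℂ[X]} {m : ℤ}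
    (hf : (f.natDegree : ℤ) ≤ m + 2) :
    coeffZ m (C x * S f + (C l₁ * X + C l₀) * D f) =
      (x * qAvg q m + l₁ * qBracket q m) * coeffZ m f +
        l₀ * qBracket q (m + 1) * coeffZ (m + 1) f +
        (x * subcoeffS q (m + 2) + l₁ * subcoeffD q (m + 2)) * coeffZ (m + 2) f := by
  have e : C x * S f + (C l₁ * X + C l₀) * D f =
      C x * S f + C l₁ * (X * D f) + C l₀ * D f := by ring
  rw [e]
  simp only [map_add, coeffZ_C_mul, coeffZ_X_mul]
  rw [h.coeffZ_S hq hq2 hf, h.coeffZ_D hq hq2 (by omega), h.coeffZ_D hq hq2 (by omega),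
    coeffZ_eq_zero (m := m + 3) (by omega), show m - 1 + 1 = m by ring,
    show m - 1 + 3 = m + 2 by ring]
  ring

/-- Monic orthogonal polynomials with a structure relation for `D` are eigenfunctions of a
first-order operator. -/
theorem IsMonicOPS.exists_eigenoperator {u : ℂ[X] →ₗ[ℂ] ℂ} {M : ℕ → ℂ[X]}
    (hM : IsMonicOPS u M) {q : ℂ} (hq : q ≠ 0) (hroot : ∀ n : ℤ, n ≠ 0 → q ^ n ≠ 1)
    {D S : ℂ[X] →ₗ[ℂ] ℂ[X]} (h : IsShiftPair ((q + q⁻¹) / 2) D S) {a b c : ℂ}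
    (hE : ∀ n i, i + 1 < n → u ((C a * X ^ 2 + C b * X + C c) * D (M n) * M i) = 0)
    (hπ : u (C a * X ^ 2 + C b * X + C c) ≠ 0) :
    ∃ x l₁ l₀ : ℂ, (x ≠ 0 ∨ l₁ ≠ 0) ∧ ∀ n : ℕ,
      C x * S (M n) + (C l₁ * X + C l₀) * D (M n) =
        C (x * qAvg q n + l₁ * qBracket q n) * M n := by
  have hq2 : q ^ 2 ≠ 1 := by exact_mod_cast hroot 2 (by norm_num)
  obtain ⟨v₀, v₁, U₀, U₁, U₂, hv, -, hK⟩ := hM.exists_adjoint h hE hπ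
  obtain ⟨e1, e0⟩ := hM.coefficient_relations hq hroot h hv hK
  have hα : (q + q⁻¹) / 2 - 1 ≠ 0 := by
    intro h0
    have h1 : q ≠ 1 := by simpa using hroot 1 one_ne_zero
    apply h1
    field_simp at h0
    have : (q - 1) ^ 2 = 0 := by linear_combination h0
    simpa [sub_eq_zero] using this
  set α := (q + q⁻¹) / 2 with hαdef
  -- Matching `[T, X]` with `N`: the `S`-part gives `l₁` and `l₀ = v₀`, the `X²`-coefficient of the
  -- `D`-part gives `x`. The other two coefficients of the `D`-part are then matched by
  -- `coefficient_relations`.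
  obtain ⟨x, hx⟩ : ∃ x, 2 * x * (α - 1) = U₂ - a - (α - 1) * v₁ :=
    ⟨(U₂ - a - (α - 1) * v₁) / (2 * (α - 1)), by field_simp⟩
  set l₁ := v₁ - x * (α - 1) with hl
  let T : ℂ[X] →ₗ[ℂ] ℂ[X] :=
    LinearMap.mulLeft ℂ (C x) ∘ₗ S + LinearMap.mulLeft ℂ (C l₁ * X + C v₀) ∘ₗ D
  let N : ℂ[X] →ₗ[ℂ] ℂ[X] := LinearMap.mulLeft ℂ (C v₁ * X + C v₀) ∘ₗ S +
    LinearMap.mulLeft ℂ (C U₂ * X ^ 2 + C U₁ * X + C U₀ - (C a * X ^ 2 + C b * X + C c)) ∘ₗ D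
  have hTd : ∀ f, T f = C x * S f + (C l₁ * X + C v₀) * D f := fun f => rfl
  have hNd : ∀ f, N f = (C v₁ * X + C v₀) * S f +
      (C U₂ * X ^ 2 + C U₁ * X + C U₀ - (C a * X ^ 2 + C b * X + C c)) * D f := fun f => rfl
  have hU₂ : U₂ = a + (α - 1) * v₁ + 2 * x * (α - 1) := by linear_combination -hx
  have hU₁ : U₁ = b + (α - 1) * v₀ := by linear_combination e1
  have hU₀ : U₀ = c - x * (α ^ 2 - 1) := by
    linear_combination e0 / 2 + (α + 1) / 2 * hx
  have hT : ∀ f, T (X * f) = N f + X * T f := by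
    intro f
    rw [hTd, hTd, hNd, h.D_X_mul, h.S_X_mul, hU₂, hU₁, hU₀, hl]
    simp only [C_add, C_sub, C_mul, C_pow, C_1, map_ofNat]
    ring
  have hN : ∀ f g, u (N f * g) = -u (f * N g) := by
    intro f g
    have h1 := hK f g
    have h2 := hK g f
    have e1 : N f * g = g * ((C v₁ * X + C v₀) * S f + (C U₂ * X ^ 2 + C U₁ * X + C U₀) * D f) -
        (C a * X ^ 2 + C b * X + C c) * D f * g := by rw [hNd]; ring
    have e2 : f * N g = f * ((C v₁ * X + C v₀) * S g + (C U₂ * X ^ 2 + C U₁ * X + C U₀) * D g) -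
        (C a * X ^ 2 + C b * X + C c) * D g * f := by rw [hNd]; ring
    rw [e1, e2, map_sub, map_sub, h1, h2]
    ring
  have hsymm := symmetric_of_commutator hT hN
  refine ⟨x, l₁, v₀, ?_, fun n => ?_⟩
  · by_contra! h0
    apply hv
    rw [← sub_add_cancel v₁ (x * (α - 1)), ← hl, h0.1, h0.2]
    ring
  · have hdeg : ∀ i : ℕ, (T (M i)).natDegree ≤ i := by
      intro i
      refine natDegree_le_of_coeffZ fun m hm => ?_
      have hd := hM.natDegree i
      rw [hTd, h.coeffZ_eigenoperator hq hq2 _ _ _ (by omega), coeffZ_eq_zero (m := m) (by omega),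
        coeffZ_eq_zero (m := m + 1) (by omega), coeffZ_eq_zero (m := m + 2) (by omega)]
      ring
    have hlead : (T (M n)).coeff n = x * qAvg q n + l₁ * qBracket q n := by
      have hd := hM.natDegree n
      rw [← coeffZ_natCast, hTd, h.coeffZ_eigenoperator hq hq2 _ _ _ (by omega),
        coeffZ_eq_zero (m := n + 1) (by omega), coeffZ_eq_zero (m := n + 2) (by omega),
        coeffZ_natCast, hM.coeff_self]
      ring
    -- After its leading term is removed, `T M_n` has degree below `n`; by symmetry it is orthogonal
    -- to all `M_i` with `i < n`.
    rw [← hTd, ← hlead, ← sub_eq_zero]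
    refine hM.eq_zero_of_orth (hM.degree_sub_lt ?_) fun i hi => ?_
    · refine degree_le_natDegree.trans_lt ?_
      exact_mod_cast Nat.lt_succ_of_le (hdeg n)
    · rw [sub_mul, map_sub, hsymm, hM.orth_of_degree_lt (degree_le_natDegree.trans_lt
        (by exact_mod_cast (hdeg i).trans_lt hi)), mul_assoc, functional_C_mul,
        hM.orth n i (by omega)]
      ring

/-! ### Closed form of the recurrence coefficients. -/

/-- Here `Y` stands for `q^(2k+2)`, and `F`, `g` for the second and third highest coefficients in
two consecutive degrees. -/
theorem recurrence_coeff_aux {q Y ρ₀ ρ₁ ς F₁ F₂ g₁ g₂ t : ℂ} (hq1 : 1 - q ≠ 0) (hq2 : 1 + q ≠ 0)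
    (he : ρ₀ + ρ₁ * Y ≠ 0) (hd : ρ₀ + ρ₁ * (Y * q) ≠ 0) (he' : ρ₀ + ρ₁ * (Y * q ^ 2) ≠ 0)
    (hd' : ρ₀ + ρ₁ * (Y * q ^ 3) ≠ 0)
    (hF₁ : 2 * (1 - q) * (ρ₀ + ρ₁ * (Y * q)) * F₁ = -ς * (1 - Y * q ^ 2))
    (hF₂ : 2 * (1 - q) * (ρ₀ + ρ₁ * (Y * q ^ 3)) * F₂ = -ς * (1 - Y * q ^ 4))
    (hg₁ : (g₁ + t / 4) * ((1 - q ^ 2) * (ρ₀ + ρ₁ * Y)) =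
      F₁ * (ς / 2) * (Y * q - q) + (ρ₀ + ρ₁) / 4 * (1 - Y * q ^ 2))
    (hg₂ : (g₂ + (t + 1) / 4) * ((1 - q ^ 2) * (ρ₀ + ρ₁ * (Y * q ^ 2))) =
      F₂ * (ς / 2) * (Y * q ^ 3 - q) + (ρ₀ + ρ₁) / 4 * (1 - Y * q ^ 4)) :
    4 * (g₁ - g₂ - (F₁ - F₂) * F₁) *
      ((ρ₀ + ρ₁ * Y) * (ρ₀ + ρ₁ * (Y * q)) ^ 2 * (ρ₀ + ρ₁ * (Y * q ^ 2))) =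
      (1 - Y * q ^ 2) * (ρ₀ ^ 2 - ρ₁ ^ 2 * Y) * ((ρ₀ + ρ₁ * (Y * q)) ^ 2 - ς ^ 2 * (Y * q)) := by
  have e1 : F₁ = -ς * (1 - Y * q ^ 2) / (2 * (1 - q) * (ρ₀ + ρ₁ * (Y * q))) := by
    rw [eq_div_iff (mul_ne_zero (mul_ne_zero two_ne_zero hq1) hd)]; linear_combination hF₁
  have e2 : F₂ = -ς * (1 - Y * q ^ 4) / (2 * (1 - q) * (ρ₀ + ρ₁ * (Y * q ^ 3))) := by
    rw [eq_div_iff (mul_ne_zero (mul_ne_zero two_ne_zero hq1) hd')]; linear_combination hF₂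
  have hq3 : 1 - q ^ 2 ≠ 0 := by
    have := mul_ne_zero hq1 hq2
    intro h0
    apply this
    linear_combination h0
  have e3 : g₁ - g₂ = 1 / 4 + (F₁ * (ς / 2) * (Y * q - q) + (ρ₀ + ρ₁) / 4 * (1 - Y * q ^ 2)) /
      ((1 - q ^ 2) * (ρ₀ + ρ₁ * Y)) - (F₂ * (ς / 2) * (Y * q ^ 3 - q) +
      (ρ₀ + ρ₁) / 4 * (1 - Y * q ^ 4)) / ((1 - q ^ 2) * (ρ₀ + ρ₁ * (Y * q ^ 2))) := by
    rw [← hg₁, ← hg₂, mul_div_cancel_right₀ _ (mul_ne_zero hq3 he),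
      mul_div_cancel_right₀ _ (mul_ne_zero hq3 he')]
    ring
  rw [e3, e1, e2, show 1 - q ^ 2 = (1 - q) * (1 + q) by ring]
  generalize h1 : ρ₀ + ρ₁ * Y = e at *
  generalize h2 : ρ₀ + ρ₁ * (Y * q) = d at *
  generalize h3 : ρ₀ + ρ₁ * (Y * q ^ 2) = e' at *
  generalize h4 : ρ₀ + ρ₁ * (Y * q ^ 3) = d' at *
  generalize h5 : 1 - q = r at *
  generalize h6 : 1 + q = s at *
  field_simp
  rw [← h1, ← h2, ← h3, ← h4, ← h5, ← h6]
  ring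

/-- The case `Y = 1`, `g₁ = 0` with the factor `ρ₀ + ρ₁` cancelled; that factor is allowed to be
zero. -/
theorem first_recurrence_coeff_aux {q ρ₀ ρ₁ ς F₁ F₂ g₂ : ℂ} (hq1 : 1 - q ≠ 0) (hq2 : 1 + q ≠ 0)
    (hd : ρ₀ + ρ₁ * q ≠ 0) (he' : ρ₀ + ρ₁ * q ^ 2 ≠ 0)
    (hd' : ρ₀ + ρ₁ * q ^ 3 ≠ 0)
    (hF₁ : 2 * (1 - q) * (ρ₀ + ρ₁ * q) * F₁ = -ς * (1 - q ^ 2))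
    (hF₂ : 2 * (1 - q) * (ρ₀ + ρ₁ * q ^ 3) * F₂ = -ς * (1 - q ^ 4))
    (hg₂ : (g₂ + 2 / 4) * ((1 - q ^ 2) * (ρ₀ + ρ₁ * q ^ 2)) =
      F₂ * (ς / 2) * (q ^ 3 - q) + (ρ₀ + ρ₁) / 4 * (1 - q ^ 4)) :
    4 * (0 - g₂ - (F₁ - F₂) * F₁) * ((ρ₀ + ρ₁ * q) ^ 2 * (ρ₀ + ρ₁ * q ^ 2)) =
      (1 - q ^ 2) * (ρ₀ - ρ₁) * ((ρ₀ + ρ₁ * q) ^ 2 - ς ^ 2 * q) := by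
  have e1 : F₁ = -ς * (1 - q ^ 2) / (2 * (1 - q) * (ρ₀ + ρ₁ * q)) := by
    rw [eq_div_iff (mul_ne_zero (mul_ne_zero two_ne_zero hq1) hd)]; linear_combination hF₁
  have e2 : F₂ = -ς * (1 - q ^ 4) / (2 * (1 - q) * (ρ₀ + ρ₁ * q ^ 3)) := by
    rw [eq_div_iff (mul_ne_zero (mul_ne_zero two_ne_zero hq1) hd')]; linear_combination hF₂
  have hq3 : 1 - q ^ 2 ≠ 0 := by
    have := mul_ne_zero hq1 hq2
    intro h0
    apply this
    linear_combination h0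
  have e3 : g₂ = -2 / 4 + (F₂ * (ς / 2) * (q ^ 3 - q) +
      (ρ₀ + ρ₁) / 4 * (1 - q ^ 4)) / ((1 - q ^ 2) * (ρ₀ + ρ₁ * q ^ 2)) := by
    rw [← hg₂, mul_div_cancel_right₀ _ (mul_ne_zero hq3 he')]
    ring
  rw [e3, e1, e2, show 1 - q ^ 2 = (1 - q) * (1 + q) by ring]
  generalize h2 : ρ₀ + ρ₁ * q = d at *
  generalize h3 : ρ₀ + ρ₁ * q ^ 2 = e' at *
  generalize h4 : ρ₀ + ρ₁ * q ^ 3 = d' at *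
  generalize h5 : 1 - q = r at *
  generalize h6 : 1 + q = s at *
  field_simp
  rw [← h2, ← h3, ← h4, ← h5, ← h6]
  ring

/-- The second highest coefficient of the monic polynomial of degree `n` with recurrence
coefficients `pencilB` and `pencilC`. -/
noncomputable def subleading (q ρ₀ ρ₁ ς : ℂ) : ℕ → ℂ
  | 0 => 0
  | k + 1 => -ς * (1 - q ^ (2 * k + 2)) / (2 * (1 - q) * (ρ₀ + ρ₁ * q ^ (2 * k + 1)))

/-- The recurrence coefficient `B_n` of the eigenpolynomials of a first-order operator with
eigenvalues `ρ₀ q⁻ⁿ - ρ₁ qⁿ`. -/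
noncomputable def pencilB (q ρ₀ ρ₁ ς : ℂ) (n : ℕ) : ℂ :=
  subleading q ρ₀ ρ₁ ς n - subleading q ρ₀ ρ₁ ς (n + 1)

/-- The recurrence coefficient `C_{n+1}` of the eigenpolynomials of a first-order operator with
eigenvalues `ρ₀ q⁻ⁿ - ρ₁ qⁿ`. -/
noncomputable def pencilC (q ρ₀ ρ₁ ς : ℂ) : ℕ → ℂ
  | 0 => (1 - q ^ 2) * (ρ₀ - ρ₁) * ((ρ₀ + ρ₁ * q) ^ 2 - ς ^ 2 * q) /
      (4 * ((ρ₀ + ρ₁ * q) ^ 2 * (ρ₀ + ρ₁ * q ^ 2)))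
  | k + 1 => (1 - q ^ (2 * k + 4)) * (ρ₀ ^ 2 - ρ₁ ^ 2 * q ^ (2 * k + 2)) *
        ((ρ₀ + ρ₁ * q ^ (2 * k + 3)) ^ 2 - ς ^ 2 * q ^ (2 * k + 3)) /
      (4 * ((ρ₀ + ρ₁ * q ^ (2 * k + 2)) * (ρ₀ + ρ₁ * q ^ (2 * k + 3)) ^ 2 *
        (ρ₀ + ρ₁ * q ^ (2 * k + 4))))

theorem pencil_unique {q ρ₀ ρ₁ : ℂ} (hq : q ≠ 0) (hroot : ∀ n : ℕ, n ≠ 0 → q ^ n ≠ 1)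
    (hρ : ρ₀ ≠ 0 ∨ ρ₁ ≠ 0) {i j : ℕ} (hi : ρ₀ + ρ₁ * q ^ i = 0) (hij : i < j) :
    ρ₀ + ρ₁ * q ^ j ≠ 0 := by
  intro hj
  obtain ⟨k, rfl⟩ := Nat.exists_eq_add_of_lt hij
  have h1 : ρ₁ * q ^ i * (1 - q ^ (k + 1)) = 0 := by
    rw [show i + k + 1 = i + (k + 1) by ring, pow_add] at hj
    linear_combination hi - hj
  have h2 : ρ₁ = 0 := by
    rcases mul_eq_zero.1 h1 with h | h
    · exact (mul_eq_zero.1 h).resolve_right (pow_ne_zero i hq)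
    · exact absurd (sub_eq_zero.1 h).symm (hroot (k + 1) (by omega))
  rw [h2, zero_mul, add_zero] at hi
  rcases hρ with h | h
  · exact h hi
  · exact h h2

/-- The equations for `F` and `g` can be solved only if `ρ₀ + ρ₁ q^j` does not vanish. This is not
assumed: it follows from `c n ≠ 0`. -/
theorem recurrence_coeff_of_subleading {q ρ₀ ρ₁ ς : ℂ} (hq : q ≠ 0)
    (hroot : ∀ n : ℕ, n ≠ 0 → q ^ n ≠ 1) (hρ : ρ₀ ≠ 0 ∨ ρ₁ ≠ 0) {F g b c : ℕ → ℂ} (hF0 : F 0 = 0)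
    (hg1 : g 1 = 0)
    (hF : ∀ k, 2 * (1 - q) * (ρ₀ + ρ₁ * q ^ (2 * k + 1)) * F (k + 1) = -ς * (1 - q ^ (2 * k + 2)))
    (hg : ∀ k : ℕ, (g (k + 1) + (k + 1) / 4) * ((1 - q ^ 2) * (ρ₀ + ρ₁ * q ^ (2 * k))) =
      F (k + 1) * (ς / 2) * (q ^ (2 * k + 1) - q) + (ρ₀ + ρ₁) / 4 * (1 - q ^ (2 * k + 2)))
    (hb : ∀ n, b n = F n - F (n + 1))
    (hc : ∀ n, c n = g (n + 1) - g (n + 2) - b (n + 1) * F (n + 1)) (hc0 : ∀ n, c n ≠ 0) :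
    (∀ m : ℕ, ρ₀ + ρ₁ * q ^ (m + 1) ≠ 0) ∧ b = pencilB q ρ₀ ρ₁ ς ∧ c = pencilC q ρ₀ ρ₁ ς := by
  have hq1 : 1 - q ≠ 0 := sub_ne_zero.2 (by simpa using (hroot 1 one_ne_zero).symm)
  have hq2 : 1 + q ≠ 0 := fun h0 => hroot 2 two_ne_zero (by linear_combination (q - 1) * h0)
  have general : ∀ k, ρ₀ + ρ₁ * q ^ (2 * k + 2) ≠ 0 → ρ₀ + ρ₁ * q ^ (2 * k + 3) ≠ 0 →
      ρ₀ + ρ₁ * q ^ (2 * k + 4) ≠ 0 → ρ₀ + ρ₁ * q ^ (2 * k + 5) ≠ 0 →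
      4 * c (k + 1) * ((ρ₀ + ρ₁ * q ^ (2 * k + 2)) * (ρ₀ + ρ₁ * q ^ (2 * k + 3)) ^ 2 *
        (ρ₀ + ρ₁ * q ^ (2 * k + 4))) =
      (1 - q ^ (2 * k + 4)) * (ρ₀ ^ 2 - ρ₁ ^ 2 * q ^ (2 * k + 2)) *
        ((ρ₀ + ρ₁ * q ^ (2 * k + 3)) ^ 2 - ς ^ 2 * q ^ (2 * k + 3)) := by
    intro k h2 h3 h4 h5
    have f1 := hF (k + 1)
    have f2 := hF (k + 2)
    have g1 := hg (k + 1)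
    have g2 := hg (k + 2)
    rw [show 2 * (k + 1) + 1 = 2 * k + 2 + 1 by ring, show 2 * (k + 1) + 2 = 2 * k + 2 + 2 by ring,
      pow_add q (2 * k + 2), pow_add q (2 * k + 2), pow_one] at f1 g1
    rw [show 2 * (k + 2) + 1 = 2 * k + 2 + 3 by ring, show 2 * (k + 2) + 2 = 2 * k + 2 + 4 by ring,
      pow_add q (2 * k + 2), pow_add q (2 * k + 2)] at f2 g2
    rw [show 2 * (k + 1) = 2 * k + 2 by ring] at g1
    rw [show 2 * (k + 2) = 2 * k + 2 + 2 by ring, pow_add q (2 * k + 2)] at g2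
    rw [show 2 * k + 3 = 2 * k + 2 + 1 by ring, pow_add q (2 * k + 2), pow_one] at h3 ⊢
    rw [show 2 * k + 4 = 2 * k + 2 + 2 by ring, pow_add q (2 * k + 2)] at h4 ⊢
    rw [show 2 * k + 5 = 2 * k + 2 + 3 by ring, pow_add q (2 * k + 2)] at h5
    push_cast at g1 g2
    have := recurrence_coeff_aux (t := (k : ℂ) + 2)
      (g₁ := g (k + 1 + 1)) (g₂ := g (k + 2 + 1)) hq1 hq2 h2 h3 h4 h5 f1 f2
      (by linear_combination g1) (by linear_combination g2)
    rw [hc, hb]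
    exact this
  have hne : ∀ m : ℕ, ρ₀ + ρ₁ * q ^ (m + 1) ≠ 0 := by
    intro m h0
    have hu : ∀ j, m + 1 < j → ρ₀ + ρ₁ * q ^ j ≠ 0 := fun j hj => pencil_unique hq hroot hρ h0 hj
    have h1 := general m (hu _ (by omega)) (hu _ (by omega)) (hu _ (by omega)) (hu _ (by omega))
    -- A zero at exponent `m + 1` is unique by `pencil_unique`, so the formula for `c (m + 1)`,
    -- whose denominators have exponents at least `2m + 2`, is valid. Its numerator contains the
    -- vanishing factor, contradicting `hc0`.
    have h2 : ρ₀ ^ 2 - ρ₁ ^ 2 * q ^ (2 * m + 2) = 0 := by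
      rw [show 2 * m + 2 = (m + 1) * 2 by ring, pow_mul]
      linear_combination (ρ₀ - ρ₁ * q ^ (m + 1)) * h0
    rw [h2, mul_zero, zero_mul] at h1
    exact mul_ne_zero (mul_ne_zero (by norm_num : (4 : ℂ) ≠ 0) (hc0 _)) (mul_ne_zero (mul_ne_zero
      (hu _ (by omega)) (pow_ne_zero _ (hu _ (by omega)))) (hu _ (by omega))) h1
  have hFs : ∀ n, F n = subleading q ρ₀ ρ₁ ς n := by
    intro n
    cases n with
    | zero => rw [hF0, subleading]
    | succ k =>
      rw [subleading, eq_div_iff (mul_ne_zero (mul_ne_zero two_ne_zero hq1) (hne _)), ← hF k]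
      ring
  refine ⟨hne, _root_.funext fun n => ?_, _root_.funext fun n => ?_⟩
  · rw [hb, hFs, hFs, pencilB]
  · cases n with
    | zero =>
      have h1 := hne 0
      have h2 := hne 1
      have h3 := hne 2
      have f1 := hF 0
      have g2 := hg 1
      norm_num at h1 h2 h3 f1 g2
      rw [pencilC, eq_div_iff (mul_ne_zero (by norm_num : (4 : ℂ) ≠ 0) (mul_ne_zero (pow_ne_zero _ h1) h2)), hc,
        hb, hg1]
      rw [← first_recurrence_coeff_aux (F₁ := F 1) (F₂ := F 2) (g₂ := g 2) hq1 hq2 h1 h2 h3 (by linear_combination f1)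
        (by simpa using hF 1) (by linear_combination g2)]
      ring
    | succ k =>
      rw [pencilC, eq_div_iff (mul_ne_zero (by norm_num : (4 : ℂ) ≠ 0) (mul_ne_zero (mul_ne_zero (hne _)
        (pow_ne_zero _ (hne _))) (hne _))),
        ← general k (hne _) (hne _) (hne _) (hne _)]
      ring

/-- The recurrence coefficients of monic orthogonal eigenpolynomials of a first-order operator. -/
theorem IsMonicOPS.exists_pencil {u : ℂ[X] →ₗ[ℂ] ℂ} {M : ℕ → ℂ[X]}
    (hM : IsMonicOPS u M) {q : ℂ} (hq : q ≠ 0) (hroot : ∀ n : ℕ, n ≠ 0 → q ^ n ≠ 1)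
    {D S : ℂ[X] →ₗ[ℂ] ℂ[X]} (h : IsShiftPair ((q + q⁻¹) / 2) D S) {x l₁ l₀ : ℂ}
    (hx : x ≠ 0 ∨ l₁ ≠ 0) (hT : ∀ n : ℕ, C x * S (M n) + (C l₁ * X + C l₀) * D (M n) =
        C (x * qAvg q n + l₁ * qBracket q n) * M n) :
    ∃ ρ₀ ρ₁ ς : ℂ, (∀ m : ℕ, ρ₀ + ρ₁ * q ^ (m + 1) ≠ 0) ∧
      M = monicOfTTRR (pencilB q ρ₀ ρ₁ ς) (pencilC q ρ₀ ρ₁ ς) := by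
  have hq2 := hroot 2 two_ne_zero
  have hk := sub_inv_ne_zero hq hq2
  obtain ⟨b, c, hc0, hMr⟩ := hM.exists_recurrence
  set F : ℕ → ℂ := fun n => coeffZ ((n : ℤ) - 1) (M n) with hFdef
  set g : ℕ → ℂ := fun n => coeffZ ((n : ℤ) - 2) (M n) with hgdef
  have hd := hM.natDegree
  have hself : ∀ n : ℕ, coeffZ n (M n) = 1 := fun n => by rw [coeffZ_natCast, hM.coeff_self]
  have hlt : ∀ (n : ℕ) (m : ℤ), n < m → coeffZ m (M n) = 0 :=
    fun n m hm => coeffZ_eq_zero (by rw [hd]; exact hm)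
  have hF0 : F 0 = 0 := coeffZ_of_neg (by norm_num) _
  have hg1 : g 1 = 0 := coeffZ_of_neg (by norm_num) _
  have hrec : ∀ n, M (n + 2) = X * M (n + 1) - C (b (n + 1)) * M (n + 1) - C (c n) * M n := by
    intro n
    rw [hMr, monicOfTTRR]
    ring
  have hb : ∀ n, b n = F n - F (n + 1) := by
    intro n
    cases n with
    | zero =>
      have : M 1 = X * 1 - C (b 0) * 1 := by rw [hMr, monicOfTTRR]; ring
      have h1 : F 1 = coeffZ ((1 : ℕ) - 1) (M 1) := rfl
      rw [hF0, h1, this, map_sub, coeffZ_X_mul, coeffZ_C_mul, coeffZ_one, coeffZ_one]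
      norm_num
    | succ n =>
      have h1 : F (n + 2) = coeffZ ((n + 2 : ℕ) - 1) (M (n + 2)) := rfl
      rw [h1, hrec, map_sub, map_sub, coeffZ_X_mul, coeffZ_C_mul, coeffZ_C_mul,
        hlt n _ (by push_cast; omega),
        show (((n + 2 : ℕ) : ℤ) - 1) = (n + 1 : ℕ) by push_cast; ring, hself]
      simp only [hFdef]
      ring
  have hc : ∀ n, c n = g (n + 1) - g (n + 2) - b (n + 1) * F (n + 1) := by
    intro n
    have h1 : g (n + 2) = coeffZ ((n + 2 : ℕ) - 2) (M (n + 2)) := rfl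
    rw [h1, hrec, map_sub, map_sub, coeffZ_X_mul, coeffZ_C_mul, coeffZ_C_mul,
      show (((n + 2 : ℕ) : ℤ) - 2) = n by push_cast; ring, hself]
    simp only [hFdef, hgdef]
    rw [show (((n + 1 : ℕ) : ℤ) - 2) = n - 1 by push_cast; ring,
      show (((n + 1 : ℕ) : ℤ) - 1) = n by push_cast; ring]
    ring
  have hF : ∀ n : ℕ, (x * qAvg q ((n : ℤ) - 1) + l₁ * qBracket q ((n : ℤ) - 1)) * F n +
      l₀ * qBracket q n = (x * qAvg q n + l₁ * qBracket q n) * F n := by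
    intro n
    have h1 := congrArg (coeffZ ((n : ℤ) - 1)) (hT n)
    rw [h.coeffZ_eigenoperator hq hq2 _ _ _ (by rw [hd]; omega), coeffZ_C_mul, sub_add_cancel,
      hself, hlt n ((n : ℤ) - 1 + 2) (by omega)] at h1
    simp only [hFdef]
    linear_combination h1
  have hg : ∀ n : ℕ, (x * qAvg q ((n : ℤ) - 2) + l₁ * qBracket q ((n : ℤ) - 2)) * g n +
      l₀ * qBracket q ((n : ℤ) - 1) * F n + (x * subcoeffS q n + l₁ * subcoeffD q n) =
        (x * qAvg q n + l₁ * qBracket q n) * g n := by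
    intro n
    have h1 := congrArg (coeffZ ((n : ℤ) - 2)) (hT n)
    rw [h.coeffZ_eigenoperator hq hq2 _ _ _ (by rw [hd]; omega), coeffZ_C_mul, sub_add_cancel,
      show (n : ℤ) - 2 + 1 = n - 1 by ring, hself] at h1
    simp only [hFdef, hgdef]
    linear_combination h1
  set k := q - q⁻¹ with hkdef
  -- Splitting the eigenvalue `x qAvg + l₁ qBracket` into powers gives `ρ₀ q⁻ⁿ - ρ₁ qⁿ`.
  refine ⟨x / 2 - l₁ / k, -(x / 2 + l₁ / k), 2 * l₀ / k, ?_⟩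
  have hx' : x / 2 - l₁ / k ≠ 0 ∨ -(x / 2 + l₁ / k) ≠ 0 := by
    by_contra! h0
    have h1 : x = 0 := by linear_combination h0.1 - h0.2
    have h2 : l₁ / k = 0 := by linear_combination -h0.1 / 2 - h0.2 / 2
    have h3 := (div_eq_zero_iff.1 h2).resolve_right hk
    rcases hx with hx | hx
    · exact hx h1
    · exact hx h3
  have key := recurrence_coeff_of_subleading (ς := 2 * l₀ / k) hq hroot hx' hF0 hg1
    (fun m => ?_) (fun m => ?_) hb hc hc0
  · rw [← key.2.1, ← key.2.2]
    exact ⟨key.1, hMr⟩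
  · have h1 := hF (m + 1)
    have hm := pow_ne_zero m hq
    rw [show (((m + 1 : ℕ) : ℤ) - 1) = (m : ℕ) by push_cast; ring, qAvg, qBracket, qAvg, qBracket,
      ← hkdef, zpow_natCast, zpow_natCast, pow_succ] at h1
    rw [pow_add, pow_add, pow_mul', pow_one]
    simp only [div_eq_mul_inv _ k] at h1 ⊢
    generalize k⁻¹ = j at *
    generalize q ^ m = y at *
    field_simp at h1
    linear_combination -h1
  · have h1 := hg (m + 1)
    have hm := pow_ne_zero m hq
    rw [subcoeffS, subcoeffD, show (((m + 1 : ℕ) : ℤ) - 2) = (m : ℕ) - 1 by push_cast; ring,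
      show (((m + 1 : ℕ) : ℤ) - 1) = (m : ℕ) by push_cast; ring, qAvg, qBracket, qBracket, qAvg,
      qBracket, ← hkdef, zpow_sub_one₀ hq, zpow_natCast, zpow_natCast, pow_succ] at h1
    rw [pow_add, pow_add, pow_mul', pow_one]
    simp only [div_eq_mul_inv _ k] at h1 ⊢
    push_cast at h1
    generalize k⁻¹ = j at *
    generalize q ^ m = y at *
    field_simp at h1
    linear_combination -h1 / 8

/-! ### Identification with Askey-Wilson polynomials and passage to the limit. -/

theorem awB_succ_aux {p y A B : ℂ} (hp : p ≠ 0) (hq1 : 1 - p ^ 2 ≠ 0)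
    (h1 : 1 + A * B * (p ^ 2 * y ^ 2) ≠ 0) (h2 : 1 + A * B * (p ^ 4 * y ^ 2) ≠ 0)
    (h3 : 1 + A * B * (p ^ 6 * y ^ 2) ≠ 0) :
    (p + 1 / p - (1 + p ^ 4 * y) * (1 - p ^ 3 * A * y) * (1 - p ^ 3 * B * y) *
        (1 + A * B * (p ^ 2 * y)) / (p * (1 + A * B * (p ^ 4 * y ^ 2)) *
          (1 + A * B * (p ^ 6 * y ^ 2))) -
      p * (1 - p ^ 2 * y) * (1 + p * A * y) * (1 + p * B * y) * (1 - A * B * y) /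
        ((1 + A * B * (p ^ 4 * y ^ 2)) * (1 + A * B * (p ^ 2 * y ^ 2)))) / 2 =
      -(A + B) * (1 - p ^ 4 * y ^ 2) / (2 * (1 - p ^ 2) * (1 + A * B * (p ^ 2 * y ^ 2))) -
        -(A + B) * (1 - p ^ 8 * y ^ 2) / (2 * (1 - p ^ 2) * (1 + A * B * (p ^ 6 * y ^ 2))) := by
  generalize e0 : 1 - p ^ 2 = r at *
  generalize e1 : 1 + A * B * (p ^ 2 * y ^ 2) = d₁ at *
  generalize e2 : 1 + A * B * (p ^ 4 * y ^ 2) = d₂ at *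
  generalize e3 : 1 + A * B * (p ^ 6 * y ^ 2) = d₃ at *
  field_simp
  rw [← e0, ← e1, ← e2, ← e3]
  ring

/-- The recurrence coefficients of the Askey-Wilson polynomials with parameters
`√q, -√q, A, B`. -/
theorem awB_eq_pencilB {p ε A B : ℂ} (hp : p ≠ 0) (hq1 : 1 - p ^ 2 ≠ 0) (hε : ε ≠ 0)
    (hne : ∀ m : ℕ, ε + ε * (A * B) * (p ^ 2) ^ (m + 1) ≠ 0) (n : ℕ) :
    awB (p ^ 2) p (-p) A B n = pencilB (p ^ 2) ε (ε * (A * B)) (ε * (A + B)) n := by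
  have hne' : ∀ m : ℕ, 1 + A * B * (p ^ 2) ^ (m + 1) ≠ 0 := fun m h0 =>
    hne m (by linear_combination ε * h0)
  have hε' : ∀ z, ε + ε * (A * B) * z = ε * (1 + A * B * z) := fun z => by ring
  have hσ : ∀ z, 1 - p * -p * A * B * z = 1 + A * B * (p ^ 2 * z) := fun z => by ring
  rw [awB, pencilB]
  cases n with
  | zero =>
    have h1 := hne' 0
    rw [zero_add, pow_one] at h1
    have h2 : 1 - p * -p * A * B = 1 + A * B * p ^ 2 := by ring
    rw [coeffA, coeffC, subleading, subleading, hε', h2, mul_zero, zero_add, zero_add, pow_one]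
    generalize h3 : 1 - p ^ 2 = r at *
    generalize h4 : 1 + A * B * p ^ 2 = d at *
    field_simp
    rw [← h3, ← h4]
    ring
  | succ k =>
    have e1 : p ^ 2 * ((p ^ 2) ^ k) ^ 2 = (p ^ 2) ^ (2 * k + 1) := by ring
    have e2 : p ^ 4 * ((p ^ 2) ^ k) ^ 2 = (p ^ 2) ^ (2 * k + 1 + 1) := by ring
    have e3 : p ^ 6 * ((p ^ 2) ^ k) ^ 2 = (p ^ 2) ^ (2 * k + 2 + 1) := by ring
    have h1 := hne' (2 * k)
    have h2 := hne' (2 * k + 1)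
    have h3 := hne' (2 * k + 2)
    rw [← e1] at h1
    rw [← e2] at h2
    rw [← e3] at h3
    have key := awB_succ_aux hp hq1 h1 h2 h3
    have s1 : subleading (p ^ 2) ε (ε * (A * B)) (ε * (A + B)) (k + 1) =
        -(A + B) * (1 - p ^ 4 * ((p ^ 2) ^ k) ^ 2) /
          (2 * (1 - p ^ 2) * (1 + A * B * (p ^ 2 * ((p ^ 2) ^ k) ^ 2))) := by
      refine Eq.trans ?_ (mul_div_mul_left _ _ hε)
      rw [subleading]
      congr 1 <;> ring
    have s2 : subleading (p ^ 2) ε (ε * (A * B)) (ε * (A + B)) (k + 1 + 1) =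
        -(A + B) * (1 - p ^ 8 * ((p ^ 2) ^ k) ^ 2) /
          (2 * (1 - p ^ 2) * (1 + A * B * (p ^ 6 * ((p ^ 2) ^ k) ^ 2))) := by
      refine Eq.trans ?_ (mul_div_mul_left _ _ hε)
      rw [subleading]
      congr 1 <;> ring
    rw [s1, s2, ← key, coeffA, coeffC]
    congr 3
    · congr 1 <;> ring
    · ring
    · ring

/-- `pencilC` is homogeneous of degree zero in its three parameters, so `ε` cancels: the third power
for `n = 0`, the fourth otherwise. -/
theorem awCsucc_eq_pencilC {p ε A B : ℂ} (hε : ε ≠ 0) (n : ℕ) :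
    awCsucc (p ^ 2) p (-p) A B n = pencilC (p ^ 2) ε (ε * (A * B)) (ε * (A + B)) n := by
  cases n with
  | zero =>
    rw [awCsucc, pencilC]
    refine (mul_div_mul_left _ _ (pow_ne_zero 3 hε)).symm.trans ?_
    congr 1 <;> ring
  | succ k =>
    rw [awCsucc, pencilC]
    refine (mul_div_mul_left _ _ (pow_ne_zero 4 hε)).symm.trans ?_
    congr 1 <;> ring

/-- With `q = p²`, the four factors that pair `±p` with `A` or `B` multiply to `(1 + AB q^(2n+1))² -
(A + B)² q^(2n+1)`. The pair `p, -p` gives `1 + q^(n+1)`, nonzero since `q` is not a root of unity.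
-/
theorem admissible_of_ne {p ε A B : ℂ} (hp : p ≠ 0) (hroot : ∀ n : ℕ, n ≠ 0 → (p ^ 2) ^ n ≠ 1)
    (hne : ∀ m : ℕ, ε + ε * (A * B) * (p ^ 2) ^ (m + 1) ≠ 0)
    (hne' : ∀ m : ℕ, ε - ε * (A * B) * (p ^ 2) ^ m ≠ 0)
    (hne'' : ∀ m : ℕ, (ε + ε * (A * B) * (p ^ 2) ^ (2 * m + 1)) ^ 2 -
      (ε * (A + B)) ^ 2 * (p ^ 2) ^ (2 * m + 1) ≠ 0) :
    Admissible (p ^ 2) p (-p) A B := by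
  refine ⟨hp, fun n => ?_⟩
  have h0 : 1 + (p ^ 2) ^ (n + 1) ≠ 0 := fun h0 =>
    hroot (2 * (n + 1)) (by omega) (by
      rw [two_mul, pow_add]; linear_combination ((p ^ 2) ^ (n + 1) - 1) * h0)
  have h := mul_ne_zero (mul_ne_zero (mul_ne_zero (hne n) (hne' n)) (hne'' n)) h0
  intro hz
  apply h
  linear_combination ε ^ 4 * hz

theorem tendsto_coeff_monicOfTTRR {b c : ℕ → ℕ → ℂ} {b' c' : ℕ → ℂ}
    (hb : ∀ n, Tendsto (fun k => b k n) atTop (𝓝 (b' n)))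
    (hc : ∀ n, Tendsto (fun k => c k n) atTop (𝓝 (c' n))) (n j : ℕ) :
    Tendsto (fun k => (monicOfTTRR (b k) (c k) n).coeff j) atTop
      (𝓝 ((monicOfTTRR b' c' n).coeff j)) := by
  induction n using Nat.twoStepInduction generalizing j with
  | zero => exact tendsto_const_nhds
  | one =>
    simp only [monicOfTTRR, coeff_sub, coeff_C]
    refine tendsto_const_nhds.sub ?_
    split_ifs
    · exact hb 0
    · exact tendsto_const_nhds
  | more n ih₀ ih₁ =>
    simp only [monicOfTTRR, sub_mul, coeff_sub, coeff_C_mul]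
    refine (Tendsto.sub ?_ ((hb _).mul (ih₁ j))).sub ((hc _).mul (ih₀ j))
    cases j with
    | zero => simp only [coeff_X_mul_zero]; exact tendsto_const_nhds
    | succ j => simp only [coeff_X_mul]; exact ih₁ j

theorem tendsto_subleading {q ρ₀ ρ₁ ς : ℂ} (hq1 : 1 - q ≠ 0)
    (hne : ∀ m : ℕ, ρ₀ + ρ₁ * q ^ (m + 1) ≠ 0) {ε : ℕ → ℂ} (hε : Tendsto ε atTop (𝓝 ρ₀)) (n : ℕ) :
    Tendsto (fun k => subleading q (ε k) ρ₁ ς n) atTop (𝓝 (subleading q ρ₀ ρ₁ ς n)) := by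
  cases n with
  | zero => exact tendsto_const_nhds
  | succ n =>
    simp only [subleading]
    exact tendsto_const_nhds.div (tendsto_const_nhds.mul (hε.add tendsto_const_nhds))
      (mul_ne_zero (mul_ne_zero two_ne_zero hq1) (hne _))

theorem tendsto_pencilC {q ρ₀ ρ₁ ς : ℂ}
    (hne : ∀ m : ℕ, ρ₀ + ρ₁ * q ^ (m + 1) ≠ 0) {ε : ℕ → ℂ} (hε : Tendsto ε atTop (𝓝 ρ₀)) (n : ℕ) :
    Tendsto (fun k => pencilC q (ε k) ρ₁ ς n) atTop (𝓝 (pencilC q ρ₀ ρ₁ ς n)) := by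
  have h4 : (4 : ℂ) ≠ 0 := by norm_num
  have ht : ∀ z, Tendsto (fun k => ε k + ρ₁ * z) atTop (𝓝 (ρ₀ + ρ₁ * z)) :=
    fun z => hε.add tendsto_const_nhds
  cases n with
  | zero =>
    have h1 := hne 0
    rw [zero_add, pow_one] at h1
    simp only [pencilC]
    exact ((tendsto_const_nhds.mul (hε.sub tendsto_const_nhds)).mul
      (((ht _).pow 2).sub tendsto_const_nhds)).div
        (tendsto_const_nhds.mul (((ht _).pow 2).mul (ht _)))
        (mul_ne_zero h4 (mul_ne_zero (pow_ne_zero _ h1) (hne 1)))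
  | succ n =>
    simp only [pencilC]
    exact ((tendsto_const_nhds.mul ((hε.pow 2).sub tendsto_const_nhds)).mul
      (((ht _).pow 2).sub tendsto_const_nhds)).div
        (tendsto_const_nhds.mul (((ht _).mul ((ht _).pow 2)).mul (ht _)))
        (mul_ne_zero h4 (mul_ne_zero (mul_ne_zero (hne _) (pow_ne_zero _ (hne _))) (hne _)))

/-- Outside a countable set of values of `ε` no Askey-Wilson parameter condition is violated. -/
theorem exists_tendsto_generic {p : ℂ} (ρ₀ ρ₁ ς : ℂ) :
    ∃ ε : ℕ → ℂ, Tendsto ε atTop (𝓝 ρ₀) ∧ ∀ k, ε k ≠ 0 ∧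
      (∀ m : ℕ, ε k + ρ₁ * (p ^ 2) ^ (m + 1) ≠ 0) ∧ (∀ m : ℕ, ε k - ρ₁ * (p ^ 2) ^ m ≠ 0) ∧
      ∀ m : ℕ, (ε k + ρ₁ * (p ^ 2) ^ (2 * m + 1)) ^ 2 - ς ^ 2 * (p ^ 2) ^ (2 * m + 1) ≠ 0 := by
  let bad : Set ℂ := {0} ∪ Set.range (fun m : ℕ => -ρ₁ * (p ^ 2) ^ (m + 1)) ∪
    Set.range (fun m : ℕ => ρ₁ * (p ^ 2) ^ m) ∪
    Set.range (fun m : ℕ => -ρ₁ * (p ^ 2) ^ (2 * m + 1) + ς * p ^ (2 * m + 1)) ∪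
    Set.range (fun m : ℕ => -ρ₁ * (p ^ 2) ^ (2 * m + 1) - ς * p ^ (2 * m + 1))
  have hbad : bad.Countable :=
    ((((Set.countable_singleton 0).union (Set.countable_range _)).union
      (Set.countable_range _)).union (Set.countable_range _)).union (Set.countable_range _)
  obtain ⟨ε, hε, ht⟩ := mem_closure_iff_seq_limit.1 (hbad.dense_compl ℝ ρ₀)
  refine ⟨ε, ht, fun k => ⟨fun h0 => hε k ?_, fun m h0 => hε k ?_, fun m h0 => hε k ?_,
    fun m h0 => ?_⟩⟩
  · exact .inl (.inl (.inl (.inl h0)))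
  · exact .inl (.inl (.inl (.inr ⟨m, by linear_combination -h0⟩)))
  · exact .inl (.inl (.inr ⟨m, by linear_combination -h0⟩))
  · have h1 : (ε k + ρ₁ * (p ^ 2) ^ (2 * m + 1) - ς * p ^ (2 * m + 1)) *
        (ε k + ρ₁ * (p ^ 2) ^ (2 * m + 1) + ς * p ^ (2 * m + 1)) = 0 := by
      rw [← h0]; ring
    rcases mul_eq_zero.1 h1 with h | h
    · exact hε k (.inl (.inr ⟨m, by linear_combination -h⟩))
    · exact hε k (.inr ⟨m, by linear_combination -h⟩)

theorem exists_add_mul_eq (s t : ℂ) : ∃ A B : ℂ, A + B = s ∧ A * B = t := by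
  obtain ⟨z, hz⟩ := IsAlgClosed.exists_pow_nat_eq (s ^ 2 - 4 * t) two_pos
  exact ⟨(s + z) / 2, (s - z) / 2, by ring, by linear_combination -hz / 4⟩

/-- Only `ρ₀` is perturbed, with `ρ₁` and `ς` fixed. The denominators stay away from zero in the
limit by `hne`, so the recurrence coefficients converge even when `ρ₀ = 0` and the parameters `A`,
`B` cannot remain bounded. -/
theorem isAskeyWilsonOrLimit_pencil {q : ℝ} (hq : 0 < q) (hq1 : q < 1) {ρ₀ ρ₁ ς : ℂ}
    (hne : ∀ m : ℕ, ρ₀ + ρ₁ * (q : ℂ) ^ (m + 1) ≠ 0) :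
    IsAskeyWilsonOrLimit q (monicOfTTRR (pencilB q ρ₀ ρ₁ ς) (pencilC q ρ₀ ρ₁ ς)) := by
  have hp := qHalf_ne_zero hq
  have hpq := qHalf_sq hq
  have hroot : ∀ n : ℕ, n ≠ 0 → (q : ℂ) ^ n ≠ 1 := fun n hn => by
    exact_mod_cast (pow_lt_one₀ hq.le hq1 hn).ne
  have hq1' : 1 - (q : ℂ) ≠ 0 := sub_ne_zero.2 (by simpa using (hroot 1 one_ne_zero).symm)
  obtain ⟨ε, ht, hε⟩ := exists_tendsto_generic (p := qHalf q) ρ₀ ρ₁ ς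
  choose A B hsum hprod using fun k => exists_add_mul_eq (ς / ε k) (ρ₁ / ε k)
  have hs : ∀ k, ε k * (A k + B k) = ς := fun k => by
    rw [hsum, mul_div_cancel₀ _ (hε k).1]
  have hm : ∀ k, ε k * (A k * B k) = ρ₁ := fun k => by
    rw [hprod, mul_div_cancel₀ _ (hε k).1]
  refine ⟨fun k => ![qHalf q, -qHalf q, A k, B k], fun k => ?_, fun n j => ?_⟩
  · obtain ⟨-, h1, h2, h3⟩ := hε k
    have := admissible_of_ne (ε := ε k) (A := A k) (B := B k) hp
      (by rw [hpq]; exact hroot) (by rw [hm]; exact h1) (by rw [hm]; exact h2)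
      (by rw [hm, hs]; exact h3)
    rw [hpq] at this
    exact this
  · have haw : ∀ k, awPoly q (qHalf q) (-qHalf q) (A k) (B k) =
        monicOfTTRR (pencilB q (ε k) ρ₁ ς) (pencilC q (ε k) ρ₁ ς) := by
      intro k
      obtain ⟨h0, h1, -, -⟩ := hε k
      rw [awPoly]
      congr 1
      · refine _root_.funext fun n => ?_
        have := awB_eq_pencilB (A := A k) (B := B k) hp (by rwa [hpq]) h0
          (by rw [hm]; exact h1) n
        rwa [hpq, hm, hs] at this
      · refine _root_.funext fun n => ?_
        have := awCsucc_eq_pencilC (p := qHalf q) (A := A k) (B := B k) h0 n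
        rwa [hpq, hm, hs] at this
    show Tendsto (fun k => (awPoly q (qHalf q) (-qHalf q) (A k) (B k) n).coeff j) atTop _
    simp only [haw]
    refine tendsto_coeff_monicOfTTRR (fun m => ?_) (fun m => tendsto_pencilC hne ht m) n j
    exact (tendsto_subleading hq1' hne ht m).sub (tendsto_subleading hq1' hne ht (m + 1))

/-! ### Normalization and conclusion. -/

/-- Every OPS is, up to normalization, a monic OPS. -/
theorem IsOPS.exists_monic {P : ℕ → ℂ[X]} (hP : IsOPS P) :
    ∃ (u : ℂ[X] →ₗ[ℂ] ℂ) (M : ℕ → ℂ[X]) (k : ℕ → ℂ), IsMonicOPS u M ∧ (∀ n, k n ≠ 0) ∧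
      ∀ n, P n = C (k n) * M n := by
  obtain ⟨hdeg, u, horth, hnorm⟩ := hP
  have h0 : ∀ n, P n ≠ 0 := fun n h => by
    have := hdeg n
    rw [h, degree_zero] at this
    exact absurd this (by simp)
  have hk : ∀ n, (P n).leadingCoeff ≠ 0 := fun n => leadingCoeff_ne_zero.2 (h0 n)
  have hPM : ∀ n, P n = C (P n).leadingCoeff * (C ((P n).leadingCoeff)⁻¹ * P n) := fun n => by
    rw [← mul_assoc, ← C_mul, mul_inv_cancel₀ (hk n), C_1, one_mul]
  have hpair : ∀ n m, u (C ((P n).leadingCoeff)⁻¹ * P n * (C ((P m).leadingCoeff)⁻¹ * P m)) =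
      ((P n).leadingCoeff)⁻¹ * (((P m).leadingCoeff)⁻¹ * u (P n * P m)) := fun n m => by
    rw [← functional_C_mul, ← functional_C_mul]
    congr 1
    ring
  refine ⟨u, fun n => C ((P n).leadingCoeff)⁻¹ * P n, fun n => (P n).leadingCoeff,
    ⟨fun n => ?_, fun n => ?_, fun n m hnm => ?_, fun n => ?_⟩, hk, hPM⟩
  · rw [mul_comm]
    exact monic_mul_leadingCoeff_inv (h0 n)
  · rw [natDegree_C_mul (inv_ne_zero (hk n))]
    exact natDegree_eq_of_degree_eq_some (hdeg n)
  · rw [hpair, horth n m hnm, mul_zero, mul_zero]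
  · rw [hpair]
    exact mul_ne_zero (inv_ne_zero (hk n)) (mul_ne_zero (inv_ne_zero (hk n)) (hnorm n))

end AskeyWilson

open AskeyWilson in
theorem theorem3p2 (q : ℝ) (hq0 : 0 < q) (hq1 : q < 1)
    (P : ℕ → Polynomial ℂ) (hP : AskeyWilson.IsOPS P)
    (a b c : ℂ) (aSeq bSeq cSeq : ℕ → ℂ) (hc : ∀ n : ℕ, 1 ≤ n → cSeq n ≠ 0)
    (hrel : ∀ n : ℕ,
      (Polynomial.C a * Polynomial.X ^ 2 + Polynomial.C b * Polynomial.X + Polynomial.C c) *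
          AskeyWilson.Dq q (AskeyWilson.Sq q (P n)) =
        Polynomial.C (aSeq n) * P (n + 1) + Polynomial.C (bSeq n) * P n +
          Polynomial.C (cSeq n) * (if n = 0 then 0 else P (n - 1))) :
    ∃ (Q : ℕ → Polynomial ℂ) (r s : ℂ) (k : ℕ → ℂ),
      AskeyWilson.IsAskeyWilsonOrLimit q Q ∧ r ≠ 0 ∧ (∀ n : ℕ, k n ≠ 0) ∧
        ∀ n : ℕ, P n =
          Polynomial.C (k n) * (Q n).comp (Polynomial.C r * Polynomial.X + Polynomial.C s) := by
  obtain ⟨u, M, k, hM, hk, hPM⟩ := hP.exists_monic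
  obtain ⟨D, S, h, β, hβ, hDS⟩ := exists_isShiftPair hq0 hq1
  have hq : (q : ℂ) ≠ 0 := by exact_mod_cast hq0.ne'
  have hrootN : ∀ n : ℕ, n ≠ 0 → (q : ℂ) ^ n ≠ 1 := fun n hn => by
    exact_mod_cast (pow_lt_one₀ hq0.le hq1 hn).ne
  have hroot : ∀ n : ℤ, n ≠ 0 → (q : ℂ) ^ n ≠ 1 := by
    intro n hn
    obtain ⟨m, rfl | rfl⟩ := n.eq_nat_or_neg
    · rw [zpow_natCast]
      exact hrootN m (by simpa using hn)
    · rw [zpow_neg, zpow_natCast, ne_eq, inv_eq_one]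
      exact hrootN m (by simpa using hn)
  have hE : ∀ n (f : ℂ[X]), β * k n * u ((C a * X ^ 2 + C b * X + C c) * D (M n) * f) =
      aSeq n * k (n + 1) * u (M (n + 1) * f) + bSeq n * k n * u (M n * f) +
        cSeq n * (if n = 0 then 0 else k (n - 1) * u (M (n - 1) * f)) := by
    intro n f
    have h1 := congrArg (fun g => u (g * f)) (hrel n)
    simp only [hDS, hPM n, hPM (n + 1), map_C_mul] at h1
    generalize C a * X ^ 2 + C b * X + C c = π at h1 ⊢
    rw [show π * (C β * (C (k n) * D (M n))) * f = C β * (C (k n) * (π * D (M n) * f)) by ring, add_mul, add_mul,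
      map_add, map_add] at h1
    simp only [mul_assoc (C _), functional_C_mul] at h1
    rw [mul_assoc, h1]
    split_ifs with hn
    · simp only [zero_mul, map_zero]; ring
    · rw [hPM, mul_assoc, functional_C_mul]; ring
  have hE0 : ∀ n i, i + 1 < n → u ((C a * X ^ 2 + C b * X + C c) * D (M n) * M i) = 0 := by
    intro n i hi
    have h1 := hE n (M i)
    rw [hM.orth _ _ (by omega), hM.orth _ _ (by omega), hM.orth _ _ (by omega), mul_zero, mul_zero,
      mul_zero, ite_self, mul_zero, add_zero, add_zero] at h1
    exact (mul_eq_zero.1 h1).resolve_left (mul_ne_zero hβ (hk n))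
  -- Pairing the relation for `n = 1` with `M 0` shows that `u π` is a nonzero multiple of `c_1
  -- u(M_0²)`.
  have hπ : u (C a * X ^ 2 + C b * X + C c) ≠ 0 := by
    intro h0
    have h1 := hE 1 (M 0)
    have h2 : D (M 1) = 1 := by
      rw [(hM.monic 1).eq_X_add_C (hM.natDegree 1), map_add, h.D_X, ← mul_one (C _), map_C_mul,
        h.D_one, mul_zero, add_zero]
    rw [hM.orth _ _ (by omega), hM.orth _ _ (by omega), h2, hM.zero_eq_one, mul_one, mul_one, h0,
      if_neg one_ne_zero, Nat.sub_self, mul_zero, mul_zero, mul_zero, zero_add, zero_add] at h1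
    refine mul_ne_zero (hc 1 le_rfl) (mul_ne_zero (hk 0) (hM.norm_ne_zero 0)) ?_
    rw [hM.zero_eq_one] at *
    exact h1.symm
  obtain ⟨x, l₁, l₀, hx, hT⟩ := hM.exists_eigenoperator hq hroot h hE0 hπ
  obtain ⟨ρ₀, ρ₁, ς, hne, hMp⟩ := hM.exists_pencil hq hrootN h hx hT
  -- The identity serves as affine map: the monic polynomials already have the required form in the
  -- given variable.
  refine ⟨M, 1, 0, k, hMp ▸ isAskeyWilsonOrLimit_pencil hq0 hq1 hne, one_ne_zero, hk, fun n => ?_⟩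
  simpa using hPM n
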